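/- Fix a non-negative integer $d$. Let $R_Z(\theta)$ be the gate $|x\rangle\mapsto e^{i\theta x}|x\rangle$ ($x\in\{0,1\}$). A circuit on $n$ qubits is a product of gates, each acting on one or two of the $n$ qubits (no ancillas). There is an algorithm with the following property, whose running time is bounded by a polynomial (depending only on $d$) in the number $n$ of qubits and the number of gates of the input circuit. Let the input be an $n$-qubit circuit over $\{\mathrm{CNOT}, H, R_Z(\pi/2^d), R_Z(2\pi/2^d)\}$, implementing the unitary $U$, that has the form $$U = C_f\, U_0 \prod_{i=1}^{h}\bigl[H_{\alpha_i} U_i\bigr]\, C_{init},$$ where $h\ge 0$, $C_f$ and $C_{init}$ are circuits over $\{\mathrm{CNOT}, H, R_Z(2\pi/2^d)\}$, $H_{\alpha_i}$ is the Hadamard gate on a qubit $\alpha_i$, and $U_0,\dots,U_h$ are circuits over $\{\mathrm{CNOT}, R_Z(\pi/2^d), R_Z(2\pi/2^d)\}$. Then the algorithm outputs an $n$-qubit circuit over $\{\mathrm{CNOT}, H, R_Z(\pi/2^d), R_Z(2\pi/2^d)\}$ that implements $U$ and in which the number of $R_Z(\pi/2^d)$ gates is at most $$\sum_{i=0}^{d}\binom{n}{i}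 + h\left(\sum_{i=0}^{d-1}\binom{n-1}{i}+1\right).$$ In particular, for $d=2$ (Clifford$+T$ circuits, $T=R_Z(\pi/4)$), the number of $T$ gates is at most $\frac{(n+1)(n+2h)}{2}+1$. -/

import Mathlib

namespace RzCount

/-! ### Gates, circuits and the unitaries they implement -/

/-- The gates on `n` qubits: CNOT (with control `c` and target `t`), the Hadamard gate `H`,
`rot a`, which is `R_Z(π/2^d)` on qubit `a`, and `rotTwo a`, which is `R_Z(2π/2^d)` on
qubit `a`. The parameter `d` enters only in the matrix of the gate, `Gate.matrix`. -/
inductive Gate (n : ℕ) : Type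
  | cnot (c t : Fin n) (hct : c ≠ t) : Gate n
  | had (a : Fin n) : Gate n
  | rot (a : Fin n) : Gate n
  | rotTwo (a : Fin n) : Gate n

/-- Operators on `n` qubits, as matrices in the computational basis `|x⟩`,
`x ∈ {0, 1}^n`; row index first. -/
abbrev Operator (n : ℕ) : Type := Matrix (Fin n → Bool) (Fin n → Bool) ℂ

/-- `|x⟩ ↦ |x'⟩`, where `x'` is `x` with the bit `x_t` replaced by `x_t ⊕ x_c`. -/
def cnotMatrix {n : ℕ} (c t : Fin n) : Operator n :=
  fun y x => if y = Function.update x t (xor (x t) (x c)) then 1 else 0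

/-- The Hadamard gate on qubit `a`: the entry at `(y, x)` is `(-1)^(x_a y_a) / √2` if `x` and `y`
agree outside `a`, and `0` otherwise. -/
noncomputable def hadMatrix {n : ℕ} (a : Fin n) : Operator n :=
  fun y x =>
    if ∀ j, j ≠ a → y j = x j then
      (if y a = true ∧ x a = true then -1 else 1) / (Real.sqrt 2 : ℂ)
    else 0

/-- `R_Z(θ)` on qubit `a`: `|x⟩ ↦ exp(i θ x_a) |x⟩`. -/
noncomputable def rzMatrix {n : ℕ} (θ : ℝ) (a : Fin n) : Operator n :=
  Matrix.diagonal fun x => if x a = true then Complex.exp (Complex.I * (θ : ℂ)) else 1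

/-- The matrix of a gate, for the gate set with parameter `d`. -/
noncomputable def Gate.matrix {n : ℕ} (d : ℕ) : Gate n → Operator n
  | Gate.cnot c t _ => cnotMatrix c t
  | Gate.had a => hadMatrix a
  | Gate.rot a => rzMatrix (Real.pi / 2 ^ d) a
  | Gate.rotTwo a => rzMatrix (2 * Real.pi / 2 ^ d) a

/-- A circuit on `n` qubits (no ancillas), written as a product of operators: the head of the list
is the leftmost factor, so it is the gate applied last. -/
abbrev Circuit (n : ℕ) : Type := List (Gate n)

/-- The unitary implemented by a circuit (equality of such unitaries is exact, not only up to a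
global phase). -/
noncomputable def Circuit.unitary {n : ℕ} (d : ℕ) (C : Circuit n) : Operator n :=
  (C.map (Gate.matrix d)).prod

/-- `true` exactly on the `R_Z(π/2^d)` gates. -/
def Gate.isRot {n : ℕ} : Gate n → Bool
  | Gate.rot _ => true
  | _ => false

/-- `true` exactly on the Hadamard gates. -/
def Gate.isHad {n : ℕ} : Gate n → Bool
  | Gate.had _ => true
  | _ => false

/-- The number of `R_Z(π/2^d)` gates of a circuit. -/
def Circuit.rotCount {n : ℕ} (C : Circuit n) : ℕ := C.countP Gate.isRot

/-- `C` is a circuit over `{CNOT, H, R_Z(2π/2^d)}`. -/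
def Circuit.RotFree {n : ℕ} (C : Circuit n) : Prop := ∀ g ∈ C, g.isRot = false

/-- `C` is a circuit over `{CNOT, R_Z(π/2^d), R_Z(2π/2^d)}`. -/
def Circuit.HadFree {n : ℕ} (C : Circuit n) : Prop := ∀ g ∈ C, g.isHad = false

/-! ### A programming language with a running time

Programs transform finite binary trees (S-expressions). Every elementary operation is charged the
size of the whole tree that it is applied to, so that copying and discarding data is paid for; the
size of an output never exceeds the time that was spent. Running times are therefore the same as
those of Turing machines up to polynomial overhead, in both directions. -/

/-- Binary trees. -/
inductive Datum : Type
  | nil : Datum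
  | cons (l r : Datum) : Datum

/-- The number of nodes and leaves of a tree. -/
def Datum.size : Datum → ℕ
  | Datum.nil => 1
  | Datum.cons l r => l.size + r.size + 1

def Datum.head : Datum → Datum
  | Datum.nil => Datum.nil
  | Datum.cons l _ => l

def Datum.tail : Datum → Datum
  | Datum.nil => Datum.nil
  | Datum.cons _ r => r

/-- Programs. As a condition, `nil` means false and every other tree means true. -/
inductive Program : Type
  | ident : Program
  | nil : Program
  | head : Program
  | tail : Program
  | pair (f g : Program) : Program
  | comp (f g : Program) : Program
  | ite (c f g : Program) : Program
  | loop (c f : Program) : Program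

/-- `Runs P x y t`: started on input `x`, the program `P` halts with output `y` after time `t`. -/
inductive Runs : Program → Datum → Datum → ℕ → Prop
  | ident (x : Datum) : Runs Program.ident x x x.size
  | nil (x : Datum) : Runs Program.nil x Datum.nil x.size
  | head (x : Datum) : Runs Program.head x x.head x.size
  | tail (x : Datum) : Runs Program.tail x x.tail x.size
  /-- Run `f` and `g` on two copies of the input, and pair the results. -/
  | pair {f g : Program} {x y z : Datum} {s t : ℕ} :
      Runs f x y s → Runs g x z t →
      Runs (Program.pair f g) x (Datum.cons y z) (s + t + x.size)
  /-- First `g`, then `f`. -/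
  | comp {f g : Program} {x y z : Datum} {s t : ℕ} :
      Runs g x y s → Runs f y z t →
      Runs (Program.comp f g) x z (s + t + x.size)
  | iteTrue {c f g : Program} {x u v y : Datum} {s t : ℕ} :
      Runs c x (Datum.cons u v) s → Runs f x y t →
      Runs (Program.ite c f g) x y (s + t + x.size)
  | iteFalse {c f g : Program} {x y : Datum} {s t : ℕ} :
      Runs c x Datum.nil s → Runs g x y t →
      Runs (Program.ite c f g) x y (s + t + x.size)
  /-- While the condition `c` holds, replace the current tree by its image under `f`. -/
  | loopStop {c f : Program} {x : Datum} {s : ℕ} :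
      Runs c x Datum.nil s →
      Runs (Program.loop c f) x x (s + x.size)
  | loopStep {c f : Program} {x u v y z : Datum} {s t r : ℕ} :
      Runs c x (Datum.cons u v) s → Runs f x y t → Runs (Program.loop c f) y z r →
      Runs (Program.loop c f) x z (s + t + r + x.size)

/-! ### Circuits as data -/

/-- Natural numbers in unary; they occur only as numbers of qubits, qubits and tags. -/
def encodeNat : ℕ → Datum
  | 0 => Datum.nil
  | k + 1 => Datum.cons Datum.nil (encodeNat k)

def encodeGate {n : ℕ} : Gate n → Datum
  | Gate.cnot c t _ =>
      Datum.cons (encodeNat 0) (Datum.cons (encodeNat c.val) (encodeNat t.val))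
  | Gate.had a => Datum.cons (encodeNat 1) (encodeNat a.val)
  | Gate.rot a => Datum.cons (encodeNat 2) (encodeNat a.val)
  | Gate.rotTwo a => Datum.cons (encodeNat 3) (encodeNat a.val)

/-- A circuit is encoded as the list of its gates. -/
def encodeCircuit {n : ℕ} : Circuit n → Datum
  | [] => Datum.nil
  | g :: C => Datum.cons (encodeGate g) (encodeCircuit C)

/-- The input of an algorithm: the number of qubits and a circuit. -/
def encodeInput {n : ℕ} (C : Circuit n) : Datum :=
  Datum.cons (encodeNat n) (encodeCircuit C)

end RzCount

open RzCount

namespace RzCount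

/-! ### Programs with a time bound -/

/-! Put `ω = exp(iπ/2^d)`. A diagonal operator `x ↦ ω ^ (∑ q ∈ Q, par q x)` is stored as its list
`Q` of parities. Only the sum modulo `2^(d+1)` matters, and parities taken twice are realized by
`R_Z(2π/2^d)` gates, so the cost lies in the parities of odd multiplicity.

The algebra rests on `expand`. Applying `u ⊕ v = u + v - 2uv` and `2uv = u + v - (u ⊕ v)`
repeatedly, a parity `q` is congruent modulo `2^(d+1)` to a sum of parities from a fixed pool, whose
multiplicities modulo 2 are polynomials of degree at most `d+1` in the bits of `q` (`wt_expand`,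
`degLe_count_expand`). Hence if every monomial of degree at most `d+1` sums to zero over `Q ++ E`
(`Null (d+2)`), all multiplicities are even, and `Q` is implemented by one `R_Z(π/2^d)` for each
nonzero member of `E` together with `R_Z(2π/2^d)` gates and CNOTs.

A small `E` comes from linear algebra. If `Q` has more members than there are monomials of degree
less than `k`, some nonempty sublist `S` is `Null k` (`exists_dependency`). Differences lower the
degree, so `S` followed by its translate `S + z` is `Null (k+1)` (`Null.shift`), and `S` may be
replaced by `S + z`. Choosing `z` so that some member becomes a fixed parity `b`, and discarding the
copies of `b`, shortens the list. Iteration leaves at most `∑_{i<k} C(n,i)` parities, and possibly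
one copy of `b` (`reduce_spec`).

The circuit is read from its leftmost factor, with a pending diagonal operator at the right end of
what has been emitted (`Pending`). CNOT gates transform the pending parities, and rotations join or
commute with them. At a Hadamard gate on `a`, only the parities that contain `a` obstruct. For them
degree `d` is enough, because only the members of the expansion that contain `a` have to cancel
(`count_flatMap_expand_of_bit`); as `a` is constantly present, `n-1` variables remain, and the cost
is `∑_{i<d} C(n-1,i) + 1` (`had_spec`). What is left over avoids `a` and commutes with the gate. At
the end `b` is the zero parity, which needs no gate, and the cost is `∑_{i≤d} C(n,i)`
(`pending_finish`).

Hadamard gates of `C_f` are free because nothing is pending yet, and those of `C_init` because the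
maximal rotation-free end of the list is set aside (`optimize_spec`). For the running time,
leftovers are distinct members of a pool of polynomial size, so each gate adds a bounded number of
pending parities (`length_extract_le`); the rest is a library of polynomial-time combinators built
on `PolyTime.foldl`. -/

theorem Datum.size_pos (x : Datum) : 1 ≤ x.size := by
  cases x <;> simp [Datum.size]

theorem Datum.size_head_le (x : Datum) : x.head.size ≤ x.size := by
  cases x <;> simp [Datum.size, Datum.head]
  omega

theorem Datum.size_tail_le (x : Datum) : x.tail.size ≤ x.size := by
  cases x <;> simp [Datum.size, Datum.tail]
  omega

/-- Every time bound is thereby also a bound for the output size, which is what lets polynomial time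
bounds be composed. -/
theorem Runs.size_le {P : Program} {x y : Datum} {t : ℕ} (h : Runs P x y t) : y.size ≤ t := by
  induction h with
  | ident x => exact le_rfl
  | nil x => exact x.size_pos
  | head x => exact x.size_head_le
  | tail x => exact x.size_tail_le
  | pair _ _ ih₁ ih₂ =>
    rename_i x y z s t _ _
    have := x.size_pos
    simp only [Datum.size]
    omega
  | comp _ _ _ _ => omega
  | iteTrue _ _ _ _ => omega
  | iteFalse _ _ _ _ => omega
  | loopStop _ _ => omega
  | loopStep _ _ _ _ _ _ => omega

/-- `P` takes `x` to `y` within time `T`. -/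
def RunsLe (P : Program) (x y : Datum) (T : ℕ) : Prop := ∃ t, Runs P x y t ∧ t ≤ T

namespace RunsLe

variable {P f g c : Program} {x y z u v : Datum} {S T R : ℕ}

theorem mono (h : RunsLe P x y S) (hST : S ≤ T) : RunsLe P x y T :=
  ⟨h.choose, h.choose_spec.1, h.choose_spec.2.trans hST⟩

theorem size_le (h : RunsLe P x y T) : y.size ≤ T :=
  h.choose_spec.1.size_le.trans h.choose_spec.2

theorem ident (x : Datum) : RunsLe Program.ident x x x.size := ⟨_, .ident x, le_rfl⟩

theorem nil (x : Datum) : RunsLe Program.nil x Datum.nil x.size := ⟨_, .nil x, le_rfl⟩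

theorem head (x : Datum) : RunsLe Program.head x x.head x.size := ⟨_, .head x, le_rfl⟩

theorem tail (x : Datum) : RunsLe Program.tail x x.tail x.size := ⟨_, .tail x, le_rfl⟩

theorem pair (hf : RunsLe f x y S) (hg : RunsLe g x z T) :
    RunsLe (.pair f g) x (.cons y z) (S + T + x.size) := by
  obtain ⟨s, hs, hsS⟩ := hf
  obtain ⟨t, ht, htT⟩ := hg
  exact ⟨_, .pair hs ht, by omega⟩

theorem comp (hg : RunsLe g x y S) (hf : RunsLe f y z T) :
    RunsLe (.comp f g) x z (S + T + x.size) := by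
  obtain ⟨s, hs, hsS⟩ := hg
  obtain ⟨t, ht, htT⟩ := hf
  exact ⟨_, .comp hs ht, by omega⟩

theorem iteTrue (hc : RunsLe c x (.cons u v) S) (hf : RunsLe f x y T) :
    RunsLe (.ite c f g) x y (S + T + x.size) := by
  obtain ⟨s, hs, hsS⟩ := hc
  obtain ⟨t, ht, htT⟩ := hf
  exact ⟨_, .iteTrue hs ht, by omega⟩

theorem iteFalse (hc : RunsLe c x .nil S) (hg : RunsLe g x y T) :
    RunsLe (.ite c f g) x y (S + T + x.size) := by
  obtain ⟨s, hs, hsS⟩ := hc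
  obtain ⟨t, ht, htT⟩ := hg
  exact ⟨_, .iteFalse hs ht, by omega⟩

theorem loopStop (hc : RunsLe c x .nil S) : RunsLe (.loop c f) x x (S + x.size) := by
  obtain ⟨s, hs, hsS⟩ := hc
  exact ⟨_, .loopStop hs, by omega⟩

theorem loopStep (hc : RunsLe c x (.cons u v) S) (hf : RunsLe f x y T)
    (hl : RunsLe (.loop c f) y z R) : RunsLe (.loop c f) x z (S + T + R + x.size) := by
  obtain ⟨s, hs, hsS⟩ := hc
  obtain ⟨t, ht, htT⟩ := hf
  obtain ⟨r, hr, hrR⟩ := hl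
  exact ⟨_, .loopStep hs ht hr, by omega⟩

end RunsLe

theorem eval_monotone (p : Polynomial ℕ) : Monotone fun n => p.eval n := by
  intro a b hab
  simp only [Polynomial.eval_eq_sum_range]
  gcongr

/-! ### Encodings and functions computable in polynomial time -/

/-- Types whose elements are represented by trees. -/
class Enc (α : Type) where
  enc : α → Datum

/-- The size of the representation. -/
def sz {α : Type} [Enc α] (x : α) : ℕ := (Enc.enc x).size

instance : Enc Datum := ⟨id⟩

instance : Enc Bool := ⟨fun b => if b then .cons .nil .nil else .nil⟩

instance : Enc ℕ := ⟨encodeNat⟩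

instance {α β : Type} [Enc α] [Enc β] : Enc (α × β) := ⟨fun x => .cons (Enc.enc x.1) (Enc.enc x.2)⟩

/-- The representation of a list. -/
def encodeList {α : Type} [Enc α] : List α → Datum
  | [] => .nil
  | a :: l => .cons (Enc.enc a) (encodeList l)

instance {α : Type} [Enc α] : Enc (List α) := ⟨encodeList⟩

section

variable {α β γ σ : Type} [Enc α] [Enc β] [Enc γ] [Enc σ]

theorem sz_pos (x : α) : 1 ≤ sz x := Datum.size_pos _

theorem enc_prod (a : α) (b : β) : Enc.enc (a, b) = .cons (Enc.enc a) (Enc.enc b) := rfl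

theorem enc_nil : Enc.enc ([] : List α) = .nil := rfl

theorem enc_cons (a : α) (l : List α) : Enc.enc (a :: l) = .cons (Enc.enc a) (Enc.enc l) := rfl

theorem sz_prod (a : α) (b : β) : sz (a, b) = sz a + sz b + 1 := rfl

theorem sz_nil : sz ([] : List α) = 1 := rfl

theorem sz_cons (a : α) (l : List α) : sz (a :: l) = sz a + sz l + 1 := rfl

theorem sz_fst_le (x : α × β) : sz x.1 ≤ sz x := by
  have : sz x = sz x.1 + sz x.2 + 1 := sz_prod x.1 x.2
  omega

theorem sz_snd_le (x : α × β) : sz x.2 ≤ sz x := by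
  have : sz x = sz x.1 + sz x.2 + 1 := sz_prod x.1 x.2
  omega

theorem sz_append (l m : List α) : sz (l ++ m) + 1 = sz l + sz m := by
  induction l with
  | nil => simp [sz_nil]; omega
  | cons a l ih => simp only [List.cons_append, sz_cons]; omega

theorem length_le_sz (l : List α) : l.length ≤ sz l := by
  induction l with
  | nil => simp
  | cons a l ih =>
    simp only [List.length_cons, sz_cons]
    omega

theorem sz_le_of_mem {a : α} {l : List α} (h : a ∈ l) : sz a ≤ sz l := by
  induction l with
  | nil => simp at h
  | cons b l ih =>
    rw [sz_cons]
    rcases List.mem_cons.1 h with rfl | h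
    · omega
    · have := ih h
      omega

theorem sz_list_le {l : List α} {M : ℕ} (h : ∀ a ∈ l, sz a ≤ M) :
    sz l ≤ l.length * (M + 1) + 1 := by
  induction l with
  | nil => simp [sz_nil]
  | cons b l ih =>
    have h₁ := h b (by simp)
    have h₂ := ih fun a ha => h a (by simp [ha])
    rw [sz_cons, List.length_cons, add_mul]
    omega

theorem sz_le_of_prefix {l m : List α} (h : l <+: m) : sz l ≤ sz m := by
  obtain ⟨k, rfl⟩ := h
  have := sz_append l k
  have := sz_pos k
  omega

theorem sz_le_of_suffix {l m : List α} (h : l <:+ m) : sz l ≤ sz m := by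
  obtain ⟨k, rfl⟩ := h
  have := sz_append k l
  have := sz_pos k
  omega

theorem sz_reverse (l : List α) : sz l.reverse = sz l := by
  induction l with
  | nil => rfl
  | cons a l ih =>
    have := sz_append l.reverse [a]
    simp only [List.reverse_cons, sz_cons, sz_nil] at *
    omega

theorem sz_flatten_le (l : List (List α)) : sz l.flatten ≤ sz l := by
  induction l with
  | nil => rfl
  | cons a l ih =>
    have := sz_append a l.flatten
    rw [List.flatten_cons, sz_cons]
    omega

theorem sz_bool_le (b : Bool) : sz b ≤ 3 := by
  cases b <;> simp [sz, Enc.enc, Datum.size]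

theorem sz_bits_le (l : List Bool) : sz l ≤ l.length * 4 + 1 :=
  sz_list_le fun b _ => sz_bool_le b

theorem sz_nat (n : ℕ) : sz n = 2 * n + 1 := by
  induction n with
  | zero => rfl
  | succ n ih =>
    have : sz (n + 1) = 1 + sz n + 1 := rfl
    omega

/-- `f` is at most a polynomial in the size of its argument. -/
def PolyBound (f : α → ℕ) : Prop := ∃ p : Polynomial ℕ, ∀ x, f x ≤ p.eval (sz x)

namespace PolyBound

variable {f g : α → ℕ}

theorem mono (hg : PolyBound g) (h : ∀ x, f x ≤ g x) : PolyBound f :=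
  ⟨hg.choose, fun x => (h x).trans (hg.choose_spec x)⟩

theorem const (c : ℕ) : PolyBound fun _ : α => c := ⟨Polynomial.C c, fun x => by simp⟩

theorem size : PolyBound fun x : α => sz x := ⟨Polynomial.X, fun x => by simp⟩

theorem add (hf : PolyBound f) (hg : PolyBound g) : PolyBound fun x => f x + g x := by
  obtain ⟨p, hp⟩ := hf
  obtain ⟨q, hq⟩ := hg
  exact ⟨p + q, fun x => by rw [Polynomial.eval_add]; exact Nat.add_le_add (hp x) (hq x)⟩

theorem mul (hf : PolyBound f) (hg : PolyBound g) : PolyBound fun x => f x * g x := by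
  obtain ⟨p, hp⟩ := hf
  obtain ⟨q, hq⟩ := hg
  exact ⟨p * q, fun x => by rw [Polynomial.eval_mul]; exact Nat.mul_le_mul (hp x) (hq x)⟩

theorem eval (p : Polynomial ℕ) (hf : PolyBound f) : PolyBound fun x => p.eval (f x) := by
  obtain ⟨q, hq⟩ := hf
  exact ⟨p.comp q, fun x => by rw [Polynomial.eval_comp]; exact eval_monotone p (hq x)⟩

theorem comp {h : β → ℕ} (hh : PolyBound h) {k : α → β} (hk : PolyBound fun x => sz (k x)) :
    PolyBound fun x => h (k x) := by
  obtain ⟨p, hp⟩ := hh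
  exact (hk.eval p).mono fun x => hp _

end PolyBound

/-- `f` is computed by a program in time polynomial in the size of the argument. -/
def PolyTime (f : α → β) : Prop :=
  ∃ (P : Program) (T : α → ℕ), PolyBound T ∧ ∀ x, RunsLe P (Enc.enc x) (Enc.enc (f x)) (T x)

namespace PolyTime

theorem sz_bound {f : α → β} (hf : PolyTime f) : PolyBound fun x => sz (f x) := by
  obtain ⟨P, T, hT, hP⟩ := hf
  exact hT.mono fun x => (hP x).size_le

theorem id : PolyTime fun x : α => x :=
  ⟨.ident, _, .size, fun _ => RunsLe.ident _⟩

theorem comp {g : β → γ} {f : α → β} (hg : PolyTime g) (hf : PolyTime f) :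
    PolyTime fun x => g (f x) := by
  have hs := hf.sz_bound
  obtain ⟨P, T, hT, hP⟩ := hf
  obtain ⟨Q, S, hS, hQ⟩ := hg
  exact ⟨.comp Q P, fun x => T x + S (f x) + sz x, (hT.add (hS.comp hs)).add .size,
    fun x => (hP x).comp (hQ _)⟩

theorem pair {f : α → β} {g : α → γ} (hf : PolyTime f) (hg : PolyTime g) :
    PolyTime fun x => (f x, g x) := by
  obtain ⟨P, T, hT, hP⟩ := hf
  obtain ⟨Q, S, hS, hQ⟩ := hg
  exact ⟨.pair P Q, fun x => T x + S x + sz x, (hT.add hS).add .size, fun x => (hP x).pair (hQ x)⟩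

/-- A program sees only trees, so a function may be replaced by one into another type whose values
have the same encodings. Changes of representation below cost nothing. -/
theorem of_enc {f : α → β} {g : α → γ} (hg : PolyTime g) (h : ∀ x, Enc.enc (f x) = Enc.enc (g x)) :
    PolyTime f := by
  obtain ⟨P, T, hT, hP⟩ := hg
  exact ⟨P, T, hT, fun x => by rw [h]; exact hP x⟩

theorem const (c : β) : PolyTime fun _ : α => c := by
  suffices h : ∀ D : Datum, PolyTime fun _ : α => D from (h (Enc.enc c)).of_enc fun _ => rfl
  intro D
  induction D with
  | nil => exact ⟨.nil, _, .size, fun _ => RunsLe.nil _⟩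
  | cons l r ihl ihr => exact (ihl.pair ihr).of_enc fun _ => rfl

theorem datumHead {f : α → Datum} (hf : PolyTime f) : PolyTime fun x => (f x).head :=
  comp (g := Datum.head) ⟨.head, _, .size, fun _ => RunsLe.head _⟩ hf

theorem datumTail {f : α → Datum} (hf : PolyTime f) : PolyTime fun x => (f x).tail :=
  comp (g := Datum.tail) ⟨.tail, _, .size, fun _ => RunsLe.tail _⟩ hf

theorem datum {f : α → β} (hf : PolyTime f) : PolyTime fun x => Enc.enc (f x) :=
  hf.of_enc fun _ => rfl

theorem fst {f : α → β × γ} (hf : PolyTime f) : PolyTime fun x => (f x).1 :=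
  hf.datum.datumHead.of_enc fun _ => rfl

theorem snd {f : α → β × γ} (hf : PolyTime f) : PolyTime fun x => (f x).2 :=
  hf.datum.datumTail.of_enc fun _ => rfl

/-- A conditional whose condition is any computable tree, as in `Program.ite`. -/
theorem iteDatum {c : α → Datum} {b : α → Bool} {f g : α → β} (hc : PolyTime c) (hf : PolyTime f)
    (hg : PolyTime g) (hb : ∀ x, b x = false ↔ c x = .nil) :
    PolyTime fun x => if b x then f x else g x := by
  obtain ⟨P, T, hT, hP⟩ := hf
  obtain ⟨Q, S, hS, hQ⟩ := hg
  obtain ⟨R, V, hV, hR⟩ := hc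
  refine ⟨.ite R P Q, fun x => V x + (T x + S x) + sz x, (hV.add (hT.add hS)).add .size,
    fun x => ?_⟩
  have hRx := hR x
  cases hbx : b x
  · rw [(hb x).1 hbx] at hRx
    simp only [hbx, Bool.false_eq_true, if_false]
    refine (hRx.iteFalse (hQ x)).mono ?_
    change V x + S x + sz x ≤ V x + (T x + S x) + sz x
    omega
  · cases hcx : c x with
    | nil => exact absurd ((hb x).2 hcx) (by simp [hbx])
    | cons u v =>
      rw [hcx] at hRx
      simp only [hbx, if_true]
      refine (hRx.iteTrue (hP x)).mono ?_
      change V x + T x + sz x ≤ V x + (T x + S x) + sz x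
      omega

theorem ite {c : α → Bool} {f g : α → β} (hc : PolyTime c) (hf : PolyTime f)
    (hg : PolyTime g) : PolyTime fun x => if c x then f x else g x :=
  iteDatum hc.datum hf hg fun x => by cases c x <;> simp [Enc.enc]

theorem cons {f : α → β} {g : α → List β} (hf : PolyTime f) (hg : PolyTime g) :
    PolyTime fun x => f x :: g x :=
  (hf.pair hg).of_enc fun _ => rfl

theorem listTail {f : α → List β} (hf : PolyTime f) : PolyTime fun x => (f x).tail :=
  hf.datum.datumTail.of_enc fun x => by cases f x <;> rfl

theorem isEmpty {f : α → List β} (hf : PolyTime f) : PolyTime fun x => (f x).isEmpty := by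
  have := iteDatum (b := fun x => !(f x).isEmpty) hf.datum (const false) (const true)
    fun x => by cases f x <;> simp [enc_nil, enc_cons]
  refine this.of_enc fun x => ?_
  cases f x <;> simp

theorem headD {f : α → List β} {g : α → β} (hf : PolyTime f) (hg : PolyTime g) :
    PolyTime fun x => (f x).headD (g x) := by
  refine (ite hf.isEmpty hg.datum hf.datum.datumHead).of_enc fun x => ?_
  cases f x <;> simp [Enc.enc, Datum.head, encodeList]

theorem not {f : α → Bool} (hf : PolyTime f) : PolyTime fun x => !f x :=
  (ite hf (const false) (const true)).of_enc fun x => by cases f x <;> rfl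

theorem and {f g : α → Bool} (hf : PolyTime f) (hg : PolyTime g) : PolyTime fun x => f x && g x :=
  (ite hf hg (const false)).of_enc fun x => by cases f x <;> rfl

theorem xor {f g : α → Bool} (hf : PolyTime f) (hg : PolyTime g) :
    PolyTime fun x => Bool.xor (f x) (g x) :=
  (ite hf hg.not hg).of_enc fun x => by cases f x <;> simp

end PolyTime

/-! ### Folds and structural recursion in polynomial time. -/

/-- The loop that runs through a list: on `(x, l, s)`, while `l` is nonempty, replace `s` by the
result of `P` on `(x, s, l.head)` and `l` by its tail. -/
def foldProgram (P : Program) : Program :=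
  .loop (.comp .head .tail)
    (.pair .head
      (.pair (.comp .tail (.comp .head .tail))
        (.comp P (.pair .head (.pair (.comp .tail .tail) (.comp .head (.comp .head .tail)))))))

/-- `M` bounds the list and every accumulator that occurs, `K` bounds one call of `P`; the factor 20
generously covers the rearrangement of the triple in one round. -/
theorem runsLe_foldProgram {P : Program} {step : α → σ → β → σ} {T : α × σ × β → ℕ}
    (hP : ∀ p : α × σ × β, RunsLe P (Enc.enc p) (Enc.enc (step p.1 p.2.1 p.2.2)) (T p))
    (x : α) (M K : ℕ) (l : List β) (s : σ) (hl : sz l ≤ M)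
    (hM : ∀ l', l' <+: l → sz (l'.foldl (step x) s) ≤ M)
    (hK : ∀ s b, sz s ≤ M → sz b ≤ M → T (x, s, b) ≤ K) :
    RunsLe (foldProgram P) (Enc.enc (x, l, s)) (Enc.enc (x, ([] : List β), l.foldl (step x) s))
      ((l.length + 1) * (K + 20 * (sz x + 3 * M + 2))) := by
  induction l generalizing s with
  | nil =>
    have hs : sz s ≤ M := hM [] (by simp)
    have h₁ := ((RunsLe.tail (Enc.enc (x, ([] : List β), s))).comp (RunsLe.head _))
    have h₂ : RunsLe (foldProgram P) _ _ _ := RunsLe.loopStop h₁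
    refine h₂.mono ?_
    have := sz_pos x
    simp only [sz] at *
    simp only [enc_prod, enc_nil, Datum.size, Datum.tail] at *
    simp only [List.length_nil, zero_add, one_mul]
    omega
  | cons b l ih =>
    have hs : sz s ≤ M := hM [] (by simp)
    have hb : sz b ≤ M := by rw [sz_cons] at hl; omega
    have hl' : sz l ≤ M := by rw [sz_cons] at hl; omega
    have hK' := hK s b hs hb
    set X := Enc.enc (x, b :: l, s) with hX
    have hc := ((RunsLe.tail X).comp (RunsLe.head _))
    have hbody := (RunsLe.head X).pair
      ((((RunsLe.tail X).comp (RunsLe.head _)).comp (RunsLe.tail _)).pair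
        (((RunsLe.head X).pair
          (((RunsLe.tail X).comp (RunsLe.tail _)).pair
            (((RunsLe.tail X).comp (RunsLe.head _)).comp (RunsLe.head _)))).comp
          (hP (x, s, b))))
    have hrec := ih (step x s b) hl' fun l' hl'' => hM (b :: l') (by simpa using hl'')
    have h := RunsLe.loopStep hc hbody hrec
    refine RunsLe.mono h ?_
    rw [List.length_cons, Nat.succ_mul (l.length + 1)]
    simp only [sz] at *
    simp only [hX, enc_prod, enc_cons, Datum.size, Datum.tail, Datum.head] at *
    omega

namespace PolyTime

/-- A loop of polynomial-time steps can take exponential time if its state keeps growing. The bound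
`B` on all intermediate states excludes this: the number of rounds is the length of the list, and
each round is polynomial in a polynomially bounded size. -/
theorem foldl {l : α → List β} {init : α → σ} {step : α → σ → β → σ} {B : α → ℕ}
    (hl : PolyTime l) (hi : PolyTime init)
    (hs : PolyTime fun p : α × σ × β => step p.1 p.2.1 p.2.2) (hB : PolyBound B)
    (hb : ∀ x l', l' <+: l x → sz (l'.foldl (step x) (init x)) ≤ B x) :
    PolyTime fun x => (l x).foldl (step x) (init x) := by
  have hstart := id.pair (hl.pair hi)
  obtain ⟨P, T, hT, hP⟩ := hs
  obtain ⟨p, hp⟩ := hT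
  have hloop : ∃ (Q : Program) (V : α → ℕ), PolyBound V ∧ ∀ x, RunsLe Q
      (Enc.enc (x, l x, init x)) (Enc.enc ((l x).foldl (step x) (init x))) (V x) := by
    let N : α → ℕ := fun x => ((l x).length + 1) *
      (p.eval (sz x + 2 * (sz (l x) + B x) + 2) + 20 * (sz x + 3 * (sz (l x) + B x) + 2))
    -- The loop ends with the triple `(x, [], result)`; two tails extract the result.
    refine ⟨.comp .tail (.comp .tail (foldProgram P)), fun x => N x
      + sz (x, ([] : List β), (l x).foldl (step x) (init x)) + sz (x, l x, init x)
      + sz (([] : List β), (l x).foldl (step x) (init x)) + sz (x, l x, init x), ?_, fun x => ?_⟩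
    · have hl' := hl.sz_bound
      have hi' := hi.sz_bound
      have hr : PolyBound fun x => sz ((l x).foldl (step x) (init x)) :=
        hB.mono fun x => hb x _ (List.prefix_refl _)
      have hn : PolyBound fun x => (l x).length := hl'.mono fun x => length_le_sz _
      have hx : PolyBound fun x : α => sz x := .size
      have h₁ : PolyBound fun x => sz (l x) + B x := hl'.add hB
      have h₂ : PolyBound fun x => p.eval (sz x + 2 * (sz (l x) + B x) + 2) :=
        ((hx.add ((PolyBound.const 2).mul h₁)).add (.const 2)).eval p
      have h₃ : PolyBound N :=
        (hn.add (.const 1)).mul (h₂.add ((PolyBound.const 20).mul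
          ((hx.add ((PolyBound.const 3).mul h₁)).add (.const 2))))
      have h₄ : PolyBound fun x => sz (x, l x, init x) :=
        ((hx.add ((hl'.add hi').add (.const 1))).add (.const 1))
      have h₅ : PolyBound fun x => sz (x, ([] : List β), (l x).foldl (step x) (init x)) :=
        ((hx.add (((PolyBound.const 1).add hr).add (.const 1))).add (.const 1))
      have h₆ : PolyBound fun x => sz (([] : List β), (l x).foldl (step x) (init x)) :=
        (((PolyBound.const 1).add hr).add (.const 1))
      exact (((h₃.add h₅).add h₄).add h₆).add h₄
    · have h := runsLe_foldProgram (step := step) hP x (sz (l x) + B x)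
        (p.eval (sz x + 2 * (sz (l x) + B x) + 2)) (l x) (init x)
        (by omega) (fun l' hl' => (hb x l' hl').trans (by omega))
        (fun s b hs hb => (hp _).trans (eval_monotone p (by
          simp only [sz_prod]; omega)))
      exact (h.comp (RunsLe.tail _)).comp (RunsLe.tail _)
  obtain ⟨Q, V, hV, hQ⟩ := hloop
  obtain ⟨R, W, hW, hR⟩ := hstart
  exact ⟨.comp Q R, _, (hW.add hV).add .size, fun x => (hR x).comp (hQ x)⟩

theorem reverse {l : α → List β} (hl : PolyTime l) : PolyTime fun x => (l x).reverse := by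
  have h := foldl (step := fun (_ : α) (s : List β) (b : β) => b :: s) (B := fun x => sz (l x))
    hl (const []) (cons id.snd.snd id.snd.fst) hl.sz_bound fun x l' h => by
      simpa [sz_reverse] using sz_le_of_prefix h
  simpa using h

/-- Structural recursion over a list is in polynomial time when its values stay small. -/
theorem listRec {f : α → List β → σ} {step : α → β → List β → σ → σ} {l : α → List β}
    (hl : PolyTime l) (hnil : PolyTime fun x => f x [])
    (hs : PolyTime fun p : α × β × List β × σ => step p.1 p.2.1 p.2.2.1 p.2.2.2)
    (hb : PolyBound fun p : α × List β => sz (f p.1 p.2))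
    (hcons : ∀ x b l, f x (b :: l) = step x b l (f x l)) :
    PolyTime fun x => f x (l x) := by
  obtain ⟨p, hp⟩ := hb
  -- Folding over the reversed list visits the suffixes from short to long. The suffix already
  -- treated is carried along because `step` may refer to it.
  let step' : α → List β × σ → β → List β × σ := fun x s b => (b :: s.1, step x b s.1 s.2)
  have key : ∀ x (l : List β), l.reverse.foldl (step' x) ([], f x []) = (l, f x l) := by
    intro x l
    induction l with
    | nil => rfl
    | cons b l ih => simp [ih, step', hcons]
  have h := foldl (step := step') (init := fun x => ([], f x [])) (l := fun x => (l x).reverse)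
    (B := fun x => sz (l x) + p.eval (sz x + sz (l x) + 1) + 1) hl.reverse ((const []).pair hnil)
    (by
      have h₁ : PolyTime fun p : α × (List β × σ) × β => p.2.2 := id.snd.snd
      have h₂ : PolyTime fun p : α × (List β × σ) × β => p.2.1.1 := id.snd.fst.fst
      have h₃ : PolyTime fun p : α × (List β × σ) × β => p.2.1.2 := id.snd.fst.snd
      exact (h₁.cons h₂).pair (hs.comp (id.fst.pair (h₁.pair (h₂.pair h₃)))))
    ((hl.sz_bound.add (((PolyBound.size.add hl.sz_bound).add (.const 1)).eval p)).add (.const 1))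
    (fun x l' hl' => by
      have h₁ : l'.reverse <:+ l x := by simpa using List.reverse_suffix.2 hl'
      have h₂ := key x l'.reverse
      rw [List.reverse_reverse] at h₂
      rw [h₂, sz_prod]
      have h₃ := sz_le_of_suffix h₁
      have h₄ := (hp (x, l'.reverse)).trans (eval_monotone p (show _ ≤ sz x + sz (l x) + 1 by
        rw [sz_prod]; omega))
      simp only at h₄
      omega)
  refine h.snd.of_enc fun x => ?_
  rw [key]

end PolyTime

end

/-! ### Standard functions computable in polynomial time -/

section

variable {α β γ σ : Type} [Enc α] [Enc β] [Enc γ] [Enc σ]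

namespace PolyTime

theorem append {l m : α → List β} (hl : PolyTime l) (hm : PolyTime m) :
    PolyTime fun x => l x ++ m x := by
  have h : PolyTime fun p : List β × List β => p.1 ++ p.2 :=
    listRec (f := fun (p : List β × List β) (l : List β) => l ++ p.2)
      (step := fun _ b _ acc => b :: acc) id.fst id.snd (cons id.snd.fst id.snd.snd.snd)
      (PolyBound.size.mono fun p => by
        have h₁ := sz_append p.2 p.1.2
        have h₂ := sz_snd_le p.1
        have h₃ := sz_prod p.1 p.2
        simp only [Prod.mk.eta] at h₃
        omega)
      fun _ _ _ => rfl
  exact h.comp (hl.pair hm)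

theorem flatten {l : α → List (List β)} (hl : PolyTime l) : PolyTime fun x => (l x).flatten :=
  listRec (f := fun (_ : α) (l : List (List β)) => l.flatten) (step := fun _ b _ acc => b ++ acc)
    hl (const []) (append id.snd.fst id.snd.snd.snd)
    (PolyBound.size.mono fun p => (sz_flatten_le p.2).trans (sz_snd_le p)) fun _ _ _ => rfl

theorem map {l : α → List β} {g : α → β → γ} (hl : PolyTime l)
    (hg : PolyTime fun p : α × β => g p.1 p.2) : PolyTime fun x => (l x).map (g x) := by
  obtain ⟨p, hp⟩ := hg.sz_bound
  refine listRec (f := fun (x : α) (l : List β) => l.map (g x))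
    (step := fun x b _ acc => g x b :: acc) hl (const [])
    (cons (hg.comp (id.fst.pair id.snd.fst)) id.snd.snd.snd) ?_ fun _ _ _ => rfl
  have h : PolyBound fun q : α × List β => sz q * (p.eval (sz q) + 1) + 1 :=
    (PolyBound.size.mul ((PolyBound.size.eval p).add (.const 1))).add (.const 1)
  refine h.mono fun q => ?_
  have h₁ : sz (q.2.map (g q.1)) ≤ (q.2.map (g q.1)).length * (p.eval (sz q) + 1) + 1 := by
    refine sz_list_le fun c hc => ?_
    obtain ⟨b, hb, rfl⟩ := List.mem_map.1 hc
    refine (hp (q.1, b)).trans (eval_monotone p ?_)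
    have h₂ := sz_le_of_mem hb
    have h₃ : sz q = sz q.1 + sz q.2 + 1 := sz_prod q.1 q.2
    rw [sz_prod]
    omega
  refine h₁.trans ?_
  rw [List.length_map]
  gcongr
  exact (length_le_sz q.2).trans (sz_snd_le q)

theorem flatMap {l : α → List β} {g : α → β → List γ} (hl : PolyTime l)
    (hg : PolyTime fun p : α × β => g p.1 p.2) : PolyTime fun x => (l x).flatMap (g x) := by
  simpa only [List.flatMap_def] using (map hl hg).flatten

theorem filter {l : α → List β} {g : α → β → Bool} (hl : PolyTime l)
    (hg : PolyTime fun p : α × β => g p.1 p.2) : PolyTime fun x => (l x).filter (g x) := by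
  have h := flatMap (g := fun x b => if g x b then [b] else []) hl
    (ite hg (cons id.snd (const [])) (const []))
  refine h.of_enc fun x => ?_
  congr 1
  induction l x with
  | nil => rfl
  | cons b l ih => cases hb : g x b <;> simp [hb, ih]

theorem any {l : α → List β} {g : α → β → Bool} (hl : PolyTime l)
    (hg : PolyTime fun p : α × β => g p.1 p.2) : PolyTime fun x => (l x).any (g x) := by
  refine (filter hl hg).isEmpty.not.of_enc fun x => ?_
  congr 1
  induction l x with
  | nil => rfl
  | cons b l ih => cases hb : g x b <;> simp [hb, ih]

theorem succ {f : α → ℕ} (hf : PolyTime f) : PolyTime fun x => f x + 1 :=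
  ((const Datum.nil).pair hf).of_enc fun _ => rfl

theorem pred {f : α → ℕ} (hf : PolyTime f) : PolyTime fun x => f x - 1 :=
  hf.datum.datumTail.of_enc fun x => by cases f x <;> rfl

theorem isZero {f : α → ℕ} (hf : PolyTime f) : PolyTime fun x => f x == 0 := by
  have := iteDatum (b := fun x => !(f x == 0)) hf.datum (const false) (const true)
    fun x => by cases f x <;> simp [Enc.enc, encodeNat]
  refine this.of_enc fun x => ?_
  cases f x <;> simp

/-- Unary numerals and lists of `nil` are the same trees, so recursion over numbers is recursion
over lists. -/
theorem enc_replicate_nil (n : ℕ) : Enc.enc (List.replicate n Datum.nil) = Enc.enc n := by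
  induction n with
  | zero => rfl
  | succ n ih =>
    rw [List.replicate_succ, enc_cons, ih]
    rfl

theorem natRec {f : α → ℕ → σ} {step : α → ℕ → σ → σ} {n : α → ℕ}
    (hn : PolyTime n) (hzero : PolyTime fun x => f x 0)
    (hs : PolyTime fun p : α × ℕ × σ => step p.1 p.2.1 p.2.2)
    (hb : PolyBound fun p : α × ℕ => sz (f p.1 p.2))
    (hsucc : ∀ x k, f x (k + 1) = step x k (f x k)) :
    PolyTime fun x => f x (n x) := by
  have hlen : PolyTime fun p : List Datum => p.length := by
    refine listRec (f := fun (_ : List Datum) (l : List Datum) => l.length)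
      (step := fun _ _ _ acc => acc + 1) id (const 0) id.snd.snd.snd.succ ?_ fun _ _ _ => rfl
    refine (((PolyBound.const 2).mul .size).add (.const 1)).mono fun p => ?_
    rw [sz_nat]
    have h₁ := length_le_sz p.2
    have h₂ := sz_snd_le p
    omega
  have hrep : PolyTime fun x => List.replicate (n x) Datum.nil :=
    hn.of_enc fun x => enc_replicate_nil _
  have h := listRec (f := fun x (l : List Datum) => f x l.length)
    (step := fun x _ l acc => step x l.length acc) hrep hzero
    (hs.comp (id.fst.pair ((hlen.comp id.snd.snd.fst).pair id.snd.snd.snd)))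
    (hb.comp (k := fun p : α × List Datum => (p.1, p.2.length))
      (id.fst.pair (hlen.comp id.snd)).sz_bound)
    fun x b l => hsucc x l.length
  simpa using h

theorem length {l : α → List β} (hl : PolyTime l) : PolyTime fun x => (l x).length := by
  refine listRec (f := fun (_ : α) (l : List β) => l.length)
    (step := fun _ _ _ acc => acc + 1) hl (const 0) id.snd.snd.snd.succ ?_ fun _ _ _ => rfl
  refine (((PolyBound.const 2).mul .size).add (.const 1)).mono fun p => ?_
  rw [sz_nat]
  have h₁ := length_le_sz p.2
  have h₂ := sz_snd_le p
  omega

theorem sub {f g : α → ℕ} (hf : PolyTime f) (hg : PolyTime g) : PolyTime fun x => f x - g x := by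
  have h : PolyTime fun p : ℕ × ℕ => p.1 - p.2 :=
    natRec (f := fun (p : ℕ × ℕ) k => p.1 - k) (step := fun _ _ acc => acc - 1) id.snd id.fst
      id.snd.snd.pred (PolyBound.size.mono fun p => by
        have h₁ := sz_fst_le p
        have h₂ := sz_fst_le p.1
        rw [sz_nat] at *
        omega) fun _ _ => rfl
  exact h.comp (hf.pair hg)

theorem natEq {f g : α → ℕ} (hf : PolyTime f) (hg : PolyTime g) : PolyTime fun x => f x == g x := by
  refine ((hf.sub hg).isZero.and (hg.sub hf).isZero).of_enc fun x => ?_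
  congr 1
  rw [Bool.eq_iff_iff]
  simp
  omega

theorem replicate {n : α → ℕ} {b : α → β} (hn : PolyTime n) (hb : PolyTime b) :
    PolyTime fun x => List.replicate (n x) (b x) := by
  have h : PolyTime fun p : ℕ × β => List.replicate p.1 p.2 :=
    natRec (f := fun (p : ℕ × β) k => List.replicate k p.2) (step := fun p _ acc => p.2 :: acc)
      id.fst (const []) (cons id.fst.snd id.snd.snd)
      (((PolyBound.size.mul (PolyBound.size.add (.const 1))).add (.const 1)).mono fun p => by
        refine (sz_list_le (M := sz p) fun a ha => ?_).trans ?_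
        · rw [(List.mem_replicate.1 ha).2]
          exact (sz_snd_le p.1).trans (sz_fst_le p)
        · rw [List.length_replicate]
          have h₁ := sz_snd_le p
          rw [sz_nat] at h₁
          gcongr
          omega) fun _ _ => List.replicate_succ
  exact h.comp (hn.pair hb)

theorem range {n : α → ℕ} (hn : PolyTime n) : PolyTime fun x => List.range (n x) := by
  refine natRec (f := fun (_ : α) k => List.range k) (step := fun _ k acc => acc ++ [k])
    hn (const []) (append id.snd.snd (cons id.snd.fst (const []))) ?_ fun _ _ => List.range_succ
  refine ((PolyBound.size.mul (PolyBound.size.add (.const 1))).add (.const 1)).mono fun p => ?_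
  have h₁ := sz_snd_le p
  rw [sz_nat] at h₁
  refine (sz_list_le (M := sz p) fun a ha => ?_).trans ?_
  · have := List.mem_range.1 ha
    rw [sz_nat]
    omega
  · rw [List.length_range]
    gcongr
    omega

theorem drop {n : α → ℕ} {l : α → List β} (hn : PolyTime n) (hl : PolyTime l) :
    PolyTime fun x => (l x).drop (n x) :=
  natRec (f := fun x k => (l x).drop k) (step := fun _ _ acc => acc.tail)
    hn hl id.snd.snd.listTail
    ((hl.sz_bound.comp (k := fun p : α × ℕ => p.1) id.fst.sz_bound).mono fun p =>
      sz_le_of_suffix (List.drop_suffix _ _)) fun x k => by simp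

theorem getD {n : α → ℕ} {l : α → List β} {d : α → β} (hl : PolyTime l) (hn : PolyTime n)
    (hd : PolyTime d) : PolyTime fun x => (l x).getD (n x) (d x) := by
  refine ((hn.drop hl).headD hd).of_enc fun x => ?_
  congr 1
  simp [List.getD_eq_getElem?_getD, List.headD_eq_head?_getD]

theorem zipWith {l : α → List β} {m : α → List γ} {g : α → β → γ → σ} (c : γ) (hl : PolyTime l)
    (hm : PolyTime m) (hg : PolyTime fun p : α × β × γ => g p.1 p.2.1 p.2.2) :
    PolyTime fun x => List.zipWith (g x) (l x) (m x) := by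
  -- The fold runs over the first list and consumes the second. The default `c` is read only behind
  -- the emptiness test, so its choice is irrelevant.
  let step : α → List γ × List σ → β → List γ × List σ := fun x s b =>
    (s.1.tail, if s.1.isEmpty then s.2 else s.2 ++ [g x b (s.1.headD c)])
  have key : ∀ x l (m : List γ) acc, l.foldl (step x) (m, acc)
      = (m.drop l.length, acc ++ List.zipWith (g x) l m) := by
    intro x l
    induction l with
    | nil => simp
    | cons b l ih =>
      intro m acc
      cases m with
      | nil =>
        rw [List.foldl_cons, show step x ([], acc) b = ([], acc) from rfl, ih]
        simp
      | cons a m =>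
        rw [List.foldl_cons, show step x (a :: m, acc) b = (m, acc ++ [g x b a]) from rfl, ih]
        simp
  obtain ⟨p, hp⟩ := hg.sz_bound
  have hB₀ : PolyBound fun x => sz x + sz (l x) + sz (m x) + 2 :=
    ((PolyBound.size.add hl.sz_bound).add hm.sz_bound).add (.const 2)
  have h := foldl (step := step) (l := l) (init := fun x => (m x, []))
    (B := fun x => sz (m x) + (sz (l x) * (p.eval (sz x + sz (l x) + sz (m x) + 2) + 1) + 1) + 1)
    hl (hm.pair (const []))
    (by
      have h₁ : PolyTime fun p : α × (List γ × List σ) × β => p.2.1.1 := id.snd.fst.fst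
      have h₂ : PolyTime fun p : α × (List γ × List σ) × β => p.2.1.2 := id.snd.fst.snd
      exact h₁.listTail.pair (ite h₁.isEmpty h₂ (h₂.append
        (cons (hg.comp (id.fst.pair (id.snd.snd.pair (h₁.headD (const c))))) (const [])))))
    ((hm.sz_bound.add ((hl.sz_bound.mul ((hB₀.eval p).add (.const 1))).add (.const 1))).add
      (.const 1))
    (fun x l' hl' => by
      rw [key, sz_prod, List.nil_append]
      have h₁ := sz_le_of_suffix (List.drop_suffix l'.length (m x))
      have h₂ : sz (List.zipWith (g x) l' (m x)) ≤
          sz (l x) * (p.eval (sz x + sz (l x) + sz (m x) + 2) + 1) + 1 := by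
        refine (sz_list_le (M := p.eval (sz x + sz (l x) + sz (m x) + 2)) fun a ha => ?_).trans ?_
        · obtain ⟨i, hi, rfl⟩ := List.getElem_of_mem ha
          rw [List.length_zipWith] at hi
          rw [List.getElem_zipWith]
          refine (hp (x, _, _)).trans (eval_monotone p ?_)
          have h₃ := sz_le_of_mem (List.getElem_mem (show i < l'.length by omega))
          have h₄ := sz_le_of_mem (List.getElem_mem (show i < (m x).length by omega))
          have h₅ := sz_le_of_prefix hl'
          simp only [sz_prod]
          omega
        · have h₃ := length_le_sz l'
          have h₄ := sz_le_of_prefix hl'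
          gcongr
          rw [List.length_zipWith]
          omega
      omega)
  refine h.snd.of_enc fun x => ?_
  rw [key]
  rfl

theorem bitsEq {f g : α → List Bool} (hf : PolyTime f) (hg : PolyTime g) :
    PolyTime fun x => f x == g x := by
  have h₁ : PolyTime fun x => List.zipWith Bool.xor (f x) (g x) :=
    zipWith (g := fun _ a b => Bool.xor a b) false hf hg (xor id.snd.fst id.snd.snd)
  have h₂ := (natEq hf.length hg.length).and (any (g := fun _ b => b) h₁ id.snd).not
  refine h₂.of_enc fun x => ?_
  congr 1
  generalize f x = a
  generalize g x = b
  induction a generalizing b with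
  | nil => cases b <;> rfl
  | cons i a ih =>
    cases b with
    | nil => rfl
    | cons j b =>
      have := ih b
      rw [Bool.eq_iff_iff] at this ⊢
      simp only [beq_iff_eq, Bool.and_eq_true] at this ⊢
      cases i <;> cases j <;> simp_all

theorem contains {l : α → List (List Bool)} {b : α → List Bool} (hl : PolyTime l)
    (hb : PolyTime b) : PolyTime fun x => (l x).contains (b x) := by
  refine (any (g := fun x c => b x == c) hl (bitsEq (hb.comp id.fst) id.snd)).of_enc fun x => ?_
  rw [List.contains_eq_any_beq]

theorem erase {l : α → List (List Bool)} {b : α → List Bool} (hl : PolyTime l)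
    (hb : PolyTime b) : PolyTime fun x => (l x).erase (b x) := by
  have h₁ : PolyTime fun p : α × List Bool × List (List Bool) × List (List Bool) => p.2.1 :=
    id.snd.fst
  refine listRec (f := fun x l => l.erase (b x))
    (step := fun x c l acc => if c == b x then l else c :: acc) hl (const [])
    (ite (bitsEq h₁ (hb.comp id.fst)) id.snd.snd.fst (h₁.cons id.snd.snd.snd)) ?_ ?_
  · refine PolyBound.size.mono fun p => le_trans ?_ (sz_snd_le p)
    induction p.2 with
    | nil => simp
    | cons c l ih =>
      rw [List.erase_cons]
      split_ifs <;> simp only [sz_cons] <;> omega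
  · intro x c l
    rw [List.erase_cons]

end PolyTime

end

/-! ### Parities -/

/-- The bit vector `q` stands for the parity `x ↦ ⨁ i, q i * x i`. -/
abbrev Bits : Type := List Bool

def bit (q : Bits) (i : ℕ) : Bool := q.getD i false

/-- The longer vector is truncated; this is addition over the field with two elements only for equal
lengths. -/
def xorv (p q : Bits) : Bits := List.zipWith Bool.xor p q

def zeros (n : ℕ) : Bits := List.replicate n false

/-- The unit vector with `n` entries whose entry at `a` is `true`. -/
def unitv (n a : ℕ) : Bits := (List.range n).map fun i => i == a

/-- The value of the parity `q` at `x`. -/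
def par : Bits → Bits → Bool
  | a :: q, b :: x => Bool.xor (a && b) (par q x)
  | _, _ => false

/-- The number of parities of a list that are `1` at `x`. -/
def wt (Q : List Bits) (x : Bits) : ℕ := Q.countP fun q => par q x

/-- The values at `q` of the monomials of degree less than `k` (some of them repeatedly). -/
def features : ℕ → Bits → Bits
  | 0, _ => []
  | k + 1, q => true :: q.flatMap fun b => (features k q).map fun c => b && c

/-- Parities whose sum agrees with the parity `q` modulo `2 ^ k`, if `M ≡ -1` modulo `2 ^ k`. The
multiplicities modulo 2 are polynomials of degree at most `k` in `q`. -/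
def expand (M : ℕ) : ℕ → Bits → List Bits
  | 0, _ => []
  | _ + 1, [] => []
  | k + 1, b :: q => (expand M (k + 1) q).map (fun Y => false :: Y) ++
      if b then (true :: zeros q.length) :: (expand M k q).flatMap fun Y =>
        (true :: Y) :: (List.replicate M [true :: zeros q.length, false :: Y]).flatten
      else []

/-- One step of `cancel`: `W.1` are the parities that occurred an odd number of times so far, and
`W.2` are the pairs that were removed. -/
def toggle (W : List Bits × List Bits) (Y : Bits) : List Bits × List Bits :=
  if W.1.contains Y then (W.1.erase Y, Y :: W.2) else (Y :: W.1, W.2)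

/-- Remove pairs of equal parities from a list. -/
def cancel (Q : List Bits) : List Bits × List Bits := Q.foldl toggle ([], [])

/-! ### Linear dependencies between the features of parities -/

/-- For each parity of the list its features, together with its index as a unit vector. -/
def trackedRows (k : ℕ) : List Bits → List (Bits × Bits)
  | [] => []
  | p :: Q => (features k p, true :: zeros Q.length) ::
      (trackedRows k Q).map fun r => (r.1, false :: r.2)

/-- Clear the first column with the help of a row that has `true` there, and remove this column. -/
def clearColumn (R : List (Bits × Bits)) : List (Bits × Bits) :=
  let p := (R.filter fun r => r.1.headD false).headD ([], [])
  R.map fun r => if r.1.headD false then ((xorv r.1 p.1).tail, xorv r.2 p.2) else (r.1.tail, r.2)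

/-- A set of parities, as a bit vector, whose features sum up to zero; `[]` if there is none except
the empty set. -/
def dependency (k : ℕ) (Q : List Bits) : Bits :=
  let R := (features k (Q.headD [])).foldl (fun R _ => clearColumn R) (trackedRows k Q)
  ((R.map fun r => r.2).filter fun y => y.any fun b => b).headD []

def select (y : Bits) (Q : List Bits) : List Bits :=
  (List.zipWith (fun c p => (c, p)) y Q |>.filter fun r => r.1).map fun r => r.2

/-- Add `z` to the selected parities. -/
def shiftSelected (z y : Bits) (Q : List Bits) : List Bits :=
  List.zipWith (fun c p => if c then xorv p z else p) y Q

/-- Use a dependency to turn at least one of the parities into `b`, and remove it. -/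
def reduceOnce (k : ℕ) (b : Bits) (Q : List Bits) : List Bits :=
  let y := dependency k Q
  let s := select y Q
  if s.isEmpty then Q
  else (shiftSelected (xorv b (s.headD [])) y Q).filter fun p => !(p == b)

def iterReduce (k : ℕ) (b : Bits) (Q : List Bits) : List Bits :=
  Q.foldl (fun R _ => reduceOnce k b R) Q

/-- The number of copies of `b` that were discarded matters only modulo 2, and it is recovered from
the lengths. -/
def oddLength (Q : List Bits) : Bool := Q.foldl (fun s _ => !s) false

/-- A list of parities with the same sums of monomials of degree at most `k` as `Q`, modulo 2. -/
def reduce (k : ℕ) (b : Bits) (Q : List Bits) : List Bits :=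
  iterReduce k b Q ++ if oddLength (Q ++ iterReduce k b Q) then [b] else []

/-! ### Circuits -/

/-- Gates on qubits that are given by natural numbers. -/
inductive RawGate : Type
  | cnot (c t : ℕ) : RawGate
  | had (a : ℕ) : RawGate
  | rot (a : ℕ) : RawGate
  | rotTwo (a : ℕ) : RawGate

def Gate.raw {n : ℕ} : Gate n → RawGate
  | Gate.cnot c t _ => RawGate.cnot c t
  | Gate.had a => RawGate.had a
  | Gate.rot a => RawGate.rot a
  | Gate.rotTwo a => RawGate.rotTwo a

def RawGate.isRot : RawGate → Bool
  | .rot _ => true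
  | _ => false

def support (q : Bits) : List ℕ := (List.range q.length).filter fun i => bit q i

/-- A circuit for `x ↦ ω ^ (par q x)`, where `g` is the gate for `x ↦ ω ^ (x a)`. -/
def emit (g : ℕ → RawGate) (q : Bits) : List RawGate :=
  if (support q).isEmpty then []
  else (support q).tail.map (fun c => RawGate.cnot c ((support q).headD 0)) ++
    (g ((support q).headD 0) ::
      (support q).tail.reverse.map fun c => RawGate.cnot c ((support q).headD 0))

/-- The parities of `cancel` that remain when `Q` is implemented by means of `reduce`, and the
circuit that is emitted. -/
def extract (d k : ℕ) (b : Bits) (Q : List Bits) : List Bits × List RawGate :=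
  let E := reduce k b Q
  let W := cancel ((Q ++ E).flatMap fun q => expand (2 ^ (d + 1) - 1) (d + 1) q)
  -- The phase of `Q` is that of `W.1` plus `2 * W.2` minus `E`. Here `-E` is written as `E + 2 * (2
  -- ^ d - 1) * E`, which is valid modulo `2 ^ (d + 1)` and needs each member of `E` only once as an
  -- `R_Z(π/2^d)` gate.
  (W.1, E.flatMap (emit .rot) ++ (W.2.flatMap (emit .rotTwo) ++
    E.flatMap fun q => (List.replicate (2 ^ d - 1) q).flatMap (emit .rotTwo)))

/-- The parity `q` after a CNOT gate in terms of the bits before it. -/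
def pullback (c t : ℕ) (q : Bits) : Bits :=
  if bit q t then xorv q (unitv q.length c) else q

/-- The pending parities after one more gate. -/
def stepPending (d n : ℕ) (Q : List Bits) : RawGate → List Bits
  | .cnot c t => Q.map (pullback c t)
  -- The base parity for the reduction is itself one that contains `a`, so translations by sums of
  -- two such parities preserve the bit at `a`.
  | .had a => (Q.filter fun q => !bit q a) ++
      (extract d d ((Q.filter fun q => bit q a).headD []) (Q.filter fun q => bit q a)).1
  | .rot a => unitv n a :: Q
  | .rotTwo _ => Q

/-- The gates that are emitted for one more gate. -/
def stepOut (d : ℕ) (Q : List Bits) : RawGate → List RawGate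
  | .cnot c t => [.cnot c t]
  | .had a =>
      (extract d d ((Q.filter fun q => bit q a).headD []) (Q.filter fun q => bit q a)).2 ++ [.had a]
  | .rot _ => []
  | .rotTwo a => [.rotTwo a]

/-- The head of the list is the leftmost factor, so this goes against the order in which the gates
act; the invariant is `Pending`. -/
def runSteps (d n : ℕ) (C : List RawGate) : List Bits × List RawGate :=
  C.foldl (fun s g => (stepPending d n s.1 g, s.2 ++ stepOut d s.1 g)) ([], [])

/-- Split off the maximal final part of a circuit without `R_Z(π/2^d)` gates. -/
def splitLastRot : List RawGate → List RawGate × List RawGate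
  | [] => ([], [])
  | g :: C =>
    let s := splitLastRot C
    if s.1.isEmpty && !g.isRot then ([], g :: s.2) else (g :: s.1, s.2)

/-- Setting the rotation-free end aside keeps the Hadamard gates of `C_init` from meeting pending
parities. The last extraction uses the zero parity as base, since it is emitted as the empty
circuit. -/
def optimize (d n : ℕ) (C : List RawGate) : List RawGate :=
  let s := splitLastRot C
  let r := runSteps d n s.1
  r.2 ++ ((extract d (d + 1) (zeros n) r.1).2 ++ s.2)

/-! ### Entries and values of parities -/

theorem bit_nil (i : ℕ) : bit [] i = false := by simp [bit]

theorem bit_cons_zero (b : Bool) (q : Bits) : bit (b :: q) 0 = b := rfl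

theorem bit_cons_succ (b : Bool) (q : Bits) (i : ℕ) : bit (b :: q) (i + 1) = bit q i := rfl

theorem bit_eq_headD (q : Bits) : bit q 0 = q.headD false := by cases q <;> rfl

theorem bit_tail (q : Bits) (i : ℕ) : bit q.tail i = bit q (i + 1) := by
  cases q <;> simp [bit]

theorem bit_of_length_le {q : Bits} {i : ℕ} (h : q.length ≤ i) : bit q i = false := by
  simp [bit, h]

theorem bit_xorv {p q : Bits} (h : p.length = q.length) (i : ℕ) :
    bit (xorv p q) i = Bool.xor (bit p i) (bit q i) := by
  induction p generalizing q i with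
  | nil =>
    cases q
    · simp [xorv, bit]
    · simp at h
  | cons a p ih =>
    cases q with
    | nil => simp at h
    | cons b q =>
      cases i with
      | zero => rfl
      | succ i => exact ih (by simpa using h) i

theorem length_xorv {p q : Bits} (h : p.length = q.length) : (xorv p q).length = q.length := by
  simp [xorv, h]

theorem length_zeros (n : ℕ) : (zeros n).length = n := by simp [zeros]

theorem bit_zeros (n i : ℕ) : bit (zeros n) i = false := by
  simp only [bit, zeros, List.getD_eq_getElem?_getD, List.getElem?_replicate]
  split_ifs <;> rfl

theorem length_unitv (n a : ℕ) : (unitv n a).length = n := by simp [unitv]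

theorem unitv_succ_zero (n : ℕ) : unitv (n + 1) 0 = true :: zeros n := by
  simp [unitv, List.range_succ_eq_map, Function.comp_def, zeros]

theorem unitv_succ_succ (n a : ℕ) : unitv (n + 1) (a + 1) = false :: unitv n a := by
  simp [unitv, List.range_succ_eq_map, Function.comp_def]

theorem bit_unitv {n a : ℕ} (h : a < n) (i : ℕ) : bit (unitv n a) i = (i == a) := by
  induction n generalizing a i with
  | zero => omega
  | succ n ih =>
    cases a with
    | zero =>
      cases i <;> simp [unitv_succ_zero, bit_cons_zero, bit_cons_succ, bit_zeros]
    | succ a =>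
      cases i with
      | zero => simp [unitv_succ_succ, bit_cons_zero]
      | succ i => simp [unitv_succ_succ, bit_cons_succ, ih (Nat.lt_of_succ_lt_succ h)]

theorem bits_ext {p q : Bits} (h : p.length = q.length) (hb : ∀ i, bit p i = bit q i) : p = q := by
  induction p generalizing q with
  | nil =>
    cases q
    · rfl
    · simp at h
  | cons a p ih =>
    cases q with
    | nil => simp at h
    | cons b q =>
      rw [show a = b from hb 0, ih (by simpa using h) fun i => hb (i + 1)]

theorem par_nil_right (q : Bits) : par q [] = false := by cases q <;> rfl

theorem par_nil_left (x : Bits) : par [] x = false := by cases x <;> rfl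

theorem par_cons (a b : Bool) (q x : Bits) :
    par (a :: q) (b :: x) = Bool.xor (a && b) (par q x) := rfl

theorem par_comm (q x : Bits) : par q x = par x q := by
  induction q generalizing x with
  | nil => rw [par_nil_left, par_nil_right]
  | cons a q ih =>
    cases x with
    | nil => rfl
    | cons b x => rw [par_cons, par_cons, ih, Bool.and_comm]

theorem par_zeros (n : ℕ) (x : Bits) : par (zeros n) x = false := by
  induction n generalizing x with
  | zero => exact par_nil_left x
  | succ n ih =>
    cases x with
    | nil => rfl
    | cons b x =>
      rw [show zeros (n + 1) = false :: zeros n from rfl, par_cons, ih]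
      rfl

theorem par_xorv {p q : Bits} (h : p.length = q.length) (x : Bits) :
    par (xorv p q) x = Bool.xor (par p x) (par q x) := by
  induction p generalizing q x with
  | nil =>
    cases q
    · simp [xorv, par_nil_left]
    · simp at h
  | cons a p ih =>
    cases q with
    | nil => simp at h
    | cons b q =>
      cases x with
      | nil => rfl
      | cons c x =>
        change Bool.xor (Bool.xor a b && c) (par (xorv p q) x) = _
        rw [ih (by simpa using h), par_cons, par_cons]
        cases a <;> cases b <;> cases c <;> simp

theorem par_unitv (n a : ℕ) (x : Bits) (hx : x.length = n) : par (unitv n a) x = bit x a := by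
  induction n generalizing a x with
  | zero => rw [List.length_eq_zero_iff.1 hx, par_nil_right, bit_nil]
  | succ n ih =>
    cases x with
    | nil => simp at hx
    | cons b x =>
      cases a with
      | zero =>
        rw [unitv_succ_zero, par_cons, par_zeros]
        simp [bit_cons_zero]
      | succ a =>
        rw [unitv_succ_succ, par_cons, ih a x (by simpa using hx)]
        simp [bit_cons_succ]

theorem wt_append (P Q : List Bits) (x : Bits) : wt (P ++ Q) x = wt P x + wt Q x :=
  List.countP_append

theorem wt_cons (q : Bits) (Q : List Bits) (x : Bits) : wt (q :: Q) x = (par q x).toNat + wt Q x := by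
  rw [wt, List.countP_cons, add_comm, wt]
  cases par q x <;> rfl

theorem wt_nil_right (Q : List Bits) : wt Q [] = 0 := by
  simp [wt, par_nil_right]

theorem wt_perm {P Q : List Bits} (h : P.Perm Q) (x : Bits) : wt P x = wt Q x := h.countP_eq _

/-! ### The expansion of a parity into small parities -/

theorem expand_nil (M k : ℕ) : expand M k [] = [] := by cases k <;> rfl

theorem expand_zero (M : ℕ) (q : Bits) : expand M 0 q = [] := by cases q <;> rfl

theorem length_of_mem_expand {M k : ℕ} {q Y : Bits} (h : Y ∈ expand M k q) :
    Y.length = q.length := by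
  induction q generalizing k Y with
  | nil => simp [expand_nil] at h
  | cons b q ih =>
    cases k with
    | zero => simp [expand_zero] at h
    | succ k =>
      rw [expand, List.mem_append] at h
      rcases h with h | h
      · obtain ⟨Z, hZ, rfl⟩ := List.mem_map.1 h
        simp [ih hZ]
      · cases b with
        | false => simp at h
        | true =>
          simp only [if_true, List.mem_cons, List.mem_flatMap, List.mem_flatten,
            List.mem_replicate] at h
          rcases h with rfl | ⟨Z, hZ, rfl | ⟨L, ⟨-, rfl⟩, hL⟩⟩
          · simp [length_zeros]
          · simp [ih hZ]
          · simp only [List.mem_cons, List.not_mem_nil, or_false] at hL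
            rcases hL with rfl | rfl
            · simp [length_zeros]
            · simp [ih hZ]

/-- Expansions involve only variables of the expanded parity. This keeps the variable of a Hadamard
gate out of the expansions of parities that avoid it. -/
theorem bit_of_mem_expand {M k i : ℕ} {q Y : Bits} (h : Y ∈ expand M k q) (hi : bit q i = false) :
    bit Y i = false := by
  induction q generalizing k Y i with
  | nil => simp [expand_nil] at h
  | cons b q ih =>
    cases k with
    | zero => simp [expand_zero] at h
    | succ k =>
      rw [expand, List.mem_append] at h
      rcases h with h | h
      · obtain ⟨Z, hZ, rfl⟩ := List.mem_map.1 h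
        cases i with
        | zero => rfl
        | succ i => exact ih (Y := Z) (i := i) hZ hi
      · cases b with
        | false => simp at h
        | true =>
          simp only [if_true, List.mem_cons, List.mem_flatMap, List.mem_flatten,
            List.mem_replicate] at h
          cases i with
          | zero => exact absurd hi (by simp [bit_cons_zero])
          | succ i =>
            rcases h with rfl | ⟨Z, hZ, rfl | ⟨L, ⟨-, rfl⟩, hL⟩⟩
            · exact bit_zeros _ _
            · exact ih (Y := Z) (i := i) hZ hi
            · simp only [List.mem_cons, List.not_mem_nil, or_false] at hL
              rcases hL with rfl | rfl
              · exact bit_zeros _ _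
              · exact ih (Y := Z) (i := i) hZ hi

theorem wt_map_false (Q : List Bits) (b : Bool) (x : Bits) :
    wt (Q.map fun Y => false :: Y) (b :: x) = wt Q x := by
  simp only [wt, List.countP_map]
  congr 1
  funext q
  simp [par_cons]

theorem wt_replicate_flatten (M : ℕ) (Q : List Bits) (x : Bits) :
    wt (List.replicate M Q).flatten x = M * wt Q x := by
  induction M with
  | zero => simp [wt]
  | succ M ih => rw [List.replicate_succ, List.flatten_cons, wt_append, ih]; ring

theorem wt_expandStep_false (M n : ℕ) (Q : List Bits) (x : Bits) :
    wt (Q.flatMap fun Y => (true :: Y) ::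
      (List.replicate M [true :: zeros n, false :: Y]).flatten) (false :: x) = (M + 1) * wt Q x := by
  induction Q with
  | nil => rfl
  | cons Y Q ih =>
    rw [List.flatMap_cons, wt_append, ih, wt_cons, wt_replicate_flatten, wt_cons, wt_cons,
      par_cons, par_cons, par_cons, par_zeros, wt_cons]
    cases par Y x <;> simp [wt] <;> ring

/-- Where `Y` has value `v`, its block contributes `(1 - v) + M(1 + v) = (M + 1)(1 + v) - 2v`;
moving `2v` to the left avoids subtraction. -/
theorem wt_expandStep_true (M n : ℕ) (Q : List Bits) (x : Bits) :
    wt (Q.flatMap fun Y => (true :: Y) ::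
      (List.replicate M [true :: zeros n, false :: Y]).flatten) (true :: x) + 2 * wt Q x
      = (M + 1) * (Q.length + wt Q x) := by
  induction Q with
  | nil => rfl
  | cons Y Q ih =>
    rw [List.flatMap_cons, wt_append, wt_cons, wt_replicate_flatten, wt_cons, wt_cons,
      par_cons, par_cons, par_cons, par_zeros, wt_cons, List.length_cons]
    cases par Y x <;> simp [wt] at ih ⊢ <;> linarith

/-- For the first bit `c` and the remaining parity `p`, `c ⊕ p = c + p - 2cp`. Because of the factor
2, in the last term `p` is needed only modulo `2 ^ (k - 1)`, so a shorter expansion suffices there,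
and each of its members `Y` gives `-2cY = (c ⊕ Y) - c - Y`, with `M` in place of `-1`. -/
theorem wt_expand {M k : ℕ} (q x : Bits) (hM : 2 ^ k ∣ M + 1) :
    wt (expand M k q) x ≡ (par q x).toNat [MOD 2 ^ k] := by
  induction q generalizing k x with
  | nil => simp [expand_nil, par_nil_left, wt, Nat.ModEq.refl]
  | cons b q ih =>
    cases k with
    | zero => simp [Nat.modEq_one]
    | succ k =>
      cases x with
      | nil => simp [wt_nil_right, par_nil_right, Nat.ModEq.refl]
      | cons c x =>
        have h₁ := ih x hM
        rw [expand, wt_append, wt_map_false]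
        cases b with
        | false => simpa [par_cons, wt] using h₁
        | true =>
          have h₂ := ih x (k := k) ((pow_dvd_pow 2 (Nat.le_succ k)).trans hM)
          simp only [if_true]
          rw [wt_cons, par_cons, par_cons, par_zeros]
          rw [← Int.natCast_modEq_iff] at h₁ h₂ ⊢
          rw [← Int.natCast_dvd_natCast] at hM
          have h₂' : ((2 ^ (k + 1) : ℕ) : ℤ) ∣ 2 * ((par q x).toNat : ℤ) -
              2 * (wt (expand M k q) x : ℤ) := by
            rw [← mul_sub, pow_succ', Nat.cast_mul]
            exact mul_dvd_mul (by simp) h₂.dvd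
          cases c with
          | false =>
            rw [wt_expandStep_false]
            have h₃ := hM.mul_right (wt (expand M k q) x : ℤ)
            have h₄ := (h₁.dvd).sub h₃
            refine Int.modEq_iff_dvd.2
              (Eq.subst (motive := fun z => ((2 ^ (k + 1) : ℕ) : ℤ) ∣ z) ?_ h₄)
            push_cast
            simp
            ring
          | true =>
            have h₃ := wt_expandStep_true M q.length (expand M k q) x
            have h₄ := ((h₁.dvd).sub (hM.mul_right
              ((expand M k q).length + wt (expand M k q) x : ℤ))).sub h₂'
            refine Int.modEq_iff_dvd.2
              (Eq.subst (motive := fun z => ((2 ^ (k + 1) : ℕ) : ℤ) ∣ z) ?_ h₄)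
            rw [← @Nat.cast_inj ℤ] at h₃
            push_cast at h₃ ⊢
            cases par q x <;> simp <;> linarith

/-! ### Lists of parities on which all polynomials of small degree sum up to zero -/

def bz (b : Bool) : ZMod 2 := if b then 1 else 0

theorem bz_xor (a b : Bool) : bz (Bool.xor a b) = bz a + bz b := by
  cases a <;> cases b <;> decide

theorem bz_and (a b : Bool) : bz (a && b) = bz a * bz b := by
  cases a <;> cases b <;> decide

theorem bz_eq_zero {b : Bool} : bz b = 0 ↔ b = false := by
  cases b <;> decide

/-- The value of a monomial. -/
def mon (T : List ℕ) (p : Bits) : ZMod 2 := (T.map fun i => bz (bit p i)).prod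

theorem mon_cons (i : ℕ) (T : List ℕ) (p : Bits) : mon (i :: T) p = bz (bit p i) * mon T p := by
  simp [mon]

/-- All monomials of degree less than `k` sum up to zero on `J`. -/
def Null (k : ℕ) (J : List Bits) : Prop :=
  ∀ T : List ℕ, T.length < k → (J.map (mon T)).sum = 0

theorem Null.append {k : ℕ} {J K : List Bits} (hJ : Null k J) (hK : Null k K) :
    Null k (J ++ K) := fun T hT => by
  rw [List.map_append, List.sum_append, hJ T hT, hK T hT, add_zero]

theorem Null.perm {k : ℕ} {J K : List Bits} (hJ : Null k J) (h : J.Perm K) : Null k K :=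
  fun T hT => by rw [← (h.map _).sum_eq, hJ T hT]

theorem null_double (k : ℕ) (J : List Bits) : Null k (J ++ J) := fun T _ => by
  rw [List.map_append, List.sum_append, CharTwo.add_self_eq_zero]

theorem Null.cancel_right {k : ℕ} {J K : List Bits} (h : Null k (J ++ (K ++ K))) : Null k J :=
  fun T hT => by
    have := h T hT
    rwa [List.map_append, List.sum_append, null_double k K T hT, add_zero] at this

/-- The difference of a monomial in direction `z` has smaller degree. The extra factor `mon U` is
needed for the induction: it collects the variables split off from `T`. -/
theorem Null.sum_shift {k : ℕ} {J : List Bits} {z : Bits} (h : Null k J)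
    (hz : ∀ p ∈ J, p.length = z.length) (T U : List ℕ) (hTU : T.length + U.length ≤ k) :
    (J.map fun p => mon U p * (mon T (xorv p z) + mon T p)).sum = 0 := by
  induction T generalizing U with
  | nil => simp [mon, CharTwo.add_self_eq_zero]
  | cons i T ih =>
    rw [List.length_cons] at hTU
    have h₁ := ih (i :: U) (by rw [List.length_cons]; omega)
    have h₂ := ih U (by omega)
    have h₃ := h (U ++ T) (by rw [List.length_append]; omega)
    have h₄ : (J.map fun p => mon U p * (mon (i :: T) (xorv p z) + mon (i :: T) p)) =
        J.map fun p => mon (i :: U) p * (mon T (xorv p z) + mon T p) +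
          (bz (bit z i) * (mon U p * (mon T (xorv p z) + mon T p)) +
            bz (bit z i) * mon (U ++ T) p) := by
      refine List.map_congr_left fun p hp => ?_
      have : mon (U ++ T) p = mon U p * mon T p := by simp [mon]
      rw [mon_cons, mon_cons, mon_cons, bit_xorv (hz p hp), bz_xor, this]
      have h2 : (2 : ZMod 2) = 0 := by decide
      linear_combination (-(bz (bit z i) * mon U p * mon T p)) * h2
    rw [h₄, List.sum_map_add, List.sum_map_add, h₁, List.sum_map_mul_left, h₂,
      List.sum_map_mul_left, h₃]
    simp

/-- The sum of a monomial over `J` and its translate is the sum over `J` of its difference in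
direction `z`, which has one degree less. -/
theorem Null.shift {k : ℕ} {J : List Bits} {z : Bits} (h : Null k J)
    (hz : ∀ p ∈ J, p.length = z.length) : Null (k + 1) (J ++ J.map fun p => xorv p z) := by
  intro T hT
  have := h.sum_shift hz T [] (by simp; omega)
  simp only [mon, List.map_nil, List.prod_nil, one_mul] at this
  rw [List.sum_map_add] at this
  rw [List.map_append, List.sum_append, List.map_map, add_comm]
  exact this

/-- `f` is a polynomial of degree at most `k` on vectors of length `n`. -/
def DegLe (n k : ℕ) (f : Bits → ZMod 2) : Prop :=
  ∀ R : List Bits, (∀ p ∈ R, p.length = n) → Null (k + 1) R → (R.map f).sum = 0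

namespace DegLe

variable {n k : ℕ} {f g : Bits → ZMod 2}

theorem zero : DegLe n k fun _ => 0 := fun R _ _ => by simp

theorem one : DegLe n k fun _ => 1 := fun R _ h => by
  have := h [] (by simp)
  simp only [show mon [] = fun _ => 1 from rfl] at this
  exact this

theorem add (hf : DegLe n k f) (hg : DegLe n k g) : DegLe n k fun q => f q + g q :=
  fun R hR h => by rw [List.sum_map_add, hf R hR h, hg R hR h, add_zero]

theorem const_mul (c : ZMod 2) (hf : DegLe n k f) : DegLe n k fun q => c * f q :=
  fun R hR h => by rw [List.sum_map_mul_left, hf R hR h, mul_zero]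

theorem congr (hf : DegLe n k f) (h : ∀ q, q.length = n → g q = f q) : DegLe n k g :=
  fun R hR hN => by
    rw [List.map_congr_left fun q hq => h q (hR q hq), hf R hR hN]

theorem tail (hf : DegLe n k f) : DegLe (n + 1) k fun q => f q.tail := fun R hR h => by
  have := hf (R.map List.tail) (by
    intro p hp
    obtain ⟨q, hq, rfl⟩ := List.mem_map.1 hp
    simp [hR q hq]) fun T hT => by
      have := h (T.map Nat.succ) (by simpa using hT)
      rw [List.map_map]
      rw [← this]
      congr 1
      refine List.map_congr_left fun p hp => ?_
      simp [mon, bit_tail, Function.comp_def]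
  rwa [List.map_map] at this

/-- Multiplication by the first coordinate restricts the sum to the vectors that have a 1 there, and
these form a list that is null to one order less: prepend the index 0 to the test monomial. -/
theorem head_mul (hf : DegLe n k f) :
    DegLe n (k + 1) fun q => bz (bit q 0) * f q := fun R hR h => by
  have key : ∀ F : Bits → ZMod 2, ((R.filter fun q => bit q 0).map F).sum =
      (R.map fun q => bz (bit q 0) * F q).sum := by
    intro F
    clear hR h
    induction R with
    | nil => rfl
    | cons q R ih => cases hq : bit q 0 <;> simp [hq, ih, bz]
  rw [← key]
  refine hf _ (fun p hp => hR p (List.mem_filter.1 hp).1) fun T hT => ?_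
  rw [key, ← h (0 :: T) (by simpa using hT)]
  rfl

end DegLe

/-- Each block consists of `1 + 2M` parities, an odd number. -/
theorem length_expand_cons (M k : ℕ) (b : Bool) (q : Bits) :
    ((expand M (k + 1) (b :: q)).length : ZMod 2) = (expand M (k + 1) q).length +
      bz b * (1 + (expand M k q).length) := by
  cases b with
  | false => simp [expand, bz]
  | true =>
    have h : ∀ (S : List Bits), ((S.flatMap fun Y => (true :: Y) ::
        (List.replicate M [true :: zeros q.length, false :: Y]).flatten).length : ZMod 2)
        = S.length := by
      intro S
      induction S with
      | nil => rfl
      | cons Y S ih =>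
        rw [List.flatMap_cons, List.length_append, Nat.cast_add, ih]
        have h2 : (2 : ZMod 2) = 0 := by decide
        simp [h2]
        ring
    rw [expand, List.length_append, Nat.cast_add, List.length_map, if_pos rfl, List.length_cons,
      Nat.cast_add, h]
    simp [bz]
    ring

/-- The length enters the multiplicities because every member of the shorter expansion adds copies
of the same vector `true :: zeros`. -/
theorem degLe_length_expand (M n k : ℕ) : DegLe n k fun q => ((expand M k q).length : ZMod 2) := by
  induction n generalizing k with
  | zero =>
    refine DegLe.zero.congr fun q hq => ?_
    rw [List.length_eq_zero_iff.1 hq, expand_nil]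
    rfl
  | succ n ih =>
    cases k with
    | zero => exact DegLe.zero.congr fun q _ => by simp [expand_zero]
    | succ k =>
      refine ((ih (k + 1)).tail.add (DegLe.one.add (ih k).tail).head_mul).congr fun q hq => ?_
      cases q with
      | nil => simp at hq
      | cons b q => exact length_expand_cons M k b q

theorem count_expand_nil (M k : ℕ) (b : Bool) (q : Bits) : (expand M k (b :: q)).count [] = 0 := by
  refine List.count_eq_zero.2 fun h => ?_
  simpa using length_of_mem_expand h

/-- As `M` is odd, each `Y` of the shorter expansion yields both `true :: Y` and `false :: Y` an odd
number of times, so the last summand does not depend on `c`. -/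
theorem count_expand_cons {M : ℕ} (hM : (M : ZMod 2) = 1) (k : ℕ) (b c : Bool) (q Y : Bits) :
    ((expand M (k + 1) (b :: q)).count (c :: Y) : ZMod 2) =
      (1 + bz c) * (expand M (k + 1) q).count Y +
      bz b * ((if c :: Y = true :: zeros q.length then 1 else 0) * (1 + (expand M k q).length) +
        (expand M k q).count Y) := by
  have h2 : (2 : ZMod 2) = 0 := by decide
  have h11 : (1 + 1 : ZMod 2) = 0 := by decide
  have h₁ : ∀ S : List Bits, (((S.map fun Y => false :: Y).count (c :: Y) : ℕ) : ZMod 2) =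
      (1 + bz c) * S.count Y := by
    intro S
    induction S with
    | nil => simp
    | cons Z S ih =>
      rw [List.map_cons, List.count_cons, List.count_cons, Nat.cast_add, ih]
      cases c
      · by_cases hZ : Z = Y <;> simp [hZ, bz]
      · simp [bz, h11]
  cases b with
  | false => simp [expand, h₁, bz]
  | true =>
    have h₃ : ∀ (N : ℕ) (A B : Bits), (((List.replicate N [A, B]).flatten.count (c :: Y) : ℕ) :
        ZMod 2) = N * ((if c :: Y = A then 1 else 0) + (if c :: Y = B then 1 else 0)) := by
      intro N A B
      induction N with
      | zero => simp
      | succ N ih =>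
        rw [List.replicate_succ, List.flatten_cons, List.count_append, Nat.cast_add, ih,
          List.count_cons, List.count_cons]
        simp only [List.count_nil, beq_iff_eq, eq_comm (a := A), eq_comm (a := B)]
        push_cast
        ring
    have h₂ : ∀ S : List Bits, (((S.flatMap fun Y => (true :: Y) ::
        (List.replicate M [true :: zeros q.length, false :: Y]).flatten).count (c :: Y) : ℕ) :
        ZMod 2) = (if c :: Y = true :: zeros q.length then 1 else 0) * S.length + S.count Y := by
      intro S
      induction S with
      | nil => simp
      | cons Z S ih =>
        rw [List.flatMap_cons, List.count_append, Nat.cast_add, ih, List.count_cons,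
          List.count_cons, Nat.cast_add, h₃, hM]
        by_cases hZ : Z = Y
        · subst hZ
          generalize (if c :: Z = true :: zeros q.length then (1 : ZMod 2) else 0) = w
          cases c <;> simp <;> ring
        · have hZ' : ¬ Y = Z := fun h => hZ h.symm
          generalize (if c :: Y = true :: zeros q.length then (1 : ZMod 2) else 0) = w
          simp [hZ, hZ']
          ring
    rw [expand, List.count_append, Nat.cast_add, h₁, if_pos rfl, List.count_cons, Nat.cast_add, h₂]
    simp only [beq_iff_eq, eq_comm (a := true :: zeros q.length), bz, if_true]
    push_cast
    ring

theorem degLe_count_expand {M : ℕ} (hM : (M : ZMod 2) = 1) (n k : ℕ) (Y : Bits) :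
    DegLe n k fun q => ((expand M k q).count Y : ZMod 2) := by
  induction n generalizing k Y with
  | zero =>
    refine DegLe.zero.congr fun q hq => ?_
    rw [List.length_eq_zero_iff.1 hq, expand_nil]
    rfl
  | succ n ih =>
    cases k with
    | zero => exact DegLe.zero.congr fun q _ => by simp [expand_zero]
    | succ k =>
      cases Y with
      | nil =>
        refine DegLe.zero.congr fun q hq => ?_
        cases q with
        | nil => simp at hq
        | cons b q => simp [count_expand_nil]
      | cons c Y =>
        refine (((ih (k + 1) Y).tail.const_mul (1 + bz c)).add
          (((DegLe.one.add (degLe_length_expand M n k).tail).const_mul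
            (if c :: Y = true :: zeros n then 1 else 0)).add
              (ih k Y).tail).head_mul).congr fun q hq => ?_
        cases q with
        | nil => simp at hq
        | cons b q =>
          have : q.length = n := by simpa using hq
          rw [count_expand_cons hM, this]
          rfl

theorem count_flatMap_cast {ι : Type} (R : List ι) (f : ι → List Bits) (Y : Bits) :
    (((R.flatMap f).count Y : ℕ) : ZMod 2) = (R.map fun q => ((f q).count Y : ZMod 2)).sum := by
  induction R with
  | nil => rfl
  | cons q R ih => simp [List.count_append, ih]

/-- All multiplicities in the expansion are even. -/
theorem count_flatMap_expand {M : ℕ} (hM : (M : ZMod 2) = 1) {n k : ℕ} {R : List Bits}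
    (hR : ∀ p ∈ R, p.length = n) (h : Null (k + 1) R) (Y : Bits) :
    (((R.flatMap (expand M k)).count Y : ℕ) : ZMod 2) = 0 := by
  rw [count_flatMap_cast]
  exact degLe_count_expand hM n k Y R hR h

/-- If `a` belongs to all parities of `R`, then one degree less is needed for the multiplicities
of the parities that `a` belongs to. -/
theorem count_flatMap_expand_of_bit {M : ℕ} (hM : (M : ZMod 2) = 1) {n k a : ℕ} {R : List Bits}
    (hR : ∀ p ∈ R, p.length = n) (ha : ∀ p ∈ R, bit p a = true) (h : Null k R) {Y : Bits}
    (hY : bit Y a = true) : (((R.flatMap (expand M k)).count Y : ℕ) : ZMod 2) = 0 := by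
  by_cases hR₀ : R = []
  · simp [hR₀]
  have han : a < n := by
    obtain ⟨p, hp⟩ := List.exists_mem_of_ne_nil R hR₀
    by_contra hn
    have := ha p hp
    rw [bit_of_length_le (by rw [hR p hp]; omega)] at this
    simp at this
  have hlen : ∀ p ∈ R, p.length = (unitv n a).length := fun p hp => by
    rw [hR p hp, length_unitv]
  -- Adding the unit vector at `a` to all of `R` gives parities without `a`, whose expansions cannot
  -- contain `Y`. Together with `R` they are null to one order more, so all multiplicities of `Y`
  -- come from `R` and are even.
  have h₁ := count_flatMap_expand (k := k) hM (R := R ++ R.map fun p => xorv p (unitv n a)) (n := n)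
    (by
      intro p hp
      rcases List.mem_append.1 hp with hp | hp
      · exact hR p hp
      · obtain ⟨q, hq, rfl⟩ := List.mem_map.1 hp
        rw [length_xorv (hlen q hq), length_unitv]) (h.shift hlen) Y
  rw [List.flatMap_append, List.count_append, Nat.cast_add] at h₁
  have h₂ : ((R.map fun p => xorv p (unitv n a)).flatMap (expand M k)).count Y = 0 := by
    refine List.count_eq_zero.2 fun hmem => ?_
    obtain ⟨p, hp, hYp⟩ := List.mem_flatMap.1 hmem
    obtain ⟨q, hq, rfl⟩ := List.mem_map.1 hp
    have := bit_of_mem_expand (i := a) hYp (by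
      rw [bit_xorv (hlen q hq), ha q hq, bit_unitv han]
      simp)
    rw [hY] at this
    simp at this
  rwa [h₂, Nat.cast_zero, add_zero] at h₁

/-! ### Cancelling pairs -/

/-- Invariant of the cancellation: the first list plus twice the second is the multiset read so far.
-/
theorem toggle_perm (W : List Bits × List Bits) (Y : Bits) :
    ((toggle W Y).1 ++ ((toggle W Y).2 ++ (toggle W Y).2)).Perm
      (Y :: (W.1 ++ (W.2 ++ W.2))) := by
  rw [List.perm_iff_count]
  intro Z
  simp only [toggle]
  split_ifs with h
  · have hY : 1 ≤ W.1.count Y := List.count_pos_iff.2 (by simpa using h)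
    simp only [List.count_append, List.count_cons, List.count_erase, beq_iff_eq]
    by_cases hZ : Y = Z
    · subst hZ
      simp
      omega
    · simp [hZ]
  · simp only [List.count_append, List.count_cons]
    omega

theorem toggle_nodup {W : List Bits × List Bits} (h : W.1.Nodup) (Y : Bits) :
    (toggle W Y).1.Nodup := by
  simp only [toggle]
  split_ifs with hY
  · exact h.erase _
  · exact List.nodup_cons.2 ⟨by simpa using hY, h⟩

theorem foldl_toggle_perm (Q : List Bits) (W : List Bits × List Bits) :
    ((Q.foldl toggle W).1 ++ ((Q.foldl toggle W).2 ++ (Q.foldl toggle W).2)).Perm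
      (Q ++ (W.1 ++ (W.2 ++ W.2))) := by
  induction Q generalizing W with
  | nil => exact List.Perm.refl _
  | cons Y Q ih =>
    rw [List.foldl_cons]
    refine (ih _).trans ?_
    exact ((toggle_perm W Y).append_left Q).trans List.perm_middle

theorem foldl_toggle_nodup (Q : List Bits) {W : List Bits × List Bits} (h : W.1.Nodup) :
    (Q.foldl toggle W).1.Nodup := by
  induction Q generalizing W with
  | nil => exact h
  | cons Y Q ih => exact ih (toggle_nodup h Y)

theorem cancel_perm (Q : List Bits) :
    ((cancel Q).1 ++ ((cancel Q).2 ++ (cancel Q).2)).Perm Q := by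
  have h := foldl_toggle_perm Q ([], [])
  simp only [List.append_nil] at h
  exact h

theorem cancel_nodup (Q : List Bits) : (cancel Q).1.Nodup := foldl_toggle_nodup Q List.nodup_nil

theorem wt_cancel (Q : List Bits) (x : Bits) :
    wt (cancel Q).1 x + 2 * wt (cancel Q).2 x = wt Q x := by
  rw [← wt_perm (cancel_perm Q) x, wt_append, wt_append]
  ring

theorem mem_of_mem_cancel {Q : List Bits} {Y : Bits} (h : Y ∈ (cancel Q).1) : Y ∈ Q :=
  (cancel_perm Q).subset (List.mem_append_left _ h)

theorem mem_of_mem_cancel_snd {Q : List Bits} {Y : Bits} (h : Y ∈ (cancel Q).2) : Y ∈ Q :=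
  (cancel_perm Q).subset (List.mem_append_right _ (List.mem_append_left _ h))

/-- A surviving parity occurs once among the survivors and an even number of times in the removed
pairs, so its multiplicity is odd. -/
theorem notMem_cancel {Q : List Bits} {Y : Bits} (h : ((Q.count Y : ℕ) : ZMod 2) = 0) :
    Y ∉ (cancel Q).1 := by
  intro hY
  have h₁ := (cancel_perm Q).count_eq Y
  have h₂ := List.count_eq_one_of_mem (cancel_nodup Q) hY
  rw [List.count_append, List.count_append, h₂] at h₁
  rw [← h₁] at h
  have := (ZMod.natCast_eq_zero_iff _ _).1 h
  omega

/-! ### Elimination -/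

theorem xorv_comm (p q : Bits) : xorv p q = xorv q p :=
  List.zipWith_comm_of_comm Bool.xor_comm

theorem xorv_assoc (p q r : Bits) : xorv (xorv p q) r = xorv p (xorv q r) := by
  induction p generalizing q r with
  | nil => rfl
  | cons a p ih =>
    cases q with
    | nil => rfl
    | cons b q =>
      cases r with
      | nil => rfl
      | cons c r =>
        change Bool.xor (Bool.xor a b) c :: xorv (xorv p q) r = _ :: xorv p (xorv q r)
        rw [ih, Bool.xor_assoc]

theorem xorv_self (p : Bits) : xorv p p = zeros p.length := by
  induction p with
  | nil => rfl
  | cons a p ih =>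
    change Bool.xor a a :: xorv p p = false :: zeros p.length
    rw [ih, Bool.xor_self]

theorem xorv_zeros (p : Bits) : xorv p (zeros p.length) = p := by
  induction p with
  | nil => rfl
  | cons a p ih =>
    change Bool.xor a false :: xorv p (zeros p.length) = a :: p
    rw [ih, Bool.xor_false]

theorem xorv_cancel {p q : Bits} (h : p.length = q.length) : xorv p (xorv q p) = q := by
  rw [xorv_comm q, ← xorv_assoc, xorv_self, xorv_comm, h, xorv_zeros]

theorem tail_xorv (p q : Bits) : (xorv p q).tail = xorv p.tail q.tail := List.tail_zipWith

theorem headD_xorv {p q : Bits} (h : p.length = q.length) :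
    (xorv p q).headD false = Bool.xor (p.headD false) (q.headD false) := by
  rw [← bit_eq_headD, ← bit_eq_headD, ← bit_eq_headD, bit_xorv h]

/-- The sum of `F` over the parities that are selected by `y`. -/
def selSum (y : Bits) (Q : List Bits) (F : Bits → ZMod 2) : ZMod 2 :=
  (List.zipWith (fun c p => bz c * F p) y Q).sum

theorem selSum_xorv {y z : Bits} {Q : List Bits} (h : y.length = z.length) (F : Bits → ZMod 2) :
    selSum (xorv y z) Q F = selSum y Q F + selSum z Q F := by
  induction y generalizing z Q with
  | nil =>
    cases z
    · simp [selSum, xorv]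
    · simp at h
  | cons a y ih =>
    cases z with
    | nil => simp at h
    | cons b z =>
      cases Q with
      | nil => simp [selSum]
      | cons q Q =>
        have := ih (z := z) (Q := Q) (by simpa using h)
        simp only [selSum, xorv, List.zipWith_cons_cons, List.sum_cons] at this ⊢
        rw [this, bz_xor]
        ring

theorem selSum_zeros (n : ℕ) (Q : List Bits) (F : Bits → ZMod 2) : selSum (zeros n) Q F = 0 := by
  induction n generalizing Q with
  | zero => rfl
  | succ n ih =>
    cases Q with
    | nil => rfl
    | cons q Q =>
      have := ih Q
      simp only [selSum, zeros, List.replicate_succ, List.zipWith_cons_cons, List.sum_cons] at this ⊢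
      rw [this]
      simp [bz]

theorem sum_select (y : Bits) (Q : List Bits) (F : Bits → ZMod 2) :
    ((select y Q).map F).sum = selSum y Q F := by
  induction y generalizing Q with
  | nil => rfl
  | cons a y ih =>
    cases Q with
    | nil => rfl
    | cons q Q =>
      have := ih Q
      cases a <;>
        simp_all [select, selSum, bz]

/-- Linear combinations of rows. -/
inductive Comb (m n : ℕ) (R : List (Bits × Bits)) : Bits × Bits → Prop
  | zero : Comb m n R (zeros m, zeros n)
  | add {r s : Bits × Bits} (hr : r ∈ R) (hs : Comb m n R s) :
      Comb m n R (xorv r.1 s.1, xorv r.2 s.2)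

def reduceRow (p r : Bits × Bits) : Bits × Bits :=
  if r.1.headD false then ((xorv r.1 p.1).tail, xorv r.2 p.2) else (r.1.tail, r.2)

/-- Either a pivot row is added to every row with a leading 1, including itself, so that it becomes
a zero row and the number of rows is kept; or the column is already zero. -/
theorem clearColumn_eq (R : List (Bits × Bits)) :
    (∃ p ∈ R, p.1.headD false = true ∧ clearColumn R = R.map (reduceRow p)) ∨
      ((∀ r ∈ R, r.1.headD false = false) ∧ clearColumn R = R.map fun r => (r.1.tail, r.2)) := by
  have h : clearColumn R =
      R.map (reduceRow ((R.filter fun r => r.1.headD false).headD ([], []))) := rfl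
  cases hf : R.filter fun r => r.1.headD false with
  | nil =>
    refine Or.inr ⟨fun r hr => ?_, ?_⟩
    · simpa using List.filter_eq_nil_iff.1 hf r hr
    · rw [h]
      refine List.map_congr_left fun r hr => ?_
      have := List.filter_eq_nil_iff.1 hf r hr
      rw [reduceRow, if_neg (by simpa using this)]
  | cons p l =>
    have hp : p ∈ R.filter fun r => r.1.headD false := by rw [hf]; exact List.mem_cons_self
    refine Or.inl ⟨p, (List.mem_filter.1 hp).1, (List.mem_filter.1 hp).2, ?_⟩
    rw [h, hf]
    rfl

section

variable {m n : ℕ} {R : List (Bits × Bits)}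

theorem Comb.length (h : ∀ r ∈ R, r.1.length = m ∧ r.2.length = n) {s : Bits × Bits}
    (hs : Comb m n R s) : s.1.length = m ∧ s.2.length = n := by
  induction hs with
  | zero => simp [length_zeros]
  | add hr _ ih =>
    obtain ⟨h₁, h₂⟩ := h _ hr
    rw [length_xorv (h₁.trans ih.1.symm), length_xorv (h₂.trans ih.2.symm)]
    exact ih

theorem clearColumn_length (h : ∀ r ∈ R, r.1.length = m + 1 ∧ r.2.length = n) :
    ∀ r ∈ clearColumn R, r.1.length = m ∧ r.2.length = n := by
  rcases clearColumn_eq R with ⟨p, hp, -, hR⟩ | ⟨-, hR⟩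
  · intro r hr
    rw [hR] at hr
    obtain ⟨s, hs, rfl⟩ := List.mem_map.1 hr
    have h₁ := h p hp
    have h₂ := h s hs
    rw [reduceRow]
    split_ifs
    · simp [length_xorv (h₂.1.trans h₁.1.symm), length_xorv (h₂.2.trans h₁.2.symm), h₁]
    · simp [h₂]
  · intro r hr
    rw [hR] at hr
    obtain ⟨s, hs, rfl⟩ := List.mem_map.1 hr
    simp [h s hs]

theorem reduceRow_add {p r s : Bits × Bits}
    (hpl : p.1.length = m ∧ p.2.length = n) (hr : r.1.length = m ∧ r.2.length = n)
    (hs : s.1.length = m ∧ s.2.length = n) :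
    reduceRow p (xorv r.1 s.1, xorv r.2 s.2) =
      (xorv (reduceRow p r).1 (reduceRow p s).1, xorv (reduceRow p r).2 (reduceRow p s).2) := by
  have key : ∀ a b c : Bits, xorv (xorv a b) c = xorv (xorv a c) b := fun a b c => by
    rw [xorv_assoc, xorv_comm b, xorv_assoc]
  have key' : ∀ a b c : Bits, b.length = c.length → xorv (xorv a c) (xorv b c) = xorv a b :=
    fun a b c hbc => by
      rw [xorv_assoc, xorv_comm b, ← xorv_assoc c, xorv_self, xorv_comm (zeros _), ← hbc,
        xorv_zeros]
  simp only [reduceRow, headD_xorv (hr.1.trans hs.1.symm)]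
  cases r.1.headD false <;> cases s.1.headD false
  · simp [tail_xorv]
  · simp [tail_xorv, xorv_assoc]
  · simp [tail_xorv, key _ s.1.tail, key _ s.2]
  · have h₁ : s.1.tail.length = p.1.tail.length := by simp [hs, hpl]
    simp [tail_xorv, key' _ _ _ h₁, key' _ _ _ (hs.2.trans hpl.2.symm)]

/-- No dependency is lost: `reduceRow p` is linear, and on a combination with leading entry 0 it
only drops that entry. -/
theorem Comb.clearColumn (h : ∀ r ∈ R, r.1.length = m + 1 ∧ r.2.length = n) {s : Bits × Bits}
    (hs : Comb (m + 1) n R s) (hs₀ : s.1.headD false = false) :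
    Comb m n (clearColumn R) (s.1.tail, s.2) := by
  rcases clearColumn_eq R with ⟨p, hp, -, hR⟩ | ⟨-, hR⟩
  · suffices Comb m n (RzCount.clearColumn R) (reduceRow p s) by
      rwa [reduceRow, if_neg (by simpa using hs₀)] at this
    clear hs₀
    induction hs with
    | zero => exact .zero
    | add hr hs ih =>
      rw [reduceRow_add (h p hp) (h _ hr) (hs.length h)]
      refine .add ?_ ih
      rw [hR]
      exact List.mem_map_of_mem hr
  · clear hs₀
    induction hs with
    | zero => exact .zero
    | add hr hs ih =>
      simp only [tail_xorv]
      refine .add (r := (_, _)) (s := (_, _)) ?_ ih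
      rw [hR]
      exact List.mem_map.2 ⟨_, hr, rfl⟩

theorem Comb.eq_zeros (hR : ∀ r ∈ R, r.2 = zeros n) {s : Bits × Bits} (hs : Comb m n R s) :
    s.2 = zeros n := by
  induction hs with
  | zero => rfl
  | add hr _ ih =>
    simp only [hR _ hr, ih]
    have := xorv_zeros (zeros n)
    rwa [length_zeros] at this

/-- What elimination knows about a row after `i` columns are cleared. -/
structure RowSpec (k : ℕ) (Q : List Bits) (i : ℕ) (r : Bits × Bits) : Prop where
  rest : ∀ j, bz (bit r.1 j) = selSum r.2 Q fun p => bz (bit (features k p) (i + j))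
  cleared : ∀ j < i, (selSum r.2 Q fun p => bz (bit (features k p) j)) = 0

variable {k i : ℕ} {Q : List Bits}

theorem RowSpec.xorv {r s : Bits × Bits} (hr : RowSpec k Q i r) (hs : RowSpec k Q i s)
    (h₁ : r.1.length = s.1.length) (h₂ : r.2.length = s.2.length) :
    RowSpec k Q i (xorv r.1 s.1, xorv r.2 s.2) :=
  ⟨fun j => by rw [bit_xorv h₁, bz_xor, hr.rest, hs.rest, selSum_xorv h₂],
    fun j hj => by rw [selSum_xorv h₂, hr.cleared j hj, hs.cleared j hj, add_zero]⟩

theorem RowSpec.tail {r : Bits × Bits} (hr : RowSpec k Q i r) (h : r.1.headD false = false) :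
    RowSpec k Q (i + 1) (r.1.tail, r.2) :=
  ⟨fun j => by rw [bit_tail, hr.rest, show i + (j + 1) = i + 1 + j by omega],
    fun j hj => by
      rcases Nat.lt_succ_iff_lt_or_eq.1 hj with hj | rfl
      · exact hr.cleared j hj
      · rw [← bit_eq_headD] at h
        have := hr.rest 0
        rw [h] at this
        simpa [bz] using this.symm⟩

theorem RowSpec.clearColumn (h : ∀ r ∈ R, r.1.length = m + 1 ∧ r.2.length = n)
    (hR : ∀ r ∈ R, RowSpec k Q i r) : ∀ r ∈ clearColumn R, RowSpec k Q (i + 1) r := by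
  intro r hr
  rcases clearColumn_eq R with ⟨p, hp, hp₁, hR'⟩ | ⟨hR₀, hR'⟩ <;> rw [hR'] at hr <;>
    obtain ⟨s, hs, rfl⟩ := List.mem_map.1 hr
  · have h₁ := (h s hs).1.trans (h p hp).1.symm
    have h₂ := (h s hs).2.trans (h p hp).2.symm
    rw [reduceRow]
    split_ifs with hs₁
    · exact ((hR s hs).xorv (hR p hp) h₁ h₂).tail (by simp only [headD_xorv h₁, hs₁, hp₁]; rfl)
    · exact (hR s hs).tail (by simpa using hs₁)
  · exact (hR s hs).tail (hR₀ s hs)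

end

/-! ### Initial rows, and completeness of the elimination. -/

theorem length_features (k : ℕ) (q : Bits) :
    (features (k + 1) q).length = 1 + q.length * (features k q).length := by
  simp [features, List.length_flatMap]
  ring

theorem length_features_congr {p q : Bits} (h : p.length = q.length) (k : ℕ) :
    (features k p).length = (features k q).length := by
  induction k with
  | zero => rfl
  | succ k ih => rw [length_features, length_features, h, ih]

theorem length_trackedRows {N k : ℕ} {Q : List Bits}
    (h : ∀ q ∈ Q, (features k q).length = N) :
    ∀ r ∈ trackedRows k Q, r.1.length = N ∧ r.2.length = Q.length := by
  induction Q with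
  | nil => simp [trackedRows]
  | cons p Q ih =>
    intro r hr
    rcases List.mem_cons.1 hr with rfl | hr
    · simp [h p, length_zeros]
    · obtain ⟨s, hs, rfl⟩ := List.mem_map.1 hr
      have := ih (fun q hq => h q (List.mem_cons_of_mem _ hq)) s hs
      simp [this]

theorem rowSpec_trackedRows (k : ℕ) (Q : List Bits) : ∀ r ∈ trackedRows k Q, RowSpec k Q 0 r := by
  induction Q with
  | nil => simp [trackedRows]
  | cons p Q ih =>
    intro r hr
    rcases List.mem_cons.1 hr with rfl | hr
    · refine ⟨fun j => ?_, fun j hj => absurd hj (Nat.not_lt_zero j)⟩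
      have := selSum_zeros Q.length Q fun p => bz (bit (features k p) (0 + j))
      simp only [selSum, List.zipWith_cons_cons, List.sum_cons] at this ⊢
      rw [this]
      simp [bz]
    · obtain ⟨s, hs, rfl⟩ := List.mem_map.1 hr
      refine ⟨fun j => ?_, fun j hj => absurd hj (Nat.not_lt_zero j)⟩
      rw [(ih s hs).rest]
      simp [selSum, bz]

/-- The second components of the rows are the unit vectors, so they span all selections. -/
theorem exists_comb_trackedRows {N k : ℕ} {Q : List Bits}
    (h : ∀ q ∈ Q, (features k q).length = N) (y : Bits) (hy : y.length = Q.length) :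
    ∃ v, Comb N Q.length (trackedRows k Q) (v, y) := by
  induction Q generalizing y with
  | nil =>
    rw [List.length_nil, List.length_eq_zero_iff] at hy
    exact ⟨zeros N, hy ▸ Comb.zero⟩
  | cons p Q ih =>
    cases y with
    | nil => simp at hy
    | cons c y =>
      obtain ⟨v, hv⟩ := ih (fun q hq => h q (List.mem_cons_of_mem _ hq)) y (by simpa using hy)
      have hlift : ∀ s, Comb N Q.length (trackedRows k Q) s →
          Comb N (p :: Q).length (trackedRows k (p :: Q)) (s.1, false :: s.2) := by
        intro s hs
        induction hs with
        | zero => exact .zero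
        | add hr _ ih =>
          refine Comb.add (r := (_, false :: _)) ?_ ih
          exact List.mem_cons_of_mem _ (List.mem_map.2 ⟨_, hr, rfl⟩)
      have h₁ := hlift _ hv
      cases c with
      | false => exact ⟨v, h₁⟩
      | true =>
        have h₂ := Comb.add (r := (features k p, true :: zeros Q.length)) List.mem_cons_self h₁
        have h₃ : xorv (true :: zeros Q.length) (false :: y) = true :: y := by
          change true :: xorv (zeros Q.length) y = _
          have : y.length = Q.length := by simpa using hy
          rw [xorv_comm, ← this, xorv_zeros]
        refine ⟨xorv (features k p) v, ?_⟩
        simp only [h₃] at h₂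
        exact h₂

theorem foldl_const {α β : Type} (f : α → α) (l : List β) (a : α) :
    l.foldl (fun s _ => f s) a = f^[l.length] a := by
  induction l generalizing a with
  | nil => rfl
  | cons b l ih => exact ih (f a)

/-- The second claim gives soundness: selections found by elimination are dependencies. The third
gives completeness: a combination with zero first component survives every clearing. -/
theorem iterate_clearColumn {N n k : ℕ} {Q : List Bits} {R : List (Bits × Bits)}
    (h : ∀ r ∈ R, r.1.length = N ∧ r.2.length = n) (hR : ∀ r ∈ R, RowSpec k Q 0 r) (i j : ℕ)
    (hij : i + j = N) :
    (∀ r ∈ clearColumn^[i] R, r.1.length = j ∧ r.2.length = n) ∧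
    (∀ r ∈ clearColumn^[i] R, RowSpec k Q i r) ∧
    ∀ y, Comb N n R (zeros N, y) → Comb j n (clearColumn^[i] R) (zeros j, y) := by
  induction i generalizing j with
  | zero =>
    have : j = N := by omega
    subst this
    exact ⟨h, hR, fun y hy => hy⟩
  | succ i ih =>
    obtain ⟨h₁, h₂, h₃⟩ := ih (j + 1) (by omega)
    rw [Function.iterate_succ_apply']
    exact ⟨clearColumn_length h₁, RowSpec.clearColumn h₁ h₂,
      fun y hy => (h₃ y hy).clearColumn h₁ rfl⟩

section

variable {k n : ℕ} {Q : List Bits}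

/-- The facts about the rows in the definition of `dependency`. -/
theorem dependency_rows (hQ : ∀ q ∈ Q, q.length = n) :
    ∃ R : List (Bits × Bits), dependency k Q =
        ((R.map fun r => r.2).filter fun y => y.any fun b => b).headD [] ∧
      (∀ r ∈ R, r.2.length = Q.length) ∧
      (∀ r ∈ R, ∀ j, (selSum r.2 Q fun p => bz (bit (features k p) j)) = 0) ∧
      ∀ y : Bits, y.length = Q.length →
        (∀ j, (selSum y Q fun p => bz (bit (features k p) j)) = 0) →
        (∀ r ∈ R, r.2 = zeros Q.length) → y = zeros Q.length := by
  set N := (features k (Q.headD [])).length with hN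
  have hlen : ∀ q ∈ Q, (features k q).length = N := by
    cases Q with
    | nil => simp
    | cons p Q =>
      intro q hq
      exact length_features_congr ((hQ q hq).trans (hQ p List.mem_cons_self).symm) k
  have hrows := length_trackedRows hlen
  obtain ⟨h₁, h₂, h₃⟩ := iterate_clearColumn hrows (rowSpec_trackedRows k Q) N 0 rfl
  refine ⟨clearColumn^[N] (trackedRows k Q), ?_, fun r hr => (h₁ r hr).2, fun r hr j => ?_,
    fun y hy hj hz => ?_⟩
  · rw [dependency, foldl_const]
  · rcases lt_or_ge j N with hj | hj
    · exact (h₂ r hr).cleared j hj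
    -- Indices beyond the number of features read the default `false`.
    · have : ∀ (y : Bits) (Q' : List Bits), (∀ q ∈ Q', q ∈ Q) →
          (selSum y Q' fun p => bz (bit (features k p) j)) = 0 := by
        intro y Q' hQ'
        induction y generalizing Q' with
        | nil => rfl
        | cons c y ih =>
          cases Q' with
          | nil => rfl
          | cons q Q' =>
            have h₄ := ih Q' fun q hq => hQ' q (List.mem_cons_of_mem _ hq)
            simp only [selSum, List.zipWith_cons_cons, List.sum_cons] at h₄ ⊢
            rw [h₄, bit_of_length_le ((hlen q (hQ' q List.mem_cons_self)).trans_le hj)]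
            simp [bz]
      exact this _ _ fun q hq => hq
  · obtain ⟨v, hv⟩ := exists_comb_trackedRows hlen y hy
    have hspec : ∀ s, Comb N Q.length (trackedRows k Q) s → RowSpec k Q 0 s := by
      intro s hs
      induction hs with
      | zero =>
        refine ⟨fun j => ?_, fun j hj => absurd hj (Nat.not_lt_zero j)⟩
        rw [bit_zeros, selSum_zeros]
        rfl
      | add hr hs ih =>
        have h₄ := hrows _ hr
        have h₅ := hs.length hrows
        exact (rowSpec_trackedRows k Q _ hr).xorv ih (h₄.1.trans h₅.1.symm)
          (h₄.2.trans h₅.2.symm)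
    -- By `RowSpec`, the first component records the feature sums of the selection `y`, which vanish
    -- by assumption.
    have hv₀ : v = zeros N := by
      refine bits_ext ((hv.length hrows).1.trans (length_zeros N).symm) fun j => ?_
      rw [bit_zeros, ← bz_eq_zero, (hspec _ hv).rest]
      exact hj _
    rw [hv₀] at hv
    exact (h₃ y hv).eq_zeros hz

theorem any_eq_false_iff (y : Bits) : (y.any fun b => b) = false ↔ y = zeros y.length := by
  induction y with
  | nil => simp [zeros]
  | cons c y ih =>
    rw [List.any_cons, Bool.or_eq_false_iff, ih, List.length_cons]
    simp [zeros, List.replicate_succ]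

theorem dependency_spec (hQ : ∀ q ∈ Q, q.length = n) (h : dependency k Q ≠ []) :
    (dependency k Q).length = Q.length ∧ ((dependency k Q).any fun b => b) = true ∧
      ∀ j, (selSum (dependency k Q) Q fun p => bz (bit (features k p) j)) = 0 := by
  obtain ⟨R, hR, h₁, h₂, -⟩ := dependency_rows (k := k) hQ
  have hmem : dependency k Q ∈ (R.map fun r => r.2).filter fun y => y.any fun b => b := by
    rw [hR] at h ⊢
    cases hl : (R.map fun r => r.2).filter fun y => y.any fun b => b with
    | nil => rw [hl] at h; exact absurd rfl h
    | cons a l => exact List.mem_cons_self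
  obtain ⟨hm, hany⟩ := List.mem_filter.1 hmem
  obtain ⟨r, hr, hr'⟩ := List.mem_map.1 hm
  rw [← hr'] at hany ⊢
  exact ⟨h₁ r hr, hany, h₂ r hr⟩

theorem dependency_complete (hQ : ∀ q ∈ Q, q.length = n) (h : dependency k Q = []) (y : Bits)
    (hy : y.length = Q.length)
    (hj : ∀ j, (selSum y Q fun p => bz (bit (features k p) j)) = 0) : y = zeros Q.length := by
  obtain ⟨R, hR, h₁, -, h₃⟩ := dependency_rows (k := k) hQ
  refine h₃ y hy hj fun r hr => ?_
  by_contra hne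
  have hany : (r.2.any fun b => b) = true := by
    by_contra hany
    refine hne ?_
    have := (any_eq_false_iff r.2).1 (by simpa using hany)
    rw [this, h₁ r hr]
  have hmem : r.2 ∈ (R.map fun r => r.2).filter fun y => y.any fun b => b :=
    List.mem_filter.2 ⟨List.mem_map.2 ⟨r, hr, rfl⟩, hany⟩
  rw [hR] at h
  cases hl : (R.map fun r => r.2).filter fun y => y.any fun b => b with
  | nil => rw [hl] at hmem; simp at hmem
  | cons a l =>
    rw [hl] at h
    have ha : a ∈ (R.map fun r => r.2).filter fun y => y.any fun b => b := by
      rw [hl]; exact List.mem_cons_self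
    have := (List.mem_filter.1 ha).2
    rw [show a = [] from h] at this
    simp at this

end

/-! ### The number of independent features -/

/-- The monomials whose values are listed by `features`. -/
def featureMonomials (n : ℕ) : ℕ → List (List ℕ)
  | 0 => []
  | k + 1 => [] :: (List.range n).flatMap fun i => (featureMonomials n k).map fun T => i :: T

theorem map_bit_range (q : Bits) : (List.range q.length).map (bit q) = q := by
  refine bits_ext (by simp) fun i => ?_
  rcases lt_or_ge i q.length with hi | hi
  · simp [bit, hi]
  · rw [bit_of_length_le hi, bit_of_length_le (by simpa using hi)]

theorem flatMap_eq_flatMap_range {β : Type} (q : Bits) (g : Bool → List β) :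
    q.flatMap g = (List.range q.length).flatMap fun i => g (bit q i) := by
  conv_lhs => rw [← map_bit_range q, List.flatMap_map]

theorem features_eq (k : ℕ) (q : Bits) :
    features k q = (featureMonomials q.length k).map fun T => T.all (bit q) := by
  induction k with
  | zero => rfl
  | succ k ih =>
    rw [features, featureMonomials, List.map_cons, List.map_flatMap, ih]
    rw [flatMap_eq_flatMap_range]
    simp [Function.comp_def]

theorem mem_featureMonomials {n k : ℕ} {T : List ℕ} :
    T ∈ featureMonomials n k ↔ T.length < k ∧ ∀ i ∈ T, i < n := by
  induction k generalizing T with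
  | zero => simp [featureMonomials]
  | succ k ih =>
    cases T with
    | nil => simp [featureMonomials]
    | cons i T =>
      simp only [featureMonomials, List.mem_cons, List.mem_flatMap, List.mem_map, List.mem_range,
        List.length_cons]
      constructor
      · rintro (h | ⟨j, hj, U, hU, h⟩)
        · simp at h
        · obtain ⟨rfl, rfl⟩ := List.cons.inj h
          obtain ⟨h₁, h₂⟩ := ih.1 hU
          refine ⟨by omega, ?_⟩
          rintro l (rfl | hl)
          · exact hj
          · exact h₂ l hl
      · rintro ⟨h₁, h₂⟩
        exact Or.inr ⟨i, h₂ i (Or.inl rfl), T, ih.2 ⟨by omega, fun l hl => h₂ l (Or.inr hl)⟩, rfl⟩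

theorem bz_all (T : List ℕ) (q : Bits) : bz (T.all (bit q)) = mon T q := by
  induction T with
  | nil => rfl
  | cons i T ih => rw [List.all_cons, bz_and, ih, mon_cons]

/-- Each feature is a monomial. -/
theorem exists_mon_eq_feature {n k j : ℕ} (hj : j < (featureMonomials n k).length) :
    ∃ T : List ℕ, (T.length < k ∧ ∀ i ∈ T, i < n) ∧
      ∀ q : Bits, q.length = n → bz (bit (features k q) j) = mon T q := by
  refine ⟨(featureMonomials n k)[j], mem_featureMonomials.1 (List.getElem_mem _), fun q hq => ?_⟩
  subst hq
  rw [← bz_all, features_eq]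
  simp [bit, hj]

/-- Each monomial of small degree is a feature. -/
theorem exists_feature_eq_mon {n k : ℕ} {T : List ℕ} (hT : T.length < k) (hn : ∀ i ∈ T, i < n) :
    ∃ j, ∀ q : Bits, q.length = n → mon T q = bz (bit (features k q) j) := by
  obtain ⟨j, hj, hjT⟩ := List.getElem_of_mem (mem_featureMonomials.2 ⟨hT, hn⟩)
  refine ⟨j, fun q hq => ?_⟩
  subst hq
  rw [← bz_all, features_eq]
  simp [bit, hj, hjT]

theorem mon_eq_zero {T : List ℕ} {q : Bits} {i : ℕ} (hi : i ∈ T) (h : q.length ≤ i) :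
    mon T q = 0 := by
  refine List.prod_eq_zero (List.mem_map.2 ⟨i, hi, ?_⟩)
  rw [bit_of_length_le h]
  rfl

theorem null_of_features {n k : ℕ} {J : List Bits} (hJ : ∀ q ∈ J, q.length = n)
    (h : ∀ j, (J.map fun p => bz (bit (features k p) j)).sum = 0) : Null k J := by
  intro T hT
  by_cases hn : ∀ i ∈ T, i < n
  · obtain ⟨j, hj⟩ := exists_feature_eq_mon hT hn
    rw [← h j]
    congr 1
    exact List.map_congr_left fun q hq => hj q (hJ q hq)
  · push Not at hn
    obtain ⟨i, hi, hni⟩ := hn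
    refine List.sum_eq_zero fun x hx => ?_
    obtain ⟨q, hq, rfl⟩ := List.mem_map.1 hx
    exact mon_eq_zero hi (by rw [hJ q hq]; exact hni)

theorem bz_mul_self (b : Bool) : bz b * bz b = bz b := by cases b <;> decide

/-- Bits are idempotent, so repeated indices may be dropped; monomials are counted by sets of
variables. -/
theorem mon_eq_prod (T : List ℕ) (q : Bits) : mon T q = ∏ i ∈ T.toFinset, bz (bit q i) := by
  induction T with
  | nil => rfl
  | cons i T ih =>
    rw [mon_cons, ih, List.toFinset_cons]
    by_cases hi : i ∈ T.toFinset
    · rw [Finset.insert_eq_of_mem hi, ← Finset.mul_prod_erase _ _ hi, ← mul_assoc, bz_mul_self]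
    · rw [Finset.prod_insert hi]

theorem card_small_subsets (S : Finset ℕ) (k : ℕ) :
    (S.powerset.filter fun U => U.card < k).card = ∑ i ∈ Finset.range k, S.card.choose i := by
  rw [Finset.card_eq_sum_card_fiberwise (f := Finset.card) (t := Finset.range k)]
  · refine Finset.sum_congr rfl fun i hi => ?_
    rw [← Finset.card_powersetCard]
    congr 1
    ext U
    simp only [Finset.mem_filter, Finset.mem_powerset, Finset.mem_powersetCard]
    have := Finset.mem_range.1 hi
    constructor
    · rintro ⟨⟨h₁, -⟩, h₂⟩
      exact ⟨h₁, h₂⟩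
    · rintro ⟨h₁, h₂⟩
      exact ⟨⟨h₁, by omega⟩, h₂⟩
  · intro U hU
    simpa using (Finset.mem_filter.1 (Finset.mem_coe.1 hU)).2

theorem selSum_ofFn (Q : List Bits) (c : Fin Q.length → Bool) (F : Bits → ZMod 2) :
    selSum (List.ofFn c) Q F = ∑ j, bz (c j) * F (Q.get j) := by
  induction Q with
  | nil => simp [selSum]
  | cons p Q ih =>
    have := ih fun j => c j.succ
    change selSum (List.ofFn (n := Q.length + 1) c) _ _ = ∑ j : Fin (Q.length + 1), _
    rw [Fin.sum_univ_succ, List.ofFn_succ]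
    simp only [selSum, List.zipWith_cons_cons, List.sum_cons] at this ⊢
    rw [this]
    rfl

/-- More parities than monomials have a dependency. The monomials in the variables of `S` suffice
if the other variables belong to all parities. -/
theorem exists_dependency {n k : ℕ} {Q : List Bits} (hQ : ∀ q ∈ Q, q.length = n) (S : Finset ℕ)
    (hS : ∀ q ∈ Q, ∀ i < n, i ∉ S → bit q i = true)
    (hcard : ∑ i ∈ Finset.range k, S.card.choose i < Q.length) :
    ∃ y : Bits, y.length = Q.length ∧ y ≠ zeros Q.length ∧
      ∀ j, (selSum y Q fun p => bz (bit (features k p) j)) = 0 := by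
  -- Each parity is mapped to its values at the squarefree monomials in the variables of `S`. There
  -- are more parities than coordinates, so these vectors are linearly dependent.
  let v : Fin Q.length → {U // U ∈ S.powerset.filter fun U => U.card < k} → ZMod 2 := fun j U => ∏ i ∈ U.1, bz (bit (Q.get j) i)
  have hdep : ¬ LinearIndependent (ZMod 2) v := by
    intro hv
    have h₁ := hv.fintype_card_le_finrank
    rw [Module.finrank_fintype_fun_eq_card, Fintype.card_fin, Fintype.card_coe,
      card_small_subsets] at h₁
    omega
  obtain ⟨g, hg, j₀, hj₀⟩ := Fintype.not_linearIndependent_iff.1 hdep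
  have hbz : ∀ x : ZMod 2, bz (decide (x ≠ 0)) = x := by decide
  refine ⟨List.ofFn fun j => decide (g j ≠ 0), by simp, ?_, fun j => ?_⟩
  · intro h
    have h₁ : bit (List.ofFn fun j => decide (g j ≠ 0)) j₀ = true := by
      simp [bit, hj₀]
    rw [h, bit_zeros] at h₁
    simp at h₁
  · rw [selSum_ofFn]
    simp only [hbz]
    have hQ' : ∀ i, (Q.get i).length = n := fun i => hQ _ (List.get_mem _ _)
    rcases lt_or_ge j (featureMonomials n k).length with hj | hj
    · obtain ⟨T, ⟨hTk, hTn⟩, hT⟩ := exists_mon_eq_feature hj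
      have hU : T.toFinset ∩ S ∈ S.powerset.filter fun U => U.card < k := by
        refine Finset.mem_filter.2 ⟨Finset.mem_powerset.2 Finset.inter_subset_right, ?_⟩
        calc (T.toFinset ∩ S).card ≤ T.toFinset.card := Finset.card_le_card Finset.inter_subset_left
          _ ≤ T.length := List.toFinset_card_le _
          _ < k := hTk
      have h₁ := congrFun hg ⟨_, hU⟩
      simp only [Finset.sum_apply, Pi.smul_apply, smul_eq_mul, v, Pi.zero_apply] at h₁
      rw [← h₁]
      refine Finset.sum_congr rfl fun i _ => ?_
      rw [hT _ (hQ' i), mon_eq_prod]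
      congr 1
      -- Variables outside `S` take the value 1 on all of `Q`, so they may be deleted from a
      -- monomial.
      refine (Finset.prod_subset Finset.inter_subset_left fun l hl hl' => ?_).symm
      have hlT := List.mem_toFinset.1 hl
      rw [hS _ (List.get_mem _ _) l (hTn l hlT)
        fun hlS => hl' (Finset.mem_inter.2 ⟨hl, hlS⟩)]
      rfl
    · refine Finset.sum_eq_zero fun i _ => ?_
      rw [bit_of_length_le]
      · simp [bz]
      · rw [features_eq, List.length_map, hQ' i]
        exact hj

/-! ### Reducing the number of parities -/

theorem select_perm {y : Bits} {Q : List Bits} (h : y.length = Q.length) :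
    (select y Q ++ select (y.map fun b => !b) Q).Perm Q := by
  induction y generalizing Q with
  | nil =>
    cases Q
    · exact List.Perm.refl _
    · simp at h
  | cons c y ih =>
    cases Q with
    | nil => simp at h
    | cons p Q =>
      have := ih (Q := Q) (by simpa using h)
      cases c with
      | true => exact this.cons p
      | false => exact List.perm_middle.trans (this.cons p)

theorem shiftSelected_perm {y : Bits} {Q : List Bits} (h : y.length = Q.length) (z : Bits) :
    (((select y Q).map fun p => xorv p z) ++ select (y.map fun b => !b) Q).Perm
      (shiftSelected z y Q) := by
  induction y generalizing Q with
  | nil => exact List.Perm.refl _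
  | cons c y ih =>
    cases Q with
    | nil => simp at h
    | cons p Q =>
      have := ih (Q := Q) (by simpa using h)
      cases c with
      | true => exact this.cons (xorv p z)
      | false => exact List.perm_middle.trans (this.cons p)

theorem select_ne_nil {y : Bits} {Q : List Bits} (h : y.length = Q.length)
    (hy : (y.any fun b => b) = true) : select y Q ≠ [] := by
  induction y generalizing Q with
  | nil => simp at hy
  | cons c y ih =>
    cases Q with
    | nil => simp at h
    | cons p Q =>
      cases c with
      | true => simp [select]
      | false =>
        have := ih (Q := Q) (by simpa using h) (by simpa using hy)
        simpa [select] using this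

theorem reduceOnce_of_nil {k : ℕ} {b : Bits} {Q : List Bits} (h : dependency k Q = []) :
    reduceOnce k b Q = Q := by
  simp [reduceOnce, h, select]

section

variable {k n : ℕ} {b : Bits} {Q : List Bits}

/-- The selected parities are translated by `b + a`, where `a` is one of them. This turns `a` into
`b`, so at least one parity disappears when the copies of `b` are discarded. A bit that is 1 in `b`
and in all of `Q` is 0 in the translation vector and hence stays 1. -/
theorem reduceOnce_of_ne_nil (hQ : ∀ q ∈ Q, q.length = n) (hb : b.length = n)
    (h : dependency k Q ≠ []) :
    (∀ q ∈ reduceOnce k b Q, q.length = n) ∧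
      (∃ r, Null (k + 1) (Q ++ (reduceOnce k b Q ++ List.replicate r b))) ∧
      (reduceOnce k b Q).length < Q.length ∧
      ∀ i, (∀ q ∈ Q, bit q i = true) → bit b i = true →
        ∀ q ∈ reduceOnce k b Q, bit q i = true := by
  obtain ⟨hlen, hany, hsum⟩ := dependency_spec hQ h
  set y := dependency k Q with hy
  obtain ⟨a, s, hs⟩ := List.exists_cons_of_ne_nil (select_ne_nil hlen hany)
  have hdef : reduceOnce k b Q = (shiftSelected (xorv b a) y Q).filter fun p => !(p == b) := by
    simp only [reduceOnce, ← hy, hs, List.isEmpty_cons, Bool.false_eq_true, if_false,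
      List.headD_cons]
  have hperm := select_perm hlen
  have hperm' := shiftSelected_perm hlen (xorv b a)
  have hsel : ∀ q ∈ select y Q, q ∈ Q := fun q hq => hperm.subset (List.mem_append_left _ hq)
  have ha : a ∈ select y Q := by rw [hs]; exact List.mem_cons_self
  have halen := hQ a (hsel a ha)
  have hz : (xorv b a).length = n := (length_xorv (hb.trans halen.symm)).trans halen
  have hmem : ∀ q ∈ shiftSelected (xorv b a) y Q,
      q ∈ Q ∨ ∃ p ∈ Q, q = xorv p (xorv b a) := by
    intro q hq
    rcases List.mem_append.1 (hperm'.symm.subset hq) with hq | hq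
    · obtain ⟨p, hp, rfl⟩ := List.mem_map.1 hq
      exact Or.inr ⟨p, hsel p hp, rfl⟩
    · exact Or.inl (hperm.subset (List.mem_append_right _ hq))
  have hmem' : ∀ q ∈ reduceOnce k b Q, q ∈ Q ∨ ∃ p ∈ Q, q = xorv p (xorv b a) := by
    intro q hq
    rw [hdef] at hq
    exact hmem q (List.mem_filter.1 hq).1
  have hbmem : b ∈ shiftSelected (xorv b a) y Q := by
    refine hperm'.subset (List.mem_append_left _ (List.mem_map.2 ⟨a, ha, ?_⟩))
    exact xorv_cancel (halen.trans hb.symm)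
  have hnull : Null (k + 1) (Q ++ shiftSelected (xorv b a) y Q) := by
    have h₁ : Null k (select y Q) :=
      null_of_features (fun q hq => hQ q (hsel q hq)) fun j => by rw [sum_select]; exact hsum j
    have h₂ := (h₁.shift fun p hp => (hQ p (hsel p hp)).trans hz.symm).append
      (null_double (k + 1) (select (y.map fun b => !b) Q))
    refine h₂.perm ?_
    refine List.Perm.trans ?_ (hperm.append hperm')
    rw [List.perm_iff_count]
    intro Z
    simp only [List.count_append]
    omega
  have hfilter : (shiftSelected (xorv b a) y Q).Perm
      (reduceOnce k b Q ++ List.replicate ((shiftSelected (xorv b a) y Q).count b) b) := by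
    rw [hdef, ← List.filter_beq]
    refine (List.filter_append_perm (fun p => p == b) _).symm.trans ?_
    exact List.perm_append_comm
  refine ⟨fun q hq => ?_, ⟨_, hnull.perm (hfilter.append_left Q)⟩, ?_, fun i hi hbi q hq => ?_⟩
  · rcases hmem' q hq with hq | ⟨p, hp, rfl⟩
    · exact hQ q hq
    · rw [length_xorv ((hQ p hp).trans hz.symm), hz]
  · have h₁ := hfilter.length_eq
    have h₂ : (shiftSelected (xorv b a) y Q).length = Q.length := by
      simp [shiftSelected, hlen]
    have h₃ := List.count_pos_iff.2 hbmem
    rw [List.length_append, List.length_replicate] at h₁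
    omega
  · rcases hmem' q hq with hq | ⟨p, hp, rfl⟩
    · exact hi q hq
    · rw [bit_xorv ((hQ p hp).trans hz.symm), bit_xorv (hb.trans halen.symm), hi p hp, hbi,
        hi a (hsel a ha)]
      rfl

theorem reduceOnce_spec (hQ : ∀ q ∈ Q, q.length = n) (hb : b.length = n) :
    (∀ q ∈ reduceOnce k b Q, q.length = n) ∧
      (∃ r, Null (k + 1) (Q ++ (reduceOnce k b Q ++ List.replicate r b))) ∧
      ∀ i, (∀ q ∈ Q, bit q i = true) → bit b i = true →
        ∀ q ∈ reduceOnce k b Q, bit q i = true := by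
  by_cases h : dependency k Q = []
  · rw [reduceOnce_of_nil h]
    exact ⟨hQ, ⟨0, by simpa using null_double (k + 1) Q⟩, fun i hi _ => hi⟩
  · obtain ⟨h₁, h₂, -, h₃⟩ := reduceOnce_of_ne_nil hQ hb h
    exact ⟨h₁, h₂, h₃⟩

/-- Consecutive replacements telescope: the intermediate list occurs twice and cancels modulo 2. -/
theorem iterate_reduceOnce_spec (hQ : ∀ q ∈ Q, q.length = n) (hb : b.length = n) (m : ℕ) :
    (∀ q ∈ (reduceOnce k b)^[m] Q, q.length = n) ∧
      (∃ r, Null (k + 1) (Q ++ ((reduceOnce k b)^[m] Q ++ List.replicate r b))) ∧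
      ∀ i, (∀ q ∈ Q, bit q i = true) → bit b i = true →
        ∀ q ∈ (reduceOnce k b)^[m] Q, bit q i = true := by
  induction m with
  | zero => exact ⟨hQ, ⟨0, by simpa using null_double (k + 1) Q⟩, fun i hi _ => hi⟩
  | succ m ih =>
    rw [Function.iterate_succ_apply']
    obtain ⟨h₁, ⟨r, h₂⟩, h₃⟩ := ih
    obtain ⟨h₄, ⟨s, h₅⟩, h₆⟩ := reduceOnce_spec (k := k) h₁ hb
    refine ⟨h₄, ⟨r + s, ?_⟩, fun i hi hbi => h₆ i (h₃ i hi hbi) hbi⟩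
    refine Null.cancel_right (K := (reduceOnce k b)^[m] Q) ((h₂.append h₅).perm ?_)
    rw [List.perm_iff_count]
    intro Z
    simp only [List.count_append, List.replicate_add]
    omega

theorem dependency_nil : dependency k [] = [] := by
  have : ∀ m, clearColumn^[m] [] = [] := by
    intro m
    induction m with
    | zero => rfl
    | succ m ih => rw [Function.iterate_succ_apply', ih]; rfl
  rw [dependency, foldl_const]
  simp [trackedRows, this]

/-- Every round with a dependency shortens the list, so as many rounds as there are parities
suffice. -/
theorem dependency_iterate (hb : b.length = n) (m : ℕ) (hQ : ∀ q ∈ Q, q.length = n)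
    (hm : Q.length ≤ m) : dependency k ((reduceOnce k b)^[m] Q) = [] := by
  induction m generalizing Q with
  | zero =>
    rw [List.length_eq_zero_iff.1 (Nat.le_zero.1 hm)]
    exact dependency_nil
  | succ m ih =>
    rw [Function.iterate_succ_apply]
    by_cases h : dependency k Q = []
    · rw [reduceOnce_of_nil h, Function.iterate_fixed (reduceOnce_of_nil h), h]
    · obtain ⟨h₁, -, h₃, -⟩ := reduceOnce_of_ne_nil hQ hb h
      exact ih h₁ (by omega)

theorem oddLength_eq (Q : List Bits) : oddLength Q = decide (Q.length % 2 = 1) := by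
  have h : ∀ s : Bool, Q.foldl (fun s _ => !s) s = Bool.xor s (decide (Q.length % 2 = 1)) := by
    induction Q with
    | nil => intro s; simp
    | cons q Q ih =>
      intro s
      rw [List.foldl_cons, ih, List.length_cons]
      rcases Nat.mod_two_eq_zero_or_one Q.length with h | h <;>
        simp [Nat.add_mod, h]
  exact (h false).trans (Bool.false_xor _)

/-- `S` contains the variables that are not known to belong to all parities. It is the whole range
for the final extraction, and the range without the qubit for a Hadamard gate. -/
theorem reduce_spec (hQ : ∀ q ∈ Q, q.length = n) (hb : b.length = n) (S : Finset ℕ)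
    (hS : ∀ i < n, i ∉ S → bit b i = true ∧ ∀ q ∈ Q, bit q i = true) :
    (∀ q ∈ reduce k b Q, q.length = n) ∧ Null (k + 1) (Q ++ reduce k b Q) ∧
      (∀ i < n, i ∉ S → ∀ q ∈ reduce k b Q, bit q i = true) ∧
      ∃ Q' B, reduce k b Q = Q' ++ B ∧ Q'.length ≤ ∑ i ∈ Finset.range k, S.card.choose i ∧
        (B = [] ∨ B = [b]) := by
  obtain ⟨h₁, ⟨r, h₂⟩, h₃⟩ := iterate_reduceOnce_spec (k := k) hQ hb Q.length
  have h₄ := dependency_iterate (k := k) hb Q.length hQ le_rfl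
  have hiter : iterReduce k b Q = (reduceOnce k b)^[Q.length] Q := foldl_const _ _ _
  rw [← hiter] at h₁ h₂ h₃ h₄
  set B : List Bits := if oddLength (Q ++ iterReduce k b Q) then [b] else [] with hB
  have hB' : B = [] ∨ B = [b] := by
    rw [hB]
    split_ifs
    · exact Or.inr rfl
    · exact Or.inl rfl
  have hmemB : ∀ q ∈ B, q = b := by
    rcases hB' with h | h <;> rw [h] <;> simp
  have hred : reduce k b Q = iterReduce k b Q ++ B := rfl
  have hbits : ∀ i < n, i ∉ S → ∀ q ∈ iterReduce k b Q, bit q i = true :=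
    fun i hi hiS => h₃ i (hS i hi hiS).2 (hS i hi hiS).1
  refine ⟨fun q hq => ?_, ?_, fun i hi hiS q hq => ?_, _, B, rfl, ?_, hB'⟩
  · rcases List.mem_append.1 hq with hq | hq
    · exact h₁ q hq
    · rw [hmemB q hq, hb]
  -- The empty monomial shows that the total length, with the `r` discarded copies of `b`, is even.
  -- So `r` has the parity that `oddLength` computes, and all copies but at most one cancel in
  -- pairs.
  · have hlen := h₂ [] (Nat.succ_pos k)
    simp only [show mon [] = fun _ => 1 from rfl, List.map_const', List.sum_replicate,
      nsmul_eq_mul, mul_one, List.length_append, List.length_replicate] at hlen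
    have hlen' := (ZMod.natCast_eq_zero_iff _ _).1 hlen
    have hr : List.replicate r b = B ++ (List.replicate (r / 2) b ++ List.replicate (r / 2) b) := by
      rw [← List.replicate_add]
      rw [oddLength_eq, List.length_append] at hB
      rcases Nat.mod_two_eq_zero_or_one r with h | h
      · rw [hB, if_neg (by simp; omega), List.nil_append]
        congr 1
        omega
      · rw [hB, if_pos (by simp; omega), List.singleton_append, ← List.replicate_succ]
        congr 1
        omega
    rw [hr, ← List.append_assoc, ← List.append_assoc, List.append_assoc Q] at h₂
    exact h₂.cancel_right
  · rcases List.mem_append.1 hq with hq | hq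
    · exact hbits i hi hiS q hq
    · rw [hmemB q hq, (hS i hi hiS).1]
  -- A list that is still too long would have a dependency, but the iteration ended without one.
  · by_contra hcard
    obtain ⟨y, hy, hy₀, hysum⟩ := exists_dependency h₁ S
      (fun q hq i hi hiS => hbits i hi hiS q hq) (not_le.1 hcard)
    exact hy₀ (dependency_complete h₁ h₄ y hy hysum)

end

/-! ### Diagonal operators -/

noncomputable def omega (d : ℕ) : ℂ := Complex.exp (Complex.I * ((Real.pi / 2 ^ d : ℝ) : ℂ))

theorem omega_sq (d : ℕ) :
    Complex.exp (Complex.I * ((2 * Real.pi / 2 ^ d : ℝ) : ℂ)) = omega d ^ 2 := by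
  rw [omega, ← Complex.exp_nat_mul]
  congr 1
  push_cast
  ring

theorem omega_pow (d : ℕ) : omega d ^ 2 ^ (d + 1) = 1 := by
  rw [omega, ← Complex.exp_nat_mul, ← Complex.exp_two_pi_mul_I]
  congr 1
  push_cast
  have : (2 : ℂ) ^ d ≠ 0 := pow_ne_zero _ two_ne_zero
  field_simp
  ring

/-- The operator `|x⟩ ↦ ω ^ (f x) |x⟩`. -/
noncomputable def phase (n d : ℕ) (f : Bits → ℕ) : Operator n :=
  Matrix.diagonal fun x => omega d ^ f (List.ofFn x)

section

variable {n d : ℕ}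

theorem phase_mul (f g : Bits → ℕ) : phase n d f * phase n d g = phase n d fun x => f x + g x := by
  simp [phase, Matrix.diagonal_mul_diagonal, pow_add]

theorem phase_zero : phase n d (fun _ => 0) = 1 := by
  simp [phase]

theorem phase_congr {f g : Bits → ℕ} (h : ∀ x, f x ≡ g x [MOD 2 ^ (d + 1)]) :
    phase n d f = phase n d g := by
  have key : ∀ a : ℕ, omega d ^ a = omega d ^ (a % 2 ^ (d + 1)) := fun a => by
    conv_lhs => rw [← Nat.div_add_mod a (2 ^ (d + 1)), pow_add, pow_mul, omega_pow, one_pow,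
      one_mul]
  rw [phase, phase]
  congr 1
  funext x
  rw [key (f _), key (g _), h]

theorem bit_ofFn (x : Fin n → Bool) (i : Fin n) : bit (List.ofFn x) i = x i := by
  simp [bit]

theorem rzMatrix_eq (a : Fin n) :
    rzMatrix (Real.pi / 2 ^ d) a = phase n d fun x => (bit x a).toNat := by
  rw [rzMatrix, phase]
  congr 1
  funext x
  rw [bit_ofFn]
  cases x a <;> simp [omega]

theorem rzMatrix_two_eq (a : Fin n) :
    rzMatrix (2 * Real.pi / 2 ^ d) a = phase n d fun x => 2 * (bit x a).toNat := by
  rw [rzMatrix, phase]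
  congr 1
  funext x
  rw [bit_ofFn, omega_sq]
  cases x a <;> simp

/-! ### Moving CNOT and Hadamard gates past diagonal operators. -/

/-- The classical action of a CNOT gate. -/
def cnotMap (c t : Fin n) (x : Fin n → Bool) : Fin n → Bool :=
  Function.update x t (Bool.xor (x t) (x c))

theorem cnotMap_cnotMap {c t : Fin n} (h : c ≠ t) (x : Fin n → Bool) :
    cnotMap c t (cnotMap c t x) = x := by
  funext i
  by_cases hi : i = t
  · subst hi
    simp [cnotMap, h]
  · simp [cnotMap, hi]

theorem cnotMatrix_mul_self {c t : Fin n} (h : c ≠ t) : cnotMatrix c t * cnotMatrix c t = 1 := by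
  ext y x
  rw [Matrix.mul_apply, Finset.sum_eq_single (cnotMap c t x)]
  · change (if y = cnotMap c t (cnotMap c t x) then (1 : ℂ) else 0) *
      (if cnotMap c t x = cnotMap c t x then 1 else 0) = _
    rw [cnotMap_cnotMap h, if_pos rfl, mul_one, Matrix.one_apply]
  · intro z _ hz
    change _ * (if z = cnotMap c t x then (1 : ℂ) else 0) = 0
    rw [if_neg hz, mul_zero]
  · simp

theorem diagonal_mul_cnotMatrix (c t : Fin n) (f : (Fin n → Bool) → ℂ) :
    Matrix.diagonal f * cnotMatrix c t =
      cnotMatrix c t * Matrix.diagonal fun x => f (cnotMap c t x) := by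
  ext y x
  rw [Matrix.diagonal_mul, Matrix.mul_diagonal]
  change f y * (if y = cnotMap c t x then (1 : ℂ) else 0) =
    (if y = cnotMap c t x then (1 : ℂ) else 0) * f (cnotMap c t x)
  split_ifs with h
  · rw [h, one_mul, mul_one]
  · rw [zero_mul, mul_zero]

theorem ofFn_cnotMap {c t : Fin n} (x : Fin n → Bool) :
    List.ofFn (cnotMap c t x) =
      if x c then xorv (List.ofFn x) (unitv n t) else List.ofFn x := by
  have hlen : (List.ofFn x).length = (unitv n t).length := by simp [length_unitv]
  refine bits_ext ?_ fun i => ?_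
  · split_ifs <;> simp [length_xorv hlen, length_unitv]
  · rcases lt_or_ge i n with hi | hi
    · have h₁ := bit_ofFn (cnotMap c t x) ⟨i, hi⟩
      have h₂ := bit_ofFn x ⟨i, hi⟩
      simp only at h₁ h₂
      rw [h₁]
      by_cases hit : (⟨i, hi⟩ : Fin n) = t
      · subst hit
        cases hc : x c
        · simp [cnotMap, hc, h₂]
        · simp [cnotMap, hc, bit_xorv hlen, h₂, bit_unitv hi]
      · have hne : (i == t) = false := beq_eq_false_iff_ne.2 fun h => hit (Fin.ext h)
        split_ifs <;> simp [cnotMap, hit, bit_xorv hlen, h₂, bit_unitv t.2, hne]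
    · rw [bit_of_length_le (by simpa using hi), bit_of_length_le]
      split_ifs
      · rw [length_xorv hlen, length_unitv]
        exact hi
      · simpa using hi

/-- The gate adds `x c` to the target bit, which changes exactly the parities that contain the
target. -/
theorem par_pullback {c t : Fin n} {q : Bits} (hq : q.length = n)
    (x : Fin n → Bool) :
    par (pullback c t q) (List.ofFn x) = par q (List.ofFn (cnotMap c t x)) := by
  have h₁ : q.length = (unitv q.length c).length := by rw [length_unitv]
  have h₂ : (List.ofFn x).length = (unitv n t).length := by simp [length_unitv]
  have h₃ : par q (List.ofFn (cnotMap c t x)) =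
      Bool.xor (par q (List.ofFn x)) (x c && bit q t) := by
    rw [ofFn_cnotMap]
    cases hc : x c
    · simp
    · rw [if_pos rfl, par_comm, par_xorv h₂, par_comm _ q, par_unitv n t q hq, Bool.true_and]
  rw [h₃, pullback]
  cases ht : bit q t
  · simp
  · rw [if_pos rfl, par_xorv h₁, hq, par_unitv n c _ (by simp), bit_ofFn, Bool.and_true]

theorem length_pullback (c t : ℕ) (q : Bits) : (pullback c t q).length = q.length := by
  rw [pullback]
  split_ifs
  · rw [length_xorv (length_unitv _ _).symm, length_unitv]
  · rfl

theorem phase_wt_mul_cnotMatrix (c t : Fin n) {Q : List Bits} (hQ : ∀ q ∈ Q, q.length = n) :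
    phase n d (wt Q) * cnotMatrix c t = cnotMatrix c t * phase n d (wt (Q.map (pullback c t))) := by
  rw [phase, diagonal_mul_cnotMatrix, phase]
  congr 2
  funext x
  congr 1
  rw [wt, wt, List.countP_map]
  refine List.countP_congr fun q hq => ?_
  rw [Function.comp_apply, par_pullback (hQ q hq)]

theorem par_congr_of_bit {q x y : Bits} {a : ℕ} (hx : x.length = y.length)
    (hq : bit q a = false) (h : ∀ i, i ≠ a → bit x i = bit y i) : par q x = par q y := by
  induction q generalizing x y a with
  | nil => rw [par_nil_left, par_nil_left]
  | cons b q ih =>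
    cases x with
    | nil => rw [List.length_eq_zero_iff.1 hx.symm]
    | cons c x =>
      cases y with
      | nil => simp at hx
      | cons e y =>
        rw [par_cons, par_cons]
        cases a with
        | zero =>
          rw [show b = false from hq, show x = y from bits_ext (by simpa using hx) fun i =>
            h (i + 1) (Nat.succ_ne_zero i)]
          rfl
        | succ a =>
          rw [show c = e from h 0 (Nat.succ_ne_zero a).symm,
            ih (a := a) (by simpa using hx) hq fun i hi => h (i + 1) fun h => hi (Nat.succ.inj h)]

/-- Nonzero entries of the Hadamard gate join only basis states that agree outside `a`, and on these
the parities without `a` coincide. -/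
theorem phase_wt_mul_hadMatrix (a : Fin n) {Q : List Bits} (hQ : ∀ q ∈ Q, bit q a = false) :
    phase n d (wt Q) * hadMatrix a = hadMatrix a * phase n d (wt Q) := by
  ext y x
  rw [phase, Matrix.diagonal_mul, Matrix.mul_diagonal]
  by_cases h : ∀ j, j ≠ a → y j = x j
  · have : wt Q (List.ofFn y) = wt Q (List.ofFn x) := by
      refine List.countP_congr fun q hq => ?_
      rw [par_congr_of_bit (x := List.ofFn y) (y := List.ofFn x) (by simp) (hQ q hq)
        fun i hi => ?_]
      rcases lt_or_ge i n with hin | hin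
      · have h₁ := h ⟨i, hin⟩ fun h => hi (congrArg Fin.val h)
        have h₂ := bit_ofFn y ⟨i, hin⟩
        have h₃ := bit_ofFn x ⟨i, hin⟩
        simp only at h₂ h₃
        rw [h₂, h₃, h₁]
      · rw [bit_of_length_le (by simpa using hin), bit_of_length_le (by simpa using hin)]
    rw [this, mul_comm]
  · simp [hadMatrix, h]

/-! ### Lists of raw gates as circuits -/

theorem unitary_append (C D : Circuit n) :
    Circuit.unitary d (C ++ D) = Circuit.unitary d C * Circuit.unitary d D := by
  simp [Circuit.unitary]

theorem unitary_cons (g : Gate n) (C : Circuit n) :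
    Circuit.unitary d (g :: C) = g.matrix d * Circuit.unitary d C := by
  simp [Circuit.unitary]

/-- `l` is a circuit on `n` qubits for `M` with at most `r` gates `R_Z(π/2^d)`. -/
def Implements (n d : ℕ) (l : List RawGate) (M : Operator n) (r : ℕ) : Prop :=
  ∃ C : Circuit n, C.map Gate.raw = l ∧ C.unitary d = M ∧ C.rotCount ≤ r

theorem Implements.append {l m : List RawGate} {M N : Operator n} {r s : ℕ}
    (hl : Implements n d l M r) (hm : Implements n d m N s) :
    Implements n d (l ++ m) (M * N) (r + s) := by
  obtain ⟨C, rfl, rfl, hC⟩ := hl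
  obtain ⟨D, rfl, rfl, hD⟩ := hm
  refine ⟨C ++ D, by simp, unitary_append C D, ?_⟩
  rw [Circuit.rotCount, List.countP_append]
  exact Nat.add_le_add hC hD

theorem implements_nil : Implements n d [] 1 0 := ⟨[], rfl, rfl, le_rfl⟩

theorem implements_gate (g : Gate n) :
    Implements n d [g.raw] (g.matrix d) (if g.isRot then 1 else 0) :=
  ⟨[g], rfl, by simp [Circuit.unitary], by cases g <;> simp [Circuit.rotCount, Gate.isRot]⟩

/-! ### Emitting parities -/

theorem support_cons (b : Bool) (q : Bits) :
    support (b :: q) = (if b then [0] else []) ++ (support q).map Nat.succ := by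
  rw [support, List.length_cons, List.range_succ_eq_map, List.filter_cons, List.filter_map]
  cases b <;> simp [bit_cons_zero, support, Function.comp_def, bit_cons_succ]

/-- The parity of the bits of `x` with indices in a list. -/
def parAt (s : List ℕ) (x : Bits) : Bool := s.foldr (fun i v => Bool.xor (bit x i) v) false

theorem parAt_cons (i : ℕ) (s : List ℕ) (x : Bits) :
    parAt (i :: s) x = Bool.xor (bit x i) (parAt s x) := rfl

theorem par_eq_parAt (q x : Bits) : par q x = parAt (support q) x := by
  induction q generalizing x with
  | nil => simp [par_nil_left, support, parAt]
  | cons b q ih =>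
    have h : ∀ (s : List ℕ) (c : Bool) (x : Bits),
        parAt (s.map Nat.succ) (c :: x) = parAt s x := by
      intro s c x
      induction s with
      | nil => rfl
      | cons i s ih => rw [List.map_cons, parAt_cons, parAt_cons, ih]; rfl
    cases x with
    | nil =>
      have : ∀ s : List ℕ, parAt s [] = false := by
        intro s
        induction s with
        | nil => rfl
        | cons i s ih => rw [parAt_cons, ih, bit_nil]; rfl
      rw [this]
      rfl
    | cons c x =>
      rw [par_cons, ih, support_cons]
      cases b
      · simp [h]
      · simp [h, parAt_cons, bit_cons_zero]

theorem parAt_congr {s : List ℕ} {x y : Bits} (h : ∀ i ∈ s, bit x i = bit y i) :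
    parAt s x = parAt s y := by
  induction s with
  | nil => rfl
  | cons i s ih =>
    rw [parAt_cons, parAt_cons, h i List.mem_cons_self, ih fun j hj =>
      h j (List.mem_cons_of_mem _ hj)]

/-- Conjugation by a CNOT gate with target `a` adds its control to the parity seen on `a`. The
exponent `e` and the cost `r` allow one proof for both rotations. -/
theorem implements_emitAux (g : Fin n → Gate n) (e r : ℕ)
    (hg : ∀ a, (g a).matrix d = phase n d fun x => e * (bit x a).toNat)
    (hr : ∀ a, (if (g a).isRot then 1 else 0) ≤ r) (a : Fin n) (cs : List ℕ)
    (hcs : ∀ c ∈ cs, c < n) (ha : (a : ℕ) ∉ cs) :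
    Implements n d (cs.map (fun c => RawGate.cnot c a) ++
        ((g a).raw :: cs.reverse.map fun c => RawGate.cnot c a))
      (phase n d fun x => e * (parAt (a :: cs) x).toNat) r := by
  induction cs with
  | nil =>
    obtain ⟨C, h₁, h₂, h₃⟩ := implements_gate (d := d) (g a)
    refine ⟨C, h₁, ?_, h₃.trans (hr a)⟩
    rw [h₂, hg]
    simp [parAt]
  | cons c cs ih =>
    have hc : c < n := hcs c List.mem_cons_self
    have hca : (⟨c, hc⟩ : Fin n) ≠ a := fun h => ha (by rw [← h]; exact List.mem_cons_self)
    have ih := ih (fun i hi => hcs i (List.mem_cons_of_mem _ hi))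
      fun h => ha (List.mem_cons_of_mem _ h)
    have hgate := implements_gate (d := d) (Gate.cnot ⟨c, hc⟩ a hca)
    have h := (hgate.append ih).append hgate
    obtain ⟨C, h₁, h₂, h₃⟩ := h
    refine ⟨C, ?_, ?_, by simpa [Gate.isRot] using h₃⟩
    · rw [h₁]
      simp [Gate.raw]
    · rw [h₂]
      change cnotMatrix _ _ * _ * cnotMatrix _ _ = _
      rw [mul_assoc, phase, diagonal_mul_cnotMatrix, ← mul_assoc, cnotMatrix_mul_self hca, one_mul,
        phase]
      congr 1
      funext x
      have h₁ : parAt cs (List.ofFn (cnotMap ⟨c, hc⟩ a x)) = parAt cs (List.ofFn x) := by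
        refine parAt_congr fun i hi => ?_
        have hin := hcs i (List.mem_cons_of_mem _ hi)
        have h₁ := bit_ofFn (cnotMap ⟨c, hc⟩ a x) ⟨i, hin⟩
        have h₂ := bit_ofFn x ⟨i, hin⟩
        have hia : (⟨i, hin⟩ : Fin n) ≠ a := fun h =>
          ha (by rw [← h]; exact List.mem_cons_of_mem _ hi)
        simp only at h₁ h₂
        rw [h₁, h₂]
        simp [cnotMap, hia]
      have h₂ := bit_ofFn x ⟨c, hc⟩
      simp only at h₂
      rw [parAt_cons, parAt_cons, parAt_cons, h₁, bit_ofFn, bit_ofFn, h₂]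
      simp [cnotMap]

theorem support_zeros (m : ℕ) : support (zeros m) = [] := by
  simp [support, bit_zeros]

theorem implements_emit (G : ℕ → RawGate) (g : Fin n → Gate n) (hG : ∀ a : Fin n, G a = (g a).raw)
    (e r : ℕ) (hg : ∀ a, (g a).matrix d = phase n d fun x => e * (bit x a).toNat)
    (hr : ∀ a, (if (g a).isRot then 1 else 0) ≤ r) {q : Bits} (hq : q.length = n) :
    Implements n d (emit G q) (phase n d fun x => e * (par q x).toNat)
      (if q == zeros n then 0 else r) := by
  have hs : ∀ c ∈ support q, c < n := fun c hc => by
    simpa [hq] using (List.mem_filter.1 hc).1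
  have hnd : (support q).Nodup := List.nodup_range.filter _
  simp only [par_eq_parAt]
  cases hsupp : support q with
  | nil =>
    rw [emit, hsupp]
    obtain ⟨C, h₁, h₂, h₃⟩ := implements_nil (n := n) (d := d)
    refine ⟨C, h₁, ?_, h₃.trans (Nat.zero_le _)⟩
    rw [h₂, ← phase_zero (d := d)]
    simp [parAt]
  | cons a cs =>
    rw [hsupp] at hs hnd
    have hne : (q == zeros n) = false := by
      rw [beq_eq_false_iff_ne]
      rintro rfl
      rw [support_zeros] at hsupp
      simp at hsupp
    rw [hne, emit, hsupp]
    have ha : a < n := hs a List.mem_cons_self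
    have h := implements_emitAux g e r hg hr ⟨a, ha⟩ cs
      (fun c hc => hs c (List.mem_cons_of_mem _ hc)) (List.nodup_cons.1 hnd).1
    rw [← hG] at h
    simpa using h

theorem implements_emit_rot {q : Bits} (hq : q.length = n) :
    Implements n d (emit .rot q) (phase n d fun x => (par q x).toNat)
      (if q == zeros n then 0 else 1) := by
  simpa using implements_emit (d := d) .rot Gate.rot (fun _ => rfl) 1 1
    (fun a => (rzMatrix_eq a).trans (by simp)) (fun a => by simp [Gate.isRot]) hq

theorem implements_emit_rotTwo {q : Bits} (hq : q.length = n) :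
    Implements n d (emit .rotTwo q) (phase n d fun x => 2 * (par q x).toNat) 0 := by
  simpa using implements_emit (d := d) .rotTwo Gate.rotTwo (fun _ => rfl) 2 0
    (fun a => rzMatrix_two_eq a) (fun a => by simp [Gate.isRot]) hq

theorem implements_flatMap_rot {E : List Bits} (hE : ∀ q ∈ E, q.length = n) :
    Implements n d (E.flatMap (emit .rot)) (phase n d (wt E))
      (E.countP fun q => !(q == zeros n)) := by
  induction E with
  | nil =>
    have : phase n d (wt []) = 1 := phase_zero
    rw [this]
    exact implements_nil
  | cons q E ih =>
    have h := (implements_emit_rot (d := d) (hE q List.mem_cons_self)).append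
      (ih fun p hp => hE p (List.mem_cons_of_mem _ hp))
    rw [phase_mul] at h
    rw [List.flatMap_cons, List.countP_cons, add_comm]
    convert h using 1
    · congr 1
      funext x
      exact wt_cons q E x
    · cases q == zeros n <;> rfl

theorem implements_flatMap_rotTwo {F : List Bits} (hF : ∀ q ∈ F, q.length = n) :
    Implements n d (F.flatMap (emit .rotTwo)) (phase n d fun x => 2 * wt F x) 0 := by
  induction F with
  | nil =>
    have : phase n d (fun x => 2 * wt [] x) = 1 := phase_zero
    rw [this]
    exact implements_nil
  | cons q F ih =>
    have h := (implements_emit_rotTwo (d := d) (hF q List.mem_cons_self)).append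
      (ih fun p hp => hF p (List.mem_cons_of_mem _ hp))
    rw [phase_mul] at h
    rw [List.flatMap_cons]
    convert h using 2
    funext x
    rw [wt_cons]
    ring

/-! ### Extracting the pending parities -/

theorem wt_flatMap_expand (Q : List Bits) (x : Bits) :
    wt (Q.flatMap (expand (2 ^ (d + 1) - 1) (d + 1))) x ≡ wt Q x [MOD 2 ^ (d + 1)] := by
  induction Q with
  | nil => exact Nat.ModEq.refl _
  | cons q Q ih =>
    rw [List.flatMap_cons, wt_append, wt_cons]
    refine (wt_expand q x ?_).add ih
    rw [Nat.sub_add_cancel Nat.one_le_two_pow]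

theorem cast_two_pow_sub_one (d : ℕ) : ((2 ^ (d + 1) - 1 : ℕ) : ZMod 2) = 1 := by
  rw [Nat.cast_sub Nat.one_le_two_pow]
  have : ((2 : ℕ) : ZMod 2) = 0 := by decide
  rw [Nat.cast_pow, this, zero_pow (Nat.succ_ne_zero d)]
  decide

theorem extract_nil (k : ℕ) (b : Bits) : extract d k b [] = ([], []) := rfl

section

variable {k : ℕ} {b : Bits} {Q : List Bits}

theorem length_of_mem_extract (hQ : ∀ q ∈ Q, q.length = n) (hE : ∀ q ∈ reduce k b Q, q.length = n) :
    ∀ q ∈ (extract d k b Q).1, q.length = n := by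
  intro q hq
  obtain ⟨p, hp, hpq⟩ := List.mem_flatMap.1 (mem_of_mem_cancel hq)
  rw [length_of_mem_expand hpq]
  rcases List.mem_append.1 hp with hp | hp
  · exact hQ p hp
  · exact hE p hp

/-- Modulo `2 ^ (d + 1)`, `wt Q + wt E ≡ wt W.1 + 2 * wt W.2`; the emitted circuit accounts for
everything but `wt W.1`. -/
theorem extract_implements (hQ : ∀ q ∈ Q, q.length = n) (hE : ∀ q ∈ reduce k b Q, q.length = n) :
    ∃ f : Bits → ℕ, Implements n d (extract d k b Q).2 (phase n d f)
        ((reduce k b Q).countP fun q => !(q == zeros n)) ∧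
      phase n d f * phase n d (wt (extract d k b Q).1) = phase n d (wt Q) := by
  set E := reduce k b Q with hEdef
  set W := cancel ((Q ++ E).flatMap fun q => expand (2 ^ (d + 1) - 1) (d + 1) q) with hW
  have hF : ∀ q ∈ W.2, q.length = n := by
    intro q hq
    obtain ⟨p, hp, hpq⟩ := List.mem_flatMap.1 (mem_of_mem_cancel_snd hq)
    rw [length_of_mem_expand hpq]
    rcases List.mem_append.1 hp with hp | hp
    · exact hQ p hp
    · exact hE p hp
  have h₁ := implements_flatMap_rot (d := d) hE
  have h₂ := implements_flatMap_rotTwo (d := d) hF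
  have hE' : ∀ q ∈ E.flatMap fun q => List.replicate (2 ^ d - 1) q, q.length = n := by
    intro q hq
    obtain ⟨p, hp, hpq⟩ := List.mem_flatMap.1 hq
    rw [(List.mem_replicate.1 hpq).2]
    exact hE p hp
  have h₃ := implements_flatMap_rotTwo (d := d) hE'
  have h := h₁.append (h₂.append h₃)
  rw [List.flatMap_assoc, phase_mul, phase_mul, add_zero, add_zero] at h
  refine ⟨_, h, ?_⟩
  rw [phase_mul]
  refine phase_congr fun x => ?_
  have h₄ := wt_cancel ((Q ++ E).flatMap fun q => expand (2 ^ (d + 1) - 1) (d + 1) q) x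
  rw [← hW] at h₄
  have h₅ := wt_flatMap_expand (d := d) (Q ++ E) x
  have h₆ : wt (E.flatMap fun q => List.replicate (2 ^ d - 1) q) x = (2 ^ d - 1) * wt E x := by
    generalize E = E'
    induction E' with
    | nil => rfl
    | cons q E' ih =>
      rw [List.flatMap_cons, wt_append, ih, wt_cons]
      have : wt (List.replicate (2 ^ d - 1) q) x = (2 ^ d - 1) * (par q x).toNat := by
        rw [wt, List.countP_replicate]
        cases par q x <;> simp
      rw [this]
      ring
  have h₇ : wt E x + (2 * wt W.2 x + 2 * ((2 ^ d - 1) * wt E x)) + wt W.1 x + 2 * wt E x =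
      wt E x + (wt W.1 x + 2 * wt W.2 x) + 2 ^ (d + 1) * wt E x := by
    obtain ⟨m, hm⟩ := Nat.exists_eq_add_of_le (Nat.one_le_two_pow (n := d))
    rw [pow_succ, hm]
    simp only [Nat.add_sub_cancel_left]
    ring
  have h₈ : (extract d k b Q).1 = W.1 := rfl
  rw [h₆, h₈]
  -- Adding `2 * wt E x` turns the summand `2 * (2 ^ d - 1) * wt E x`, which stands for `-2 * wt E
  -- x`, into a multiple of the modulus.
  refine Nat.ModEq.add_right_cancel' (2 * wt E x) ?_
  rw [h₇, h₄]
  have h₉ : wt Q x + 2 * wt E x = wt E x + wt (Q ++ E) x := by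
    rw [wt_append]
    ring
  rw [h₉]
  have h₁₀ : 2 ^ (d + 1) * wt E x ≡ 0 [MOD 2 ^ (d + 1)] := by
    simp [Nat.modEq_zero_iff_dvd]
  simpa using (h₅.add_left (wt E x)).add h₁₀

/-- The multiplicities have degree at most `d + 1`, so nothing survives the cancellation. -/
theorem extract_fst_eq_nil (hQ : ∀ q ∈ Q, q.length = n) (hE : ∀ q ∈ reduce (d + 1) b Q, q.length = n)
    (hN : Null (d + 2) (Q ++ reduce (d + 1) b Q)) : (extract d (d + 1) b Q).1 = [] := by
  refine List.eq_nil_iff_forall_not_mem.2 fun Y => notMem_cancel ?_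
  refine count_flatMap_expand (cast_two_pow_sub_one d) (n := n) (fun p hp => ?_) hN Y
  rcases List.mem_append.1 hp with hp | hp
  · exact hQ p hp
  · exact hE p hp

/-- With one degree less, leftovers are possible, but only parities that commute with a Hadamard
gate on `a`. -/
theorem bit_of_mem_extract {a : ℕ} (hQ : ∀ q ∈ Q, q.length = n)
    (hE : ∀ q ∈ reduce d b Q, q.length = n) (hN : Null (d + 1) (Q ++ reduce d b Q))
    (hQa : ∀ q ∈ Q, bit q a = true) (hEa : ∀ q ∈ reduce d b Q, bit q a = true) :
    ∀ Y ∈ (extract d d b Q).1, bit Y a = false := by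
  intro Y hY
  by_contra hYa
  refine notMem_cancel ?_ hY
  refine count_flatMap_expand_of_bit (cast_two_pow_sub_one d) (n := n) (a := a) (fun p hp => ?_)
    (fun p hp => ?_) hN (by simpa using hYa)
  · rcases List.mem_append.1 hp with hp | hp
    · exact hQ p hp
    · exact hE p hp
  · rcases List.mem_append.1 hp with hp | hp
    · exact hQa p hp
    · exact hEa p hp

end

end

/-! ### Encodings of gates -/

def RawGate.enc : RawGate → Datum
  | .cnot c t => .cons (encodeNat 0) (.cons (encodeNat c) (encodeNat t))
  | .had a => .cons (encodeNat 1) (encodeNat a)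
  | .rot a => .cons (encodeNat 2) (encodeNat a)
  | .rotTwo a => .cons (encodeNat 3) (encodeNat a)

instance : Enc RawGate := ⟨RawGate.enc⟩

def RawGate.tag : RawGate → ℕ
  | .cnot _ _ => 0
  | .had _ => 1
  | .rot _ => 2
  | .rotTwo _ => 3

def RawGate.control : RawGate → ℕ
  | .cnot c _ => c
  | _ => 0

def RawGate.target : RawGate → ℕ
  | .cnot _ t => t
  | .had a => a
  | .rot a => a
  | .rotTwo a => a

namespace PolyTime

section

variable {α β : Type} [Enc α] [Enc β] {g : α → RawGate}

theorem tag (hg : PolyTime g) : PolyTime fun x => (g x).tag :=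
  hg.datum.datumHead.of_enc fun x => by cases g x <;> rfl

theorem control (hg : PolyTime g) : PolyTime fun x => (g x).control := by
  refine (ite hg.tag.isZero hg.datum.datumTail.datumHead (const .nil)).of_enc fun x => ?_
  cases g x <;> rfl

theorem target (hg : PolyTime g) : PolyTime fun x => (g x).target := by
  refine (ite hg.tag.isZero hg.datum.datumTail.datumTail hg.datum.datumTail).of_enc fun x => ?_
  cases g x <;> rfl

theorem cnotGate {c t : α → ℕ} (hc : PolyTime c) (ht : PolyTime t) :
    PolyTime fun x => RawGate.cnot (c x) (t x) :=
  ((const 0).pair (hc.pair ht)).of_enc fun _ => rfl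

theorem hadGate {a : α → ℕ} (ha : PolyTime a) : PolyTime fun x => RawGate.had (a x) :=
  ((const 1).pair ha).of_enc fun _ => rfl

theorem rotGate {a : α → ℕ} (ha : PolyTime a) : PolyTime fun x => RawGate.rot (a x) :=
  ((const 2).pair ha).of_enc fun _ => rfl

theorem rotTwoGate {a : α → ℕ} (ha : PolyTime a) : PolyTime fun x => RawGate.rotTwo (a x) :=
  ((const 3).pair ha).of_enc fun _ => rfl

theorem gateCases {F : α → RawGate → β} (hg : PolyTime g)
    (hc : PolyTime fun p : α × ℕ × ℕ => F p.1 (.cnot p.2.1 p.2.2))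
    (hh : PolyTime fun p : α × ℕ => F p.1 (.had p.2))
    (hr : PolyTime fun p : α × ℕ => F p.1 (.rot p.2))
    (h2 : PolyTime fun p : α × ℕ => F p.1 (.rotTwo p.2)) : PolyTime fun x => F x (g x) := by
  have ht := PolyTime.id.pair hg.target
  refine (ite hg.tag.isZero (hc.comp (PolyTime.id.pair (hg.control.pair hg.target)))
    (ite (natEq hg.tag (const 1)) (hh.comp ht)
      (ite (natEq hg.tag (const 2)) (hr.comp ht) (h2.comp ht)))).of_enc fun x => ?_
  cases g x <;> rfl

end

/-! ### The functions of the algorithm -/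

section

variable {α : Type} [Enc α]

theorem xorv {p q : α → Bits} (hp : PolyTime p) (hq : PolyTime q) :
    PolyTime fun x => xorv (p x) (q x) :=
  zipWith (g := fun _ a b => Bool.xor a b) false hp hq (xor id.snd.fst id.snd.snd)

theorem zeros {n : α → ℕ} (hn : PolyTime n) : PolyTime fun x => zeros (n x) :=
  replicate hn (const false)

theorem unitv {n a : α → ℕ} (hn : PolyTime n) (ha : PolyTime a) :
    PolyTime fun x => unitv (n x) (a x) :=
  map (g := fun x i => i == a x) hn.range (natEq id.snd (ha.comp id.fst))

theorem bit {q : α → Bits} {i : α → ℕ} (hq : PolyTime q) (hi : PolyTime i) :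
    PolyTime fun x => bit (q x) (i x) :=
  getD hq hi (const false)

theorem features (k : ℕ) : PolyTime (features k) := by
  induction k with
  | zero => exact const []
  | succ k ih =>
    exact cons (const true) (flatMap (g := fun q b => (RzCount.features k q).map fun c => b && c)
      PolyTime.id (map (g := fun (p : Bits × Bool) c => p.2 && c) (ih.comp PolyTime.id.fst)
        (PolyTime.id.fst.snd.and PolyTime.id.snd)))

end

end PolyTime

/-! ### Size bounds for intermediate values. -/

/-- One more variable adds one parity, and `2M + 1` parities for each member of the expansion of
next lower order. For fixed `M` and `k` the growth is polynomial of degree `k`. -/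
theorem length_expand_le (M k : ℕ) (q : Bits) :
    (expand M k q).length ≤ ((2 * M + 2) * (q.length + 1)) ^ k := by
  induction q generalizing k with
  | nil => simp [expand_nil]
  | cons b q ih =>
    cases k with
    | zero => simp [expand_zero]
    | succ k =>
      have h₁ : (expand M (k + 1) (b :: q)).length ≤ (expand M (k + 1) q).length +
          (1 + (2 * M + 1) * (expand M k q).length) := by
        rw [expand, List.length_append, List.length_map]
        cases b with
        | false => simp
        | true =>
          simp [List.length_flatMap]
          ring_nf
          omega
      have h₂ := ih (k + 1)
      have h₃ := ih k
      rw [List.length_cons]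
      set a := (2 * M + 2) * (q.length + 1) with ha
      have h₄ : (2 * M + 2) * (q.length + 1 + 1) = a + (2 * M + 2) := by rw [ha]; ring
      have h₅ : 1 ≤ a ^ k := Nat.one_le_pow _ _ (by rw [ha]; positivity)
      have h₆ : a ^ k ≤ (a + (2 * M + 2)) ^ k := Nat.pow_le_pow_left (by omega) k
      rw [h₄]
      calc (expand M (k + 1) (b :: q)).length
          ≤ a ^ (k + 1) + (1 + (2 * M + 1) * a ^ k) := by
            refine h₁.trans (Nat.add_le_add h₂ ?_)
            gcongr
        _ ≤ a ^ k * a + (2 * M + 2) * a ^ k := by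
            rw [pow_succ]
            nlinarith
        _ ≤ (a + (2 * M + 2)) ^ k * a + (2 * M + 2) * (a + (2 * M + 2)) ^ k := by gcongr
        _ = (a + (2 * M + 2)) ^ (k + 1) := by ring

/-- The size of a list of bit vectors, in terms of the lengths. -/
theorem sz_le_of_lengths {Q : List Bits} {A L : ℕ} (hA : Q.length ≤ A)
    (hL : ∀ q ∈ Q, q.length ≤ L) : sz Q ≤ A * (L * 4 + 2) + 1 := by
  refine (sz_list_le (M := L * 4 + 1) fun q hq => (sz_bits_le q).trans ?_).trans ?_
  · have := hL q hq
    omega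
  · gcongr

theorem PolyBound.pow {α : Type} [Enc α] {f : α → ℕ} (hf : PolyBound f) (k : ℕ) :
    PolyBound fun x => f x ^ k := by
  induction k with
  | zero => exact (PolyBound.const 1).mono fun x => by simp
  | succ k ih => exact (ih.mul hf).mono fun x => by rw [pow_succ]

theorem polyBound_length {α : Type} [Enc α] : PolyBound fun l : List α => l.length :=
  PolyBound.size.mono length_le_sz

theorem sz_perm {α : Type} [Enc α] {l m : List α} (h : l.Perm m) : sz l = sz m := by
  induction h with
  | nil => rfl
  | cons a _ ih => rw [sz_cons, sz_cons, ih]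
  | swap a b l => simp only [sz_cons]; omega
  | trans _ _ ih₁ ih₂ => exact ih₁.trans ih₂

theorem length_trackedRows_eq (k : ℕ) (Q : List Bits) : (trackedRows k Q).length = Q.length := by
  induction Q with
  | nil => rfl
  | cons p Q ih => simp [trackedRows, ih]

theorem mem_trackedRows {k : ℕ} {Q : List Bits} {r : Bits × Bits} (h : r ∈ trackedRows k Q) :
    (∃ p ∈ Q, r.1 = features k p) ∧ r.2.length = Q.length := by
  induction Q generalizing r with
  | nil => simp [trackedRows] at h
  | cons p Q ih =>
    rcases List.mem_cons.1 h with rfl | h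
    · exact ⟨⟨p, List.mem_cons_self, rfl⟩, by simp [length_zeros]⟩
    · obtain ⟨s, hs, rfl⟩ := List.mem_map.1 h
      obtain ⟨⟨p', hp', h₁⟩, h₂⟩ := ih hs
      exact ⟨⟨p', List.mem_cons_of_mem _ hp', h₁⟩, by simp [h₂]⟩

theorem length_xorv_le (p q : Bits) : (xorv p q).length ≤ p.length := by
  simp [xorv]

theorem iterate_clearColumn_small {R : List (Bits × Bits)} {A B : ℕ}
    (h : ∀ r ∈ R, r.1.length ≤ A ∧ r.2.length ≤ B) (m : ℕ) :
    (clearColumn^[m] R).length = R.length ∧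
      ∀ r ∈ clearColumn^[m] R, r.1.length ≤ A ∧ r.2.length ≤ B := by
  induction m with
  | zero => exact ⟨rfl, h⟩
  | succ m ih =>
    rw [Function.iterate_succ_apply']
    refine ⟨by simpa [clearColumn] using ih.1, fun r hr => ?_⟩
    obtain ⟨s, hs, rfl⟩ := List.mem_map.1 hr
    obtain ⟨h₁, h₂⟩ := ih.2 s hs
    split_ifs
    · refine ⟨?_, (length_xorv_le _ _).trans h₂⟩
      rw [List.length_tail]
      exact ((Nat.sub_le _ _).trans (length_xorv_le _ _)).trans h₁
    · refine ⟨?_, h₂⟩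
      rw [List.length_tail]
      exact (Nat.sub_le _ _).trans h₁

/-- Since `xorv` truncates, vectors never get longer, whatever the lengths of `b` and the members of
`Q`; the running time must be bounded on malformed arguments too. -/
theorem iterate_reduceOnce_small {k A L : ℕ} {b : Bits} {Q : List Bits} (hA : Q.length ≤ A)
    (hL : ∀ q ∈ Q, q.length ≤ L) (m : ℕ) :
    ((reduceOnce k b)^[m] Q).length ≤ A ∧ ∀ q ∈ (reduceOnce k b)^[m] Q, q.length ≤ L := by
  induction m with
  | zero => exact ⟨hA, hL⟩
  | succ m ih =>
    rw [Function.iterate_succ_apply']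
    generalize (reduceOnce k b)^[m] Q = R at ih
    simp only [reduceOnce]
    split_ifs
    · exact ih
    · refine ⟨?_, fun q hq => ?_⟩
      · refine (List.length_filter_le _ _).trans (le_trans ?_ ih.1)
        simp [shiftSelected]
      · obtain ⟨i, hi, rfl⟩ := List.getElem_of_mem (List.mem_filter.1 hq).1
        have hiR : i < R.length := by
          simp only [shiftSelected, List.length_zipWith] at hi
          omega
        have h₁ := ih.2 _ (List.getElem_mem hiR)
        simp only [shiftSelected, List.getElem_zipWith]
        split_ifs
        · exact (length_xorv_le _ _).trans h₁
        · exact h₁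

namespace PolyTime

theorem expand (M k : ℕ) : PolyTime (expand M k) := by
  induction k with
  | zero => exact (const []).of_enc fun q => by rw [expand_zero]
  | succ k ih =>
    have hz : PolyTime fun p : Bits × Bool × Bits × List Bits => p.2.2.1 := id.snd.snd.fst
    refine listRec (f := fun (_ : Bits) q => RzCount.expand M (k + 1) q)
      (step := fun _ b q acc => acc.map (fun Y => false :: Y) ++
        if b then (true :: RzCount.zeros q.length) :: (RzCount.expand M k q).flatMap fun Y =>
          (true :: Y) ::
            (List.replicate M [true :: RzCount.zeros q.length, false :: Y]).flatten
        else []) (l := fun q => q) id (const []) ?_ ?_ fun _ _ _ => rfl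
    · refine append (map (g := fun _ Y => false :: Y) id.snd.snd.snd ((const false).cons id.snd))
        (ite id.snd.fst (cons ((const true).cons hz.length.zeros)
          (flatMap (g := fun (p : Bits × Bool × Bits × List Bits) Y => (true :: Y) ::
            (List.replicate M [true :: RzCount.zeros p.2.2.1.length, false :: Y]).flatten)
            (ih.comp hz) ?_)) (const []))
      exact cons ((const true).cons id.snd) (flatten (replicate (const M)
        (cons ((const true).cons (hz.comp id.fst).length.zeros)
          (cons ((const false).cons id.snd) (const [])))))
    · have hL : PolyBound fun p : Bits × Bits => p.2.length :=
        polyBound_length.comp (k := fun p : Bits × Bits => p.2) id.snd.sz_bound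
      have hA : PolyBound fun p : Bits × Bits => ((2 * M + 2) * (p.2.length + 1)) ^ (k + 1) :=
        ((PolyBound.const _).mul (hL.add (.const 1))).pow _
      refine ((hA.mul ((hL.mul (.const 4)).add (.const 2))).add (.const 1)).mono fun p => ?_
      exact sz_le_of_lengths (length_expand_le M (k + 1) p.2)
        fun q hq => (length_of_mem_expand hq).le

theorem cancel : PolyTime cancel := by
  have h₁ : PolyTime fun p : List Bits × (List Bits × List Bits) × Bits => p.2.1.1 := id.snd.fst.fst
  have h₂ : PolyTime fun p : List Bits × (List Bits × List Bits) × Bits => p.2.1.2 := id.snd.fst.snd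
  have h₃ : PolyTime fun p : List Bits × (List Bits × List Bits) × Bits => p.2.2 := id.snd.snd
  refine foldl (step := fun (_ : List Bits) W Y => toggle W Y) (l := fun Q => Q)
    (init := fun _ => ([], [])) (B := fun Q => 2 * sz Q + 1) id (const _)
    (ite (contains h₁ h₃) ((h₁.erase h₃).pair (h₃.cons h₂)) ((h₃.cons h₁).pair h₂))
    (((PolyBound.const 2).mul .size).add (.const 1)) fun Q l' hl' => ?_
  -- The two lists, with the second counted twice, are a rearrangement of the part read, so the
  -- state cannot outgrow the input.
  have h₄ := sz_perm (foldl_toggle_perm l' ([], []))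
  have h₅ := sz_le_of_prefix hl'
  simp only [List.append_nil] at h₄
  generalize List.foldl toggle ([], []) l' = W at h₄
  have h₆ := sz_append W.1 (W.2 ++ W.2)
  have h₇ := sz_append W.2 W.2
  have h₈ : sz W = sz W.1 + sz W.2 + 1 := sz_prod _ _
  have h₉ := sz_pos W.1
  have h₁₀ := sz_pos W.2
  change sz W ≤ _
  omega

theorem trackedRows (k : ℕ) : PolyTime (trackedRows k) := by
  obtain ⟨P, hP⟩ := (features k).sz_bound
  refine listRec (f := fun (_ : List Bits) Q => RzCount.trackedRows k Q)
    (step := fun _ p Q acc => (RzCount.features k p, true :: RzCount.zeros Q.length) ::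
      acc.map fun r => (r.1, false :: r.2)) (l := fun Q => Q) id (const [])
    (cons (((features k).comp id.snd.fst).pair ((const true).cons id.snd.snd.fst.length.zeros))
      (map (g := fun _ (r : Bits × Bits) => (r.1, false :: r.2)) id.snd.snd.snd
        (id.snd.fst.pair ((const false).cons id.snd.snd)))) ?_ fun _ _ _ => rfl
  have hB : PolyBound fun p : List Bits × List Bits =>
      sz p * (P.eval (sz p) + (sz p * 4 + 1) + 1 + 1) + 1 :=
    (PolyBound.size.mul ((((PolyBound.size.eval P).add ((PolyBound.size.mul (.const 4)).add
      (.const 1))).add (.const 1)).add (.const 1))).add (.const 1)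
  refine hB.mono fun p => ?_
  have h₁ : p.2.length ≤ sz p := (length_le_sz _).trans (sz_snd_le _)
  refine (sz_list_le (M := P.eval (sz p) + (sz p * 4 + 1) + 1) fun r hr => ?_).trans ?_
  · obtain ⟨⟨q, hq, h₂⟩, h₃⟩ := mem_trackedRows hr
    have h₄ : sz r.1 ≤ P.eval (sz p) := by
      rw [h₂]
      exact (hP q).trans (eval_monotone P ((sz_le_of_mem hq).trans (sz_snd_le p)))
    have h₅ := sz_bits_le r.2
    have h₆ : sz r = sz r.1 + sz r.2 + 1 := sz_prod _ _
    omega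
  · rw [length_trackedRows_eq]
    gcongr

theorem clearColumn : PolyTime clearColumn := by
  have hp : PolyTime fun R : List (Bits × Bits) =>
      (R.filter fun r => r.1.headD false).headD ([], []) :=
    headD (filter (g := fun _ (r : Bits × Bits) => r.1.headD false) id
      (id.snd.fst.headD (const false))) (const _)
  have hp' : PolyTime fun p : List (Bits × Bits) × (Bits × Bits) =>
      (p.1.filter fun r => r.1.headD false).headD ([], []) := hp.comp id.fst
  exact map (g := fun (R : List (Bits × Bits)) r => if r.1.headD false then
    ((RzCount.xorv r.1 ((R.filter fun r => r.1.headD false).headD ([], [])).1).tail,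
      RzCount.xorv r.2 ((R.filter fun r => r.1.headD false).headD ([], [])).2)
    else (r.1.tail, r.2)) id
    (ite (id.snd.fst.headD (const false))
      ((id.snd.fst.xorv hp'.fst).listTail.pair (id.snd.snd.xorv hp'.snd))
      (id.snd.fst.listTail.pair id.snd.snd))

theorem dependency (k : ℕ) : PolyTime (dependency k) := by
  have hR : PolyTime fun Q => (RzCount.features k (Q.headD [])).foldl
      (fun R _ => RzCount.clearColumn R) (RzCount.trackedRows k Q) := by
    have hs := (trackedRows k).sz_bound
    refine foldl (step := fun (_ : List Bits) R (_ : Bool) => RzCount.clearColumn R)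
      (init := RzCount.trackedRows k)
      (B := fun Q => sz (RzCount.trackedRows k Q) *
        ((sz (RzCount.trackedRows k Q) * 4 + 1) + (sz (RzCount.trackedRows k Q) * 4 + 1) + 1 + 1)
        + 1)
      ((features k).comp (id.headD (const []))) (trackedRows k) (clearColumn.comp id.snd.fst)
      ((hs.mul (((((hs.mul (.const 4)).add (.const 1)).add
        ((hs.mul (.const 4)).add (.const 1))).add (.const 1)).add (.const 1))).add (.const 1))
      fun Q l' _ => ?_
    rw [foldl_const]
    set T := RzCount.trackedRows k Q
    have hsmall : ∀ r ∈ T, r.1.length ≤ sz T ∧ r.2.length ≤ sz T := fun r hr =>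
      ⟨(length_le_sz _).trans ((sz_fst_le r).trans (sz_le_of_mem hr)),
        (length_le_sz _).trans ((sz_snd_le r).trans (sz_le_of_mem hr))⟩
    obtain ⟨h₁, h₂⟩ := iterate_clearColumn_small hsmall l'.length
    refine (sz_list_le (M := (sz T * 4 + 1) + (sz T * 4 + 1) + 1) fun r hr => ?_).trans ?_
    · have h₃ := sz_bits_le r.1
      have h₄ := sz_bits_le r.2
      obtain ⟨h₅, h₆⟩ := h₂ r hr
      have h₇ : sz r = sz r.1 + sz r.2 + 1 := sz_prod _ _
      omega
    · rw [h₁]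
      have := length_le_sz T
      gcongr
  exact headD (filter (g := fun _ (y : Bits) => y.any fun b => b)
    (map (g := fun _ (r : Bits × Bits) => r.2) hR id.snd.snd)
    (any (g := fun _ (b : Bool) => b) id.snd id.snd)) (const [])

section

variable {α : Type} [Enc α] {Q : α → List Bits} {b : α → Bits}

theorem select {y : α → Bits} (hy : PolyTime y) (hQ : PolyTime Q) :
    PolyTime fun x => select (y x) (Q x) :=
  map (g := fun _ (r : Bool × Bits) => r.2) (filter (g := fun _ (r : Bool × Bits) => r.1)
    (zipWith (g := fun _ c p => (c, p)) ([] : Bits) hy hQ (id.snd.fst.pair id.snd.snd))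
    id.snd.fst) id.snd.snd

theorem shiftSelected {y z : α → Bits} (hz : PolyTime z) (hy : PolyTime y) (hQ : PolyTime Q) :
    PolyTime fun x => shiftSelected (z x) (y x) (Q x) :=
  zipWith (g := fun x (c : Bool) (p : Bits) => if c then RzCount.xorv p (z x) else p) ([] : Bits) hy hQ
    (ite id.snd.fst (id.snd.snd.xorv (hz.comp id.fst)) id.snd.snd)

theorem reduceOnce (k : ℕ) (hb : PolyTime b) (hQ : PolyTime Q) :
    PolyTime fun x => reduceOnce k (b x) (Q x) := by
  have hy := (dependency k).comp hQ
  have hs := hy.select hQ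
  exact ite hs.isEmpty hQ (filter (g := fun x p => !(p == b x))
    ((hb.xorv (hs.headD (const []))).shiftSelected hy hQ) (bitsEq id.snd (hb.comp id.fst)).not)

theorem iterReduce (k : ℕ) (hb : PolyTime b) (hQ : PolyTime Q) :
    PolyTime fun x => iterReduce k (b x) (Q x) := by
  have hs := hQ.sz_bound
  refine foldl (step := fun x R (_ : Bits) => RzCount.reduceOnce k (b x) R)
    (B := fun x => sz (Q x) * (sz (Q x) * 4 + 2) + 1) hQ hQ
    (reduceOnce k (hb.comp id.fst) id.snd.fst)
    ((hs.mul ((hs.mul (.const 4)).add (.const 2))).add (.const 1)) fun x l' _ => ?_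
  rw [foldl_const]
  obtain ⟨h₁, h₂⟩ := iterate_reduceOnce_small (k := k) (b := b x) (length_le_sz (Q x))
    (fun q hq => (length_le_sz q).trans (sz_le_of_mem hq)) l'.length
  exact sz_le_of_lengths h₁ h₂

theorem oddLength (hQ : PolyTime Q) : PolyTime fun x => oddLength (Q x) :=
  foldl (step := fun _ s (_ : Bits) => !s) (B := fun _ => 3) hQ (const false)
    id.snd.fst.not (.const 3) fun _ _ _ => sz_bool_le _

theorem reduce (k : ℕ) (hb : PolyTime b) (hQ : PolyTime Q) :
    PolyTime fun x => reduce k (b x) (Q x) :=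
  append (iterReduce k hb hQ) (ite (append hQ (iterReduce k hb hQ)).oddLength
    (hb.cons (const [])) (const []))

theorem support {q : α → Bits} (hq : PolyTime q) : PolyTime fun x => support (q x) :=
  filter (g := fun x i => RzCount.bit (q x) i) hq.length.range (bit (hq.comp id.fst) id.snd)

theorem emit {q : α → Bits} {g : ℕ → RawGate} (hg : PolyTime g) (hq : PolyTime q) :
    PolyTime fun x => emit g (q x) := by
  have hs := hq.support
  have hh := hs.headD (const 0)
  exact ite hs.isEmpty (const []) (append
    (map (g := fun x c => RawGate.cnot c ((RzCount.support (q x)).headD 0)) hs.listTail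
      (cnotGate id.snd (hh.comp id.fst)))
    (cons (hg.comp hh) (map (g := fun x c => RawGate.cnot c ((RzCount.support (q x)).headD 0))
      hs.listTail.reverse (cnotGate id.snd (hh.comp id.fst)))))

theorem extract (d k : ℕ) (hb : PolyTime b) (hQ : PolyTime Q) :
    PolyTime fun x => extract d k (b x) (Q x) := by
  have hE := reduce k hb hQ
  have hW := cancel.comp (flatMap (g := fun _ q => RzCount.expand (2 ^ (d + 1) - 1) (d + 1) q)
    (append hQ hE) ((expand _ _).comp id.snd))
  have h₂ : PolyTime fun p : α × Bits => RzCount.emit .rotTwo p.2 :=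
    emit (rotTwoGate id) id.snd
  exact hW.fst.pair (append
    (flatMap (g := fun _ q => RzCount.emit .rot q) hE (emit (rotGate id) id.snd))
    (append (flatMap (g := fun _ q => RzCount.emit .rotTwo q) hW.snd h₂)
      (flatMap (g := fun _ q => (List.replicate (2 ^ d - 1) q).flatMap (RzCount.emit .rotTwo)) hE
        (flatMap (g := fun _ q => RzCount.emit .rotTwo q) (replicate (const _) id.snd)
          (emit (rotTwoGate id) id.snd)))))

theorem pullback {q : α → Bits} {c t : α → ℕ} (hc : PolyTime c) (ht : PolyTime t)
    (hq : PolyTime q) : PolyTime fun x => pullback (c x) (t x) (q x) :=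
  ite (bit hq ht) (xorv hq (unitv hq.length hc)) hq

theorem filterBit {a : α → ℕ} (hQ : PolyTime Q) (ha : PolyTime a) :
    PolyTime fun x => (Q x).filter fun q => RzCount.bit q (a x) :=
  filter (g := fun x q => RzCount.bit q (a x)) hQ (bit id.snd (ha.comp id.fst))

theorem filterNotBit {a : α → ℕ} (hQ : PolyTime Q) (ha : PolyTime a) :
    PolyTime fun x => (Q x).filter fun q => !RzCount.bit q (a x) :=
  filter (g := fun x q => !RzCount.bit q (a x)) hQ (bit id.snd (ha.comp id.fst)).not

theorem stepPending (d : ℕ) {n : α → ℕ} {g : α → RawGate} (hn : PolyTime n) (hQ : PolyTime Q)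
    (hg : PolyTime g) : PolyTime fun x => stepPending d (n x) (Q x) (g x) := by
  refine gateCases (F := fun x g => RzCount.stepPending d (n x) (Q x) g) hg ?_ ?_ ?_ ?_
  · exact map (g := fun (p : α × ℕ × ℕ) q => RzCount.pullback p.2.1 p.2.2 q) (hQ.comp id.fst)
      (pullback id.fst.snd.fst id.fst.snd.snd id.snd)
  · have h := filterBit (hQ.comp (id (α := α × ℕ)).fst) id.snd
    exact append (filterNotBit (hQ.comp id.fst) id.snd)
      (extract d d (h.headD (const [])) h).fst
  · exact cons (unitv (hn.comp id.fst) id.snd) (hQ.comp id.fst)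
  · exact hQ.comp id.fst

theorem stepOut (d : ℕ) {g : α → RawGate} (hQ : PolyTime Q) (hg : PolyTime g) :
    PolyTime fun x => stepOut d (Q x) (g x) := by
  refine gateCases (F := fun x g => RzCount.stepOut d (Q x) g) hg ?_ ?_ (const [])
    (cons (rotTwoGate id.snd) (const []))
  · exact cons (cnotGate id.snd.fst id.snd.snd) (const [])
  · have h := filterBit (hQ.comp (id (α := α × ℕ)).fst) id.snd
    exact append (extract d d (h.headD (const [])) h).snd (cons (hadGate id.snd) (const []))

end

theorem splitLastRot : PolyTime splitLastRot := by
  have h₁ : PolyTime fun p : List RawGate × RawGate × List RawGate ×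
      (List RawGate × List RawGate) => p.2.1 := id.snd.fst
  have h₂ : PolyTime fun p : List RawGate × RawGate × List RawGate ×
      (List RawGate × List RawGate) => p.2.2.2 := id.snd.snd.snd
  have hr : PolyTime RawGate.isRot := by
    refine (natEq id.tag (const 2)).of_enc fun g => ?_
    cases g <;> rfl
  refine listRec (f := fun (_ : List RawGate) C => RzCount.splitLastRot C)
    (step := fun _ g _ s => if s.1.isEmpty && !g.isRot then ([], g :: s.2) else (g :: s.1, s.2))
    (l := fun C => C) id (const _)
    (ite (h₂.fst.isEmpty.and (hr.comp h₁).not) ((const []).pair (h₁.cons h₂.snd))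
      ((h₁.cons h₂.fst).pair h₂.snd)) ?_ fun _ _ _ => rfl
  refine (PolyBound.size.add (.const 2)).mono fun p => ?_
  have h : ∀ C : List RawGate, sz (RzCount.splitLastRot C) = sz C + 2 := by
    intro C
    induction C with
    | nil => rfl
    | cons g C ih =>
      have h₃ : sz (RzCount.splitLastRot C) = sz (RzCount.splitLastRot C).1 +
        sz (RzCount.splitLastRot C).2 + 1 := sz_prod _ _
      rw [sz_cons, RzCount.splitLastRot]
      split_ifs with hs
      · have h₄ : (RzCount.splitLastRot C).1 = [] := by simp_all
        rw [h₄, sz_nil] at h₃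
        rw [sz_prod, sz_cons, sz_nil]
        omega
      · rw [sz_prod, sz_cons]
        omega
  rw [h]
  have := sz_snd_le p
  omega

end PolyTime

/-! ### The number of pending parities -/

/-- The all-ones vector provides a pool for the expansions of all parities of the same length. -/
theorem expand_subset (M k : ℕ) (q : Bits) :
    expand M k q ⊆ expand M k (List.replicate q.length true) := by
  induction q generalizing k with
  | nil => simp
  | cons b q ih =>
    cases k with
    | zero => simp [expand_zero]
    | succ k =>
      intro Y hY
      have hlen : (List.replicate q.length true).length = q.length := List.length_replicate
      rw [List.length_cons, List.replicate_succ, expand, hlen, if_pos rfl]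
      rw [expand] at hY
      rcases List.mem_append.1 hY with hY | hY
      · obtain ⟨Z, hZ, rfl⟩ := List.mem_map.1 hY
        exact List.mem_append_left _ (List.mem_map.2 ⟨Z, ih _ hZ, rfl⟩)
      · cases b with
        | false => simp at hY
        | true =>
          rw [if_pos rfl] at hY
          refine List.mem_append_right _ ?_
          rcases List.mem_cons.1 hY with rfl | hY
          · exact List.mem_cons_self
          · obtain ⟨Z, hZ, h⟩ := List.mem_flatMap.1 hY
            exact List.mem_cons_of_mem _ (List.mem_flatMap.2 ⟨Z, ih _ hZ, h⟩)

/-- A bound for the number of parities that are added by one gate. -/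
def growth (d n : ℕ) : ℕ := ((2 * (2 ^ (d + 1) - 1) + 2) * (n + 1)) ^ (d + 1)

/-- Leftovers are distinct and lie in the common pool, so their number does not depend on `Q`.
Without cancellation, the pending list could be multiplied at every Hadamard gate and grow
exponentially. -/
theorem length_extract_le {d k n : ℕ} {b : Bits} {Q : List Bits} (hQ : ∀ q ∈ Q, q.length = n)
    (hE : ∀ q ∈ reduce k b Q, q.length = n) : (extract d k b Q).1.length ≤ growth d n := by
  have hsub : (extract d k b Q).1 ⊆ expand (2 ^ (d + 1) - 1) (d + 1) (List.replicate n true) := by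
    intro Y hY
    obtain ⟨p, hp, hpY⟩ := List.mem_flatMap.1 (mem_of_mem_cancel hY)
    have hpn : p.length = n := by
      rcases List.mem_append.1 hp with hp | hp
      · exact hQ p hp
      · exact hE p hp
    have := expand_subset _ _ _ hpY
    rwa [hpn] at this
  refine ((cancel_nodup _).subperm hsub).length_le.trans ?_
  have := length_expand_le (2 ^ (d + 1) - 1) (d + 1) (List.replicate n true)
  rwa [List.length_replicate] at this

/-- For empty `Q` the default base has the wrong length, but then nothing is produced. -/
theorem length_of_mem_reduce {k n : ℕ} {Q : List Bits} (hQ : ∀ q ∈ Q, q.length = n) :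
    ∀ q ∈ reduce k (Q.headD []) Q, q.length = n := by
  cases Q with
  | nil =>
    intro q hq
    exact absurd hq (by simp [reduce, iterReduce, oddLength])
  | cons p Q =>
    exact (reduce_spec (k := k) hQ (hQ p List.mem_cons_self) (Finset.range n)
      fun i hi hi' => absurd (Finset.mem_range.2 hi) hi').1

/-- The growth is additive. Gates are arbitrary here, with qubits possibly out of range, because the
running time is estimated for all lists of raw gates. -/
theorem stepPending_spec {d n : ℕ} {Q : List Bits} (hQ : ∀ q ∈ Q, q.length = n) (g : RawGate) :
    (∀ q ∈ stepPending d n Q g, q.length = n) ∧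
      (stepPending d n Q g).length ≤ Q.length + (growth d n + 1) := by
  cases g with
  | cnot c t =>
    refine ⟨fun q hq => ?_, by simp [stepPending]⟩
    obtain ⟨p, hp, rfl⟩ := List.mem_map.1 hq
    rw [length_pullback, hQ p hp]
  | had a =>
    have hQ₁ : ∀ q ∈ Q.filter fun q => bit q a, q.length = n :=
      fun q hq => hQ q (List.mem_filter.1 hq).1
    have hE := length_of_mem_reduce (k := d) hQ₁
    refine ⟨fun q hq => ?_, ?_⟩
    · rcases List.mem_append.1 hq with hq | hq
      · exact hQ q (List.mem_filter.1 hq).1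
      · exact length_of_mem_extract hQ₁ hE q hq
    · rw [stepPending, List.length_append]
      have h₁ := length_extract_le (d := d) hQ₁ hE
      have h₂ := List.length_filter_le (fun q => !bit q a) Q
      omega
  | rot a =>
    refine ⟨fun q hq => ?_, by simp [stepPending]⟩
    rcases List.mem_cons.1 hq with rfl | hq
    · exact length_unitv n a
    · exact hQ q hq
  | rotTwo a => exact ⟨hQ, by simp [stepPending]⟩

namespace PolyTime

theorem runSteps (d : ℕ) {α : Type} [Enc α] {n : α → ℕ} {C : α → List RawGate} (hn : PolyTime n)
    (hC : PolyTime C) : PolyTime fun x => runSteps d (n x) (C x) := by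
  have hout : PolyTime fun p : List Bits × RawGate => RzCount.stepOut d p.1 p.2 :=
    stepOut d id.fst id.snd
  obtain ⟨P, hP⟩ := hout.sz_bound
  have hn' : PolyBound n := hn.sz_bound.mono fun x => by rw [sz_nat]; omega
  have hl' : PolyBound fun x => (C x).length := hC.sz_bound.mono fun x => length_le_sz _
  let S : α → ℕ := fun x => (C x).length * (growth d (n x) + 1) * (n x * 4 + 2) + 1
  let T : α → ℕ := fun x => P.eval (S x + sz (C x) + 1)
  have hS : PolyBound S := ((hl'.mul ((((PolyBound.const _).mul
    (hn'.add (.const 1))).pow _).add (.const 1))).mul ((hn'.mul (.const 4)).add (.const 2))).add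
      (.const 1)
  have hT : PolyBound T := ((hS.add hC.sz_bound).add (.const 1)).eval P
  refine foldl (step := fun x (s : List Bits × List RawGate) g =>
      (RzCount.stepPending d (n x) s.1 g, s.2 ++ RzCount.stepOut d s.1 g))
    (init := fun _ => ([], [])) (B := fun x => S x + ((C x).length * T x + 1) + 1) hC (const _)
    ((stepPending d (hn.comp id.fst) id.snd.fst.fst id.snd.snd).pair
      (append id.snd.fst.snd (stepOut d id.snd.fst.fst id.snd.snd)))
    ((hS.add ((hl'.mul hT).add (.const 1))).add (.const 1)) fun x l' hl => ?_
  -- Both components of the state grow by a bounded amount per gate: the pending list by `growth d n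
  -- + 1` parities, the output by the size `T x` of one step.
  have key : ∀ l', l' <+: C x →
      (∀ q ∈ (RzCount.runSteps d (n x) l').1, q.length = n x) ∧
      (RzCount.runSteps d (n x) l').1.length ≤ l'.length * (growth d (n x) + 1) ∧
      sz (RzCount.runSteps d (n x) l').2 ≤ l'.length * T x + 1 := by
    intro l'
    induction l' using List.reverseRecOn with
    | nil => exact fun _ => ⟨by simp [RzCount.runSteps], by simp [RzCount.runSteps], by
        simp [RzCount.runSteps, sz_nil]⟩
    | append_singleton l g ih =>
      intro hl
      obtain ⟨h₁, h₂, h₃⟩ := ih ((List.prefix_append _ _).trans hl)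
      have hrun : RzCount.runSteps d (n x) (l ++ [g]) =
          (RzCount.stepPending d (n x) (RzCount.runSteps d (n x) l).1 g,
            (RzCount.runSteps d (n x) l).2 ++
              RzCount.stepOut d (RzCount.runSteps d (n x) l).1 g) := by
        simp [RzCount.runSteps]
      rw [hrun]
      obtain ⟨h₄, h₅⟩ := stepPending_spec (d := d) h₁ g
      have hlC := hl.length_le
      have hgC : g ∈ C x := hl.subset (by simp)
      refine ⟨h₄, ?_, ?_⟩
      · refine h₅.trans ?_
        rw [List.length_append, add_mul]
        simpa using h₂
      · have h₆ := sz_append (RzCount.runSteps d (n x) l).2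
          (RzCount.stepOut d (RzCount.runSteps d (n x) l).1 g)
        have h₇ := (hP ((RzCount.runSteps d (n x) l).1, g)).trans (eval_monotone P
          (show _ ≤ S x + sz (C x) + 1 by
            rw [sz_prod]
            have h₈ := sz_le_of_lengths (A := (C x).length * (growth d (n x) + 1)) (L := n x)
              (h₂.trans (by
                gcongr
                rw [List.length_append] at hlC
                omega)) fun q hq => (h₁ q hq).le
            have h₉ := sz_le_of_mem hgC
            exact Nat.add_le_add_right (Nat.add_le_add h₈ h₉) 1))
        change sz (RzCount.stepOut d (RzCount.runSteps d (n x) l).1 g) ≤ T x at h₇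
        rw [List.length_append, add_mul, List.length_singleton, one_mul]
        simp only at h₆ ⊢
        omega
  obtain ⟨h₁, h₂, h₃⟩ := key l' hl
  have hlC := hl.length_le
  change sz (RzCount.runSteps d (n x) l') ≤ _
  have h₄ : sz (RzCount.runSteps d (n x) l') = sz (RzCount.runSteps d (n x) l').1 +
    sz (RzCount.runSteps d (n x) l').2 + 1 := sz_prod _ _
  rw [h₄]
  refine Nat.add_le_add_right (Nat.add_le_add ?_ (h₃.trans (by gcongr))) 1
  exact sz_le_of_lengths (h₂.trans (by gcongr)) fun q hq => (h₁ q hq).le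

theorem optimize (d : ℕ) : PolyTime fun p : ℕ × List RawGate => optimize d p.1 p.2 := by
  have hs : PolyTime fun p : ℕ × List RawGate => RzCount.splitLastRot p.2 :=
    splitLastRot.comp id.snd
  have hr := runSteps d (id (α := ℕ × List RawGate)).fst hs.fst
  exact append hr.snd (append (extract d (d + 1) (zeros id.fst) hr.fst).snd hs.snd)

end PolyTime

/-! ### Correctness and gate count of the algorithm -/

section

variable {d n : ℕ}

theorem raw_isRot (g : Gate n) : g.raw.isRot = g.isRot := by cases g <;> rfl

theorem encodeGate_eq (g : Gate n) : encodeGate g = Enc.enc g.raw := by cases g <;> rfl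

theorem encodeCircuit_eq (C : Circuit n) : encodeCircuit C = Enc.enc (C.map Gate.raw) := by
  induction C with
  | nil => rfl
  | cons g C ih =>
    rw [encodeCircuit, encodeGate_eq, ih]
    rfl

theorem encodeInput_eq (C : Circuit n) : encodeInput C = Enc.enc (n, C.map Gate.raw) := by
  rw [encodeInput, encodeCircuit_eq]
  rfl

theorem sz_raw_le (g : Gate n) : sz g.raw ≤ 4 * n + 10 := by
  have h : ∀ (a : Fin n) (k : ℕ), (Datum.cons (encodeNat k) (encodeNat a)).size =
      (2 * k + 1) + (2 * a + 1) + 1 := by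
    intro a k
    have h₁ := sz_nat (a : ℕ)
    have h₂ := sz_nat k
    simp only [sz, Enc.enc] at h₁ h₂
    rw [Datum.size, h₁, h₂]
  cases g with
  | cnot c t hct =>
    have h₁ := sz_nat (c : ℕ)
    have h₂ := sz_nat (t : ℕ)
    simp only [sz, Enc.enc] at h₁ h₂
    simp only [sz, Enc.enc, Gate.raw, RawGate.enc, Datum.size, h₁, h₂, encodeNat]
    omega
  | had a =>
    change (Datum.cons (encodeNat 1) (encodeNat a)).size ≤ _
    rw [h]
    omega
  | rot a =>
    change (Datum.cons (encodeNat 2) (encodeNat a)).size ≤ _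
    rw [h]
    omega
  | rotTwo a =>
    change (Datum.cons (encodeNat 3) (encodeNat a)).size ≤ _
    rw [h]
    omega

theorem sz_input_le (C : Circuit n) :
    sz (n, C.map Gate.raw) ≤ 2 * n + 3 + C.length * (4 * n + 11) := by
  have h : sz (C.map Gate.raw) ≤ C.length * (4 * n + 11) + 1 := by
    refine (sz_list_le (M := 4 * n + 10) fun g hg => ?_).trans (by rw [List.length_map])
    obtain ⟨g, -, rfl⟩ := List.mem_map.1 hg
    exact sz_raw_le g
  rw [sz_prod, sz_nat]
  omega

theorem implements_rotFree {C : Circuit n} (hC : C.RotFree) :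
    Implements n d (C.map Gate.raw) (C.unitary d) 0 := by
  refine ⟨C, rfl, rfl, ?_⟩
  rw [Circuit.rotCount, Nat.le_zero, List.countP_eq_zero]
  intro g hg
  simp [hC g hg]

theorem phase_comm (f g : Bits → ℕ) :
    phase n d f * phase n d g = phase n d g * phase n d f := by
  rw [phase_mul, phase_mul]
  simp only [add_comm]

/-- The bound for the number of gates `R_Z(π/2^d)` that are emitted for a Hadamard gate. -/
def hadCost (d n : ℕ) : ℕ := (∑ i ∈ Finset.range d, (n - 1).choose i) + 1

/-- `s` consists of pending parities and a circuit with at most `r` gates `R_Z(π/2^d)` that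
together implement `C`. -/
def Pending (d : ℕ) (C : Circuit n) (s : List Bits × List RawGate) (r : ℕ) : Prop :=
  (∀ q ∈ s.1, q.length = n) ∧
    ∃ M, Implements n d s.2 M r ∧ M * phase n d (wt s.1) = C.unitary d

theorem wt_filter_add (Q : List Bits) (a : ℕ) (x : Bits) :
    wt (Q.filter fun q => bit q a) x + wt (Q.filter fun q => !bit q a) x = wt Q x := by
  rw [← wt_append]
  exact wt_perm (List.filter_append_perm (fun q => bit q a) Q) x

/-- The parities that `a` belongs to can be moved past a Hadamard gate on `a`, except for a part
that is emitted. -/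
theorem had_spec (a : Fin n) {Q : List Bits} (hQ : ∀ q ∈ Q, q.length = n) :
    ∃ M, Implements n d
        (extract d d ((Q.filter fun q => bit q a).headD []) (Q.filter fun q => bit q a)).2 M
        (hadCost d n) ∧
      M * phase n d (wt (extract d d ((Q.filter fun q => bit q a).headD [])
        (Q.filter fun q => bit q a)).1) = phase n d (wt (Q.filter fun q => bit q a)) ∧
      ∀ Y ∈ (extract d d ((Q.filter fun q => bit q a).headD [])
        (Q.filter fun q => bit q a)).1, bit Y a = false := by
  have hQ₁ : ∀ q ∈ Q.filter fun q => bit q a, q.length = n :=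
    fun q hq => hQ q (List.mem_filter.1 hq).1
  have hQa : ∀ q ∈ Q.filter fun q => bit q a, bit q a = true :=
    fun q hq => (List.mem_filter.1 hq).2
  generalize (Q.filter fun q => bit q a) = P at hQ₁ hQa
  cases P with
  | nil =>
    rw [extract_nil]
    refine ⟨1, ?_, by rw [one_mul], by simp⟩
    obtain ⟨C, h₁, h₂, h₃⟩ := implements_nil (n := n) (d := d)
    exact ⟨C, h₁, h₂, h₃.trans (Nat.zero_le _)⟩
  | cons b P =>
    rw [List.headD_cons]
    have hb := hQ₁ b List.mem_cons_self
    -- Only the variable `a` is constant on these parities; removing it leaves `n - 1` variables,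
    -- hence the binomials of `n - 1`. The `1` in `hadCost` pays for the possible copy of `b`.
    obtain ⟨hE, hN, hbits, Q', B, hQB, hcard, hB⟩ := reduce_spec (k := d) hQ₁ hb
      ((Finset.range n).erase a) (fun i hi hiS => by
        have : i = a := by
          by_contra hne
          exact hiS (Finset.mem_erase.2 ⟨hne, Finset.mem_range.2 hi⟩)
        subst this
        exact ⟨hQa b List.mem_cons_self, hQa⟩)
    obtain ⟨f, hf, hfQ⟩ := extract_implements (d := d) hQ₁ hE
    refine ⟨_, ?_, hfQ, bit_of_mem_extract hQ₁ hE hN hQa (hbits a a.2 (by simp))⟩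
    obtain ⟨C, h₁, h₂, h₃⟩ := hf
    refine ⟨C, h₁, h₂, h₃.trans (List.countP_le_length.trans ?_)⟩
    rw [Finset.card_erase_of_mem (Finset.mem_range.2 a.2), Finset.card_range] at hcard
    rw [hQB, List.length_append, hadCost]
    refine Nat.add_le_add hcard ?_
    rcases hB with rfl | rfl <;> simp

/-- The new gate stands to the right of the pending operator and has to be moved to its left or
absorbed; only a Hadamard gate requires part of the pending operator to be emitted. -/
theorem Pending.step {C : Circuit n} {s : List Bits × List RawGate} {r : ℕ}
    (h : Pending d C s r) (g : Gate n) :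
    Pending d (C ++ [g]) (stepPending d n s.1 g.raw, s.2 ++ stepOut d s.1 g.raw)
      (r + if g.isHad then hadCost d n else 0) := by
  obtain ⟨hQ, M, hM, hMC⟩ := h
  refine ⟨(stepPending_spec hQ _).1, ?_⟩
  have hg := implements_gate (d := d) g
  rw [unitary_append, ← hMC, unitary_cons, mul_assoc M]
  cases g with
  | cnot c t hct =>
    refine ⟨_, hM.append hg, ?_⟩
    change _ * cnotMatrix c t * phase n d (wt (s.1.map (pullback c t))) =
      M * (phase n d (wt s.1) * (cnotMatrix c t * 1))
    rw [mul_one, phase_wt_mul_cnotMatrix c t hQ, mul_assoc]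
  | had a =>
    obtain ⟨N, hN, hNQ, hL⟩ := had_spec (d := d) a hQ
    refine ⟨_, hM.append (hN.append hg), ?_⟩
    change M * (N * hadMatrix a) * phase n d (wt (_ ++ _)) =
      M * (phase n d (wt s.1) * (hadMatrix a * 1))
    set L := (extract d d ((s.1.filter fun q => bit q a).headD [])
        (s.1.filter fun q => bit q a)).1 with hLdef
    set Q₀ := s.1.filter fun q => !bit q a with hQ₀
    have h₁ : ∀ q ∈ Q₀ ++ L, bit q a = false := by
      intro q hq
      rcases List.mem_append.1 hq with hq | hq
      · simpa using (List.mem_filter.1 hq).2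
      · exact hL q hq
    have h₂ : phase n d (wt s.1) = N * phase n d (wt (Q₀ ++ L)) := by
      have h₃ : phase n d (wt (Q₀ ++ L)) = phase n d (wt L) * phase n d (wt Q₀) := by
        rw [phase_mul]
        congr 1
        funext x
        rw [wt_append, add_comm]
      rw [h₃, ← mul_assoc, hNQ, phase_mul]
      congr 1
      funext x
      exact (wt_filter_add s.1 a x).symm
    rw [h₂, mul_one, mul_assoc, mul_assoc, mul_assoc N, phase_wt_mul_hadMatrix a h₁]
  | rot a =>
    refine ⟨M, ?_, ?_⟩
    · change Implements n d (s.2 ++ []) M (r + 0)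
      rwa [List.append_nil]
    · change M * phase n d (wt (unitv n a :: s.1)) =
        M * (phase n d (wt s.1) * (rzMatrix (Real.pi / 2 ^ d) a * 1))
      rw [mul_one, rzMatrix_eq, phase_mul]
      congr 1
      rw [phase, phase]
      congr 1
      funext x
      rw [wt_cons, par_unitv n a _ (by simp), add_comm]
  | rotTwo a =>
    refine ⟨_, hM.append hg, ?_⟩
    change M * rzMatrix (2 * Real.pi / 2 ^ d) a * phase n d (wt s.1) =
      M * (phase n d (wt s.1) * (rzMatrix (2 * Real.pi / 2 ^ d) a * 1))
    rw [mul_one, rzMatrix_two_eq, mul_assoc, phase_comm]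

theorem runSteps_append_singleton (C : List RawGate) (g : RawGate) :
    runSteps d n (C ++ [g]) = (stepPending d n (runSteps d n C).1 g,
      (runSteps d n C).2 ++ stepOut d (runSteps d n C).1 g) := by
  simp [runSteps]

/-- Nothing becomes pending before the first rotation, so Hadamard gates up to there cost nothing.
-/
theorem runSteps_rotFree {C : Circuit n} (hC : C.RotFree) :
    runSteps d n (C.map Gate.raw) = ([], C.map Gate.raw) := by
  induction C using List.reverseRecOn with
  | nil => rfl
  | append_singleton C g ih =>
    have hg := hC g (by simp)
    rw [List.map_append, List.map_singleton, runSteps_append_singleton,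
      ih fun g hg => hC g (by simp [hg])]
    cases g with
    | cnot c t h => rfl
    | had a => rfl
    | rot a => simp [Gate.isRot] at hg
    | rotTwo a => rfl

theorem pending_runSteps {C D : Circuit n} (hC : C.RotFree) :
    Pending d (C ++ D) (runSteps d n ((C ++ D).map Gate.raw))
      (D.countP Gate.isHad * hadCost d n) := by
  induction D using List.reverseRecOn with
  | nil =>
    rw [List.append_nil, runSteps_rotFree hC]
    refine ⟨by simp, C.unitary d, by simpa using implements_rotFree hC, ?_⟩
    rw [show phase n d (wt []) = 1 from phase_zero, mul_one]
  | append_singleton D g ih =>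
    have h := ih.step g
    rw [← List.append_assoc, List.map_append, List.map_singleton, runSteps_append_singleton]
    convert h using 1
    rw [List.countP_append, add_mul]
    congr 1
    cases g <;> simp [Gate.isHad]

/-- With no further gate to pass, everything must be emitted: degree `d + 1` in all `n` variables.
-/
theorem pending_finish {C : Circuit n} {s : List Bits × List RawGate} {r : ℕ}
    (h : Pending d C s r) :
    Implements n d (s.2 ++ (extract d (d + 1) (zeros n) s.1).2) (C.unitary d)
      (r + ∑ i ∈ Finset.range (d + 1), n.choose i) := by
  obtain ⟨hQ, M, hM, hMC⟩ := h
  obtain ⟨hE, hN, -, Q', B, hQB, hcard, hB⟩ := reduce_spec (k := d + 1) hQ (length_zeros n)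
    (Finset.range n) fun i hi hi' => absurd (Finset.mem_range.2 hi) hi'
  obtain ⟨f, ⟨D, h₁, h₂, h₃⟩, hfQ⟩ := extract_implements (d := d) hQ hE
  rw [extract_fst_eq_nil hQ hE hN, show phase n d (wt []) = 1 from phase_zero, mul_one] at hfQ
  rw [← hMC, ← hfQ]
  refine hM.append ⟨D, h₁, h₂, h₃.trans ?_⟩
  rw [hQB, List.countP_append]
  rw [Finset.card_range] at hcard
  -- The correcting copy of the base is the zero parity, which emits no gate; so no extra `1`
  -- appears in this bound.
  have hB₀ : (B.countP fun q => !(q == zeros n)) = 0 := by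
    rcases hB with rfl | rfl <;> simp
  rw [hB₀, add_zero]
  exact List.countP_le_length.trans hcard

/-! ### The final part without rotations -/

theorem splitLastRot_append (C : List RawGate) : (splitLastRot C).1 ++ (splitLastRot C).2 = C := by
  induction C with
  | nil => rfl
  | cons g C ih =>
    rw [splitLastRot]
    split_ifs with h
    · have : (splitLastRot C).1 = [] := by simp_all
      rw [this] at ih
      simpa using ih
    · simpa using ih

theorem splitLastRot_snd (C : List RawGate) : ∀ g ∈ (splitLastRot C).2, g.isRot = false := by
  induction C with
  | nil => simp [splitLastRot]
  | cons g C ih =>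
    rw [splitLastRot]
    split_ifs with h
    · intro g' hg'
      rcases List.mem_cons.1 hg' with rfl | hg'
      · simp_all
      · exact ih g' hg'
    · exact ih

theorem splitLastRot_prefix {A B : List RawGate} (hB : ∀ g ∈ B, g.isRot = false) :
    (splitLastRot (A ++ B)).1 <+: A := by
  induction A with
  | nil =>
    suffices h : (splitLastRot B).1 = [] by simp [h]
    induction B with
    | nil => rfl
    | cons g B ih =>
      rw [splitLastRot, if_pos]
      simp [ih fun g hg => hB g (List.mem_cons_of_mem _ hg), hB g List.mem_cons_self]
  | cons g A ih =>
    rw [List.cons_append, splitLastRot]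
    split_ifs
    · exact List.nil_prefix
    · exact (List.prefix_cons_inj g).2 ih

/-- The algorithm does not know the decomposition. As `B` is rotation-free, the part that it treats
is a prefix of `A ++ D`, and only Hadamard gates in a prefix of `D` are charged. -/
theorem optimize_spec {A D B : Circuit n} (hA : A.RotFree) (hB : B.RotFree) :
    Implements n d (optimize d n ((A ++ D ++ B).map Gate.raw)) (Circuit.unitary d (A ++ D ++ B))
      (D.countP Gate.isHad * hadCost d n + ∑ i ∈ Finset.range (d + 1), n.choose i) := by
  set s := splitLastRot ((A ++ D ++ B).map Gate.raw) with hs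
  have happ : (A ++ D ++ B).map Gate.raw = s.1 ++ s.2 := (splitLastRot_append _).symm
  obtain ⟨E, F, hEF, hE, hF⟩ := List.map_eq_append_iff.1 happ
  have hpre : E <+: A ++ D := by
    have h₁ : s.1 <+: (A ++ D).map Gate.raw := by
      rw [hs, List.map_append]
      refine splitLastRot_prefix fun g hg => ?_
      obtain ⟨g', hg', rfl⟩ := List.mem_map.1 hg
      rw [raw_isRot]
      exact hB g' hg'
    have h₂ : E.length ≤ (A ++ D).length := by
      have := h₁.length_le
      rwa [← hE, List.length_map, List.length_map] at this
    exact List.prefix_of_prefix_length_le (hEF ▸ List.prefix_append E F)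
      (List.prefix_append (A ++ D) B) h₂
  -- The treated part may end inside `A`; then no gate of `D` belongs to it.
  have hsplit : ∃ A' D' : Circuit n, E = A' ++ D' ∧ A'.RotFree ∧ D' <+: D := by
    rcases List.prefix_or_prefix_of_prefix hpre (List.prefix_append A D) with h | h
    · exact ⟨E, [], by simp, fun g hg => hA g (h.subset hg), List.nil_prefix⟩
    · obtain ⟨D', rfl⟩ := h
      exact ⟨A, D', rfl, hA, (List.prefix_append_right_inj A).1 hpre⟩
  obtain ⟨A', D', rfl, hA', hD'⟩ := hsplit
  have hFfree : Circuit.RotFree F := by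
    intro g hg
    rw [← raw_isRot]
    exact splitLastRot_snd ((A ++ D ++ B).map Gate.raw) _ (by
      rw [← hs, ← hF]
      exact List.mem_map_of_mem hg)
  have h := (pending_finish (pending_runSteps (d := d) (D := D') hA')).append
    (implements_rotFree (d := d) hFfree)
  rw [← unitary_append, ← hEF, hE, hF, List.append_assoc] at h
  obtain ⟨G, h₁, h₂, h₃⟩ := h
  refine ⟨G, h₁, h₂, h₃.trans ?_⟩
  rw [add_zero]
  have := hD'.sublist.countP_le (p := Gate.isHad)
  gcongr

/-! ### The prescribed form of the input, and the case `d = 2`. -/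

theorem countP_isHad_blocks {U₀ : Circuit n} {blocks : List (Fin n × Circuit n)} (h₀ : U₀.HadFree)
    (hb : ∀ b ∈ blocks, b.2.HadFree) :
    (U₀ ++ blocks.flatMap fun b => Gate.had b.1 :: b.2).countP Gate.isHad = blocks.length := by
  have hfree : ∀ C : Circuit n, C.HadFree → C.countP Gate.isHad = 0 := by
    intro C hC
    rw [List.countP_eq_zero]
    intro g hg
    simp [hC g hg]
  rw [List.countP_append, hfree U₀ h₀, zero_add]
  induction blocks with
  | nil => rfl
  | cons b blocks ih =>
    rw [List.flatMap_cons, List.countP_append, ih fun b hb' => hb b (List.mem_cons_of_mem _ hb'),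
      List.countP_cons, hfree b.2 (hb b List.mem_cons_self), List.length_cons]
    simp [Gate.isHad]
    omega

theorem unitary_blocks (blocks : List (Fin n × Circuit n)) :
    Circuit.unitary d (blocks.flatMap fun b => Gate.had b.1 :: b.2) =
      (blocks.map fun b => hadMatrix b.1 * b.2.unitary d).prod := by
  induction blocks with
  | nil => rfl
  | cons b blocks ih =>
    rw [List.flatMap_cons, unitary_append, ih, unitary_cons, List.map_cons, List.prod_cons]
    rfl

/-- Equality holds for positive `n`. For `n = 0` the truncated `n - 1` would spoil the estimate, but
without qubits there are no Hadamard gates. -/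
theorem count_bound_two (h : ℕ) (hn : n = 0 → h = 0) :
    (((∑ i ∈ Finset.range (2 + 1), n.choose i) +
        h * ((∑ i ∈ Finset.range 2, (n - 1).choose i) + 1) : ℕ) : ℚ) ≤
      ((n : ℚ) + 1) * ((n : ℚ) + 2 * (h : ℚ)) / 2 + 1 := by
  cases n with
  | zero => simp [hn rfl, Finset.sum_range_succ]
  | succ m =>
    simp only [Finset.sum_range_succ, Finset.sum_range_zero, Nat.choose_zero_right,
      Nat.choose_one_right, Nat.add_sub_cancel]
    push_cast [Nat.cast_choose_two]
    apply le_of_eq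
    ring

end

end RzCount

open RzCount

theorem mainTheorem1 (d : ℕ) :
    ∃ (P : Program) (p : Polynomial ℕ),
      ∀ (n : ℕ) (Cfin U₀ Cinit : Circuit n) (blocks : List (Fin n × Circuit n))
        (U : Operator n) (C : Circuit n),
        Cfin.RotFree → Cinit.RotFree → U₀.HadFree → (∀ b ∈ blocks, b.2.HadFree) →
        -- the unitary `C_f U₀ ∏ᵢ [H_{αᵢ} Uᵢ] C_init`, where `blocks` lists the pairs `(αᵢ, Uᵢ)`
        U = Cfin.unitary d * U₀.unitary d
          * (blocks.map fun b => hadMatrix b.1 * b.2.unitary d).prod * Cinit.unitary d →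
        -- the circuit that spells out this product
        C = Cfin ++ U₀ ++ (blocks.flatMap fun b => Gate.had b.1 :: b.2) ++ Cinit →
        ∃ (C' : Circuit n) (t : ℕ),
          Runs P (encodeInput C) (encodeCircuit C') t ∧
          t ≤ p.eval (n + C.length) ∧
          C'.unitary d = U ∧
          C'.rotCount ≤ (∑ i ∈ Finset.range (d + 1), n.choose i)
            + blocks.length * ((∑ i ∈ Finset.range d, (n - 1).choose i) + 1) ∧
          (d = 2 → (C'.rotCount : ℚ)
            ≤ ((n : ℚ) + 1) * ((n : ℚ) + 2 * (blocks.length : ℚ)) / 2 + 1) := by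
  obtain ⟨P, T, ⟨p, hp⟩, hP⟩ := PolyTime.optimize d
  -- The inner polynomial bounds the size of the encoded input as in `sz_input_le`, with `n` and the
  -- number of gates both replaced by their sum.
  refine ⟨P, p.comp (2 * Polynomial.X + 3 + Polynomial.X * (4 * Polynomial.X + 11)), ?_⟩
  intro n Cfin U₀ Cinit blocks U C hCf hCi hU₀ hb hU hC
  set D := U₀ ++ blocks.flatMap fun b => Gate.had b.1 :: b.2 with hD
  have hC' : C = Cfin ++ D ++ Cinit := by rw [hC, hD, ← List.append_assoc]
  obtain ⟨C', h₁, h₂, h₃⟩ := optimize_spec (d := d) (D := D) hCf hCi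
  rw [← hC'] at h₁ h₂
  obtain ⟨t, ht, htT⟩ := hP (n, C.map Gate.raw)
  have hcount : C'.rotCount ≤ (∑ i ∈ Finset.range (d + 1), n.choose i)
      + blocks.length * ((∑ i ∈ Finset.range d, (n - 1).choose i) + 1) := by
    rw [countP_isHad_blocks hU₀ hb, add_comm] at h₃
    exact h₃
  refine ⟨C', t, ?_, ?_, ?_, hcount, ?_⟩
  · rw [encodeInput_eq, encodeCircuit_eq, h₁]
    exact ht
  · refine htT.trans ((hp _).trans ?_)
    rw [Polynomial.eval_comp]
    refine eval_monotone p ((sz_input_le C).trans ?_)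
    simp only [Polynomial.eval_add, Polynomial.eval_mul, Polynomial.eval_X, Polynomial.eval_ofNat]
    gcongr <;> omega
  · rw [h₂, hU, hC', unitary_append, unitary_append, hD, unitary_append, unitary_blocks]
    simp only [mul_assoc]
  · rintro rfl
    refine le_trans (Nat.cast_le.2 hcount) (count_bound_two blocks.length fun hn => ?_)
    subst hn
    cases blocks with
    | nil => rfl
    | cons b blocks => exact b.1.elim0
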